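/- Let $M$ be a smooth manifold and $A\to M$ a smooth real vector bundle of finite rank with space of smooth sections $\Gamma(A)$. Let $\rho\colon A\to TM$ be a smooth vector bundle morphism over $\mathrm{id}_M$ (the anchor) that is surjective on every fiber, so that $(A,\rho)$ is a transitive anchored bundle, and let $\nabla$ be a $TM$-connection (a smooth linear connection) on $A$. Let $[\cdot,\cdot]\colon\Gamma(A)\times\Gamma(A)\to\Gamma(A)$ be a map, and for $X,Y\in\Gamma(A)$ put $$X\triangleright Y:=\nabla_{\rho(X)}Y,\qquad \llbracket X,Y\rrbracket:=X\triangleright Y-Y\triangleright X+[X,Y].$$ Call $(A,\rho,[\cdot,\cdot],\nabla)$ a post-Lie algebroid if $[\cdot,\cdot]$ is a Lie bracket on $\Gamma(A)$ that is $C^\infty(M)$-bilinear and, for all $X,Y,Z\in\Gamma(A)$, $$X\triangleright[Y,Z]=[X\triangleright Y,Z]+[Y,X\triangleright Z],$$ $$[X,Y]\triangleright Z=a(X,Y,Z)-a(Y,X,Z),\quad\text{where } a(X,Y,Z)=X\triangleright(Y\triangleright Z)-(X\triangleright Y)\triangleright Z.$$ An action of a finite-dimensional real Lie algebra $\mathfrak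 g$ on an open set $U\subseteq M$ is a Lie algebra homomorphism $\mathfrak g\to\mathfrak X(U)$, $\xi\mapsto\xi_U$; it is transitive if $\xi\mapsto\xi_U(x)$ maps $\mathfrak g$ onto $T_xM$ for every $x\in U$. Its action algebroid $\mathfrak g\ltimes U$ is the trivial bundle $\mathfrak g\times U\to U$ with anchor $(\xi,x)\mapsto\xi_U(x)$ and with the bracket on sections that agrees with the bracket of $\mathfrak g$ on constant sections and satisfies the Leibniz rule; its canonical flat connection is the connection for which constant sections are parallel. **Theorem.** $(A,\rho,[\cdot,\cdot],\nabla)$ is a post-Lie algebroid if and only if every point of $M$ has an open neighborhood $U$ such that, for some finite-dimensional real Lie algebra $\mathfrak g$ and some transitive action of $\mathfrak g$ on $U$, there is a vector bundle isomorphism of $A|_U$ with $\mathfrak g\times U$ over $\mathrm{id}_U$ that carries the anchor $\rho$, the bracket $\llbracket\cdot,\cdot\rrbracket$ and the connection $\nabla$ (restricted to $U$) to the anchor, the bracket and the canonical flat connection of $\mathfrak g\ltimes U$. If $M$ is simply connected, then $(A,\rho,[\cdot,\cdot],\nabla)$ is a post-Lie algebroid if and only if this holds with $U=M$. -/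

import Mathlib

open Bundle
open scoped Manifold ContDiff

noncomputable section

namespace Algebroid

/-! ### Algebra: Lie brackets and post-Lie algebras -/

/-- `b` is a Lie bracket on the real vector space `L`. -/
structure IsLieBracket {L : Type*} [AddCommGroup L] [Module ℝ L] (b : L → L → L) : Prop where
  add_left : ∀ X Y Z, b (X + Y) Z = b X Z + b Y Z
  add_right : ∀ X Y Z, b X (Y + Z) = b X Y + b X Z
  smul_left : ∀ (r : ℝ) (X Y), b (r • X) Y = r • b X Y
  smul_right : ∀ (r : ℝ) (X Y), b X (r • Y) = r • b X Y
  self : ∀ X, b X X = 0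
  jacobi : ∀ X Y Z, b X (b Y Z) + b Y (b Z X) + b Z (b X Y) = 0

/-- The bracket of a Mathlib Lie algebra is a Lie bracket in the above sense. -/
theorem isLieBracket_lie {L : Type*} [LieRing L] [LieAlgebra ℝ L] :
    IsLieBracket (fun X Y : L => ⁅X, Y⁆) where
  add_left := add_lie
  add_right := lie_add
  smul_left := smul_lie
  smul_right := fun r X Y => lie_smul r X Y
  self := lie_self
  jacobi := lie_jacobi

/-- The associator `a(X, Y, Z) = X ▷ (Y ▷ Z) - (X ▷ Y) ▷ Z` of a product `▷`. -/
def assoc {L : Type*} [AddCommGroup L] (tri : L → L → L) (X Y Z : L) : L :=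
  tri X (tri Y Z) - tri (tri X Y) Z

/-- The associator triple bracket `[X, Y, Z] = a(X, Y, Z) - a(Y, X, Z)`. -/
def tripleBracket {L : Type*} [AddCommGroup L] (tri : L → L → L) (X Y Z : L) : L :=
  assoc tri X Y Z - assoc tri Y X Z

/-- `(L, b, ▷)` is a post-Lie algebra: `b` is a Lie bracket, the product `▷` is bilinear,
`X ▷ [Y, Z] = [X ▷ Y, Z] + [Y, X ▷ Z]` and `[X, Y] ▷ Z = [X, Y, Z]`. -/
structure IsPostLieAlgebra {L : Type*} [AddCommGroup L] [Module ℝ L]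
    (b tri : L → L → L) : Prop where
  lie : IsLieBracket b
  tri_add_left : ∀ X Y Z, tri (X + Y) Z = tri X Z + tri Y Z
  tri_add_right : ∀ X Y Z, tri X (Y + Z) = tri X Y + tri X Z
  tri_smul_left : ∀ (r : ℝ) (X Y), tri (r • X) Y = r • tri X Y
  tri_smul_right : ∀ (r : ℝ) (X Y), tri X (r • Y) = r • tri X Y
  derivation : ∀ X Y Z, tri X (b Y Z) = b (tri X Y) Z + b Y (tri X Z)
  bracket_tri : ∀ X Y Z, tri (b X Y) Z = tripleBracket tri X Y Z

/-! ### Anchored bundles, connections and post-Lie algebroids -/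

section Bundles

variable {E : Type*} [NormedAddCommGroup E] [NormedSpace ℝ E]
  {H : Type*} [TopologicalSpace H] {I : ModelWithCorners ℝ E H}
  {M : Type*} [TopologicalSpace M] [ChartedSpace H M] [IsManifold I ∞ M]
  {F : Type*} [NormedAddCommGroup F] [NormedSpace ℝ F]
  {A : M → Type*} [TopologicalSpace (TotalSpace F A)]
  [∀ x, AddCommGroup (A x)] [∀ x, Module ℝ (A x)] [∀ x, TopologicalSpace (A x)]
  [FiberBundle F A] [VectorBundle ℝ F A]

/-- The product `f • X` of a smooth function and a smooth section. -/
instance instSMulSmoothSection : SMul C^∞⟮I, M; ℝ⟯ Cₛ^∞⟮I; F, A⟯ where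
  smul f X := ⟨fun x => f x • X x, f.contMDiff.smul_section X.contMDiff⟩

variable (I F A) in
/-- An anchor on `A`: a smooth vector bundle morphism `A → TM` over the identity of `M`. -/
structure Anchor where
  toFun : ∀ x : M, A x →L[ℝ] TangentSpace I x
  contMDiff_toFun : ContMDiff (I.prod 𝓘(ℝ, F)) (I.prod 𝓘(ℝ, E)) ∞
    (fun p : TotalSpace F A => (⟨p.1, toFun p.1 p.2⟩ : TotalSpace E (TangentSpace I : M → Type _)))

/-- The anchored bundle is transitive: the anchor is surjective (on every fiber). -/
def Anchor.IsTransitive (ρ : Anchor I F A) : Prop :=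
  ∀ x, Function.Surjective (ρ.toFun x)

/-- `nab` is an `A`-connection on `A`; here `mvfderiv I f x (ρ.toFun x (X x))` is the value at `x`
of the derivative `ρ(X)[f]`. -/
structure IsAConnection (ρ : Anchor I F A)
    (nab : Cₛ^∞⟮I; F, A⟯ → Cₛ^∞⟮I; F, A⟯ → Cₛ^∞⟮I; F, A⟯) : Prop where
  add_left : ∀ X Y Z, nab (X + Y) Z = nab X Z + nab Y Z
  add_right : ∀ X Y Z, nab X (Y + Z) = nab X Y + nab X Z
  smul_left : ∀ (r : ℝ) (X Y), nab (r • X) Y = r • nab X Y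
  smul_right : ∀ (r : ℝ) (X Y), nab X (r • Y) = r • nab X Y
  smooth_smul_left : ∀ (f : C^∞⟮I, M; ℝ⟯) (X Y), nab (f • X) Y = f • nab X Y
  leibniz : ∀ (f : C^∞⟮I, M; ℝ⟯) (X Y) (x : M),
    nab X (f • Y) x = mvfderiv I f x (ρ.toFun x (X x)) • Y x + f x • nab X Y x

/-- `(A, ρ, br, nab)` is a post-Lie algebroid: `nab` is an `A`-connection on `A`, `br` is a
tensorial Lie bracket on `Γ(A)`, and `(Γ(A), br, ▷)` with `X ▷ Y = nab X Y` is a post-Lie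
algebra. -/
structure IsPostLieAlgebroid (ρ : Anchor I F A)
    (br nab : Cₛ^∞⟮I; F, A⟯ → Cₛ^∞⟮I; F, A⟯ → Cₛ^∞⟮I; F, A⟯) : Prop where
  connection : IsAConnection ρ nab
  tensorial_left : ∀ (f : C^∞⟮I, M; ℝ⟯) (X Y), br (f • X) Y = f • br X Y
  tensorial_right : ∀ (f : C^∞⟮I, M; ℝ⟯) (X Y), br X (f • Y) = f • br X Y
  postLie : IsPostLieAlgebra br nab

/-- The bracket `⟦X, Y⟧ = X ▷ Y - Y ▷ X + [X, Y]` determined by `[·,·] = br` and `▷ = nab`. -/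
def algebroidBracket (br nab : Cₛ^∞⟮I; F, A⟯ → Cₛ^∞⟮I; F, A⟯ → Cₛ^∞⟮I; F, A⟯)
    (X Y : Cₛ^∞⟮I; F, A⟯) : Cₛ^∞⟮I; F, A⟯ :=
  nab X Y - nab Y X + br X Y

section Induced

variable [∀ x, IsTopologicalAddGroup (A x)] [∀ x, ContinuousSMul ℝ (A x)]

/-- The product `X ▷ Y = ∇_{ρ(X)} Y` on `Γ(A)` given by a smooth `TM`-connection `∇ = cov` on `A`.
(In Mathlib's convention `cov Y x v` is `(∇_v Y)(x)`.) -/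
def inducedConnection (ρ : Anchor I F A) (cov : CovariantDerivative I F A)
    [hcov : CovariantDerivative.ContMDiffCovariantDerivative cov ∞]
    (X Y : Cₛ^∞⟮I; F, A⟯) : Cₛ^∞⟮I; F, A⟯ where
  toFun x := cov Y x (ρ.toFun x (X x))
  contMDiff_toFun := by
    have h1 := hcov.contMDiff.contMDiff (σ := fun x => Y x) Y.contMDiff.contMDiffOn
    have h2 : ContMDiff I (I.prod 𝓘(ℝ, E)) ∞
        (fun x => (⟨x, ρ.toFun x (X x)⟩ : TotalSpace E (TangentSpace I : M → Type _))) :=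
      ρ.contMDiff_toFun.comp X.contMDiff
    intro x
    exact (((contMDiffOn_univ.1 h1) x).clm_bundle_apply (h2 x))

end Induced

end Bundles

/-! ### Lie algebra actions and action algebroids -/

/-- Together with `NormedLieAlgebra`: a real Lie algebra equipped with some norm. The norm and the
bracket are not related by any condition; on a finite-dimensional Lie algebra the norm is only used
for speaking of smoothness and derivatives of functions with values in the Lie algebra. -/
class NormedLieRing (𝔤 : Type*) extends NormedAddCommGroup 𝔤, LieRing 𝔤

/-- See `NormedLieRing`. -/
class NormedLieAlgebra (𝔤 : Type*) [NormedLieRing 𝔤] extends NormedSpace ℝ 𝔤, LieAlgebra ℝ 𝔤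

section Actions

variable {E : Type*} [NormedAddCommGroup E] [NormedSpace ℝ E]
  {H : Type*} [TopologicalSpace H]
  {M : Type*} [TopologicalSpace M] [ChartedSpace H M]

/-- An action of the Lie algebra `𝔤` on the open submanifold `U` of `M`: a Lie algebra homomorphism
from `𝔤` to the smooth vector fields on `U`. Vector fields on `U` are represented by functions on
`M` whose values outside `U` are irrelevant. -/
structure LieAlgebraAction (I : ModelWithCorners ℝ E H) (𝔤 : Type*) [NormedLieRing 𝔤]
    [NormedLieAlgebra 𝔤] [IsManifold I ∞ M] (U : TopologicalSpace.Opens M) where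
  toFun : 𝔤 →ₗ[ℝ] (∀ x : M, TangentSpace I x)
  contMDiffOn_toFun : ∀ ξ : 𝔤, ContMDiffOn I (I.prod 𝓘(ℝ, E)) ∞
    (fun x => (⟨x, toFun ξ x⟩ : TotalSpace E (TangentSpace I : M → Type _))) U
  map_lie : ∀ ξ η : 𝔤, ∀ x ∈ U,
    toFun ⁅ξ, η⁆ x = VectorField.mlieBracket I (toFun ξ) (toFun η) x

variable {I : ModelWithCorners ℝ E H} [IsManifold I ∞ M]
  {𝔤 : Type*} [NormedLieRing 𝔤] [NormedLieAlgebra 𝔤] {U : TopologicalSpace.Opens M}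

namespace LieAlgebraAction

/-- The anchor `(ξ, x) ↦ ξ_U(x)` of the action algebroid `𝔤 ⋉ U`, whose underlying vector bundle is
the trivial bundle `𝔤 × U → U`. -/
def anchor (a : LieAlgebraAction I 𝔤 U) (x : M) (ξ : 𝔤) : TangentSpace I x := a.toFun ξ x

/-- The action is transitive on `U`. -/
def IsTransitive (a : LieAlgebraAction I 𝔤 U) : Prop :=
  ∀ x ∈ U, Function.Surjective (a.anchor x)

/-- The bracket of the action algebroid `𝔤 ⋉ U`. Its sections are the smooth functions `u : U → 𝔤`,
and `⟦u, v⟧ = [u, v]_𝔤 + ρ(u)[v] - ρ(v)[u]`; by `bracket_const` and `bracket_smul_right` below this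
is the bracket that agrees with that of `𝔤` on constant sections and satisfies the Leibniz rule. -/
def bracket (a : LieAlgebraAction I 𝔤 U) (u v : M → 𝔤) (x : M) : 𝔤 :=
  ⁅u x, v x⁆ + mvfderiv I v x (a.anchor x (u x)) - mvfderiv I u x (a.anchor x (v x))

theorem bracket_const (a : LieAlgebraAction I 𝔤 U) (ξ η : 𝔤) (x : M) :
    a.bracket (fun _ => ξ) (fun _ => η) x = ⁅ξ, η⁆ := by
  simp [bracket, mvfderiv_const]

theorem bracket_smul_right (a : LieAlgebraAction I 𝔤 U) (u v : M → 𝔤) (f : M → ℝ) (x : M)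
    (hf : MDifferentiableAt I 𝓘(ℝ, ℝ) f x) (hv : MDifferentiableAt I 𝓘(ℝ, 𝔤) v x) :
    a.bracket u (f • v) x =
      mvfderiv I f x (a.anchor x (u x)) • v x + f x • a.bracket u v x := by
  have h : a.anchor x (f x • v x) = f x • a.anchor x (v x) := by
    simp [anchor]
  simp only [bracket, Pi.smul_apply', h, mvfderiv_smul hf hv]
  simp only [lie_smul, map_smul, add_apply, smul_sub, smul_add, FunLike.coe_smul,
    Pi.smul_apply, ContinuousLinearMap.smulRight_apply]
  abel

/-- The canonical flat connection on the trivial bundle `𝔤 × U`: the `TM`-connection that is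
given by differentiating `𝔤`-valued functions, so that constant sections are flat. -/
def canonicalFlatConnection (_a : LieAlgebraAction I 𝔤 U) (u : M → 𝔤) (x : M)
    (w : TangentSpace I x) : 𝔤 :=
  mvfderiv I u x w

end LieAlgebraAction

variable {F : Type*} [NormedAddCommGroup F] [NormedSpace ℝ F]
  {A : M → Type*} [TopologicalSpace (TotalSpace F A)]
  [∀ x, AddCommGroup (A x)] [∀ x, Module ℝ (A x)] [∀ x, TopologicalSpace (A x)]
  [FiberBundle F A] [VectorBundle ℝ F A]
  [∀ x, IsTopologicalAddGroup (A x)] [∀ x, ContinuousSMul ℝ (A x)]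

/-- An isomorphism over `U` between `(A, ρ, ⟦·,·⟧)` and the action algebroid `𝔤 ⋉ U`, carrying the
`TM`-connection `cov` on `A` to the canonical flat connection.

It consists of a smooth vector bundle isomorphism `hom : 𝔤 × U → A|_U` with smooth inverse `inv`
(the values outside `U` are irrelevant) compatible with the anchors, brackets and connections.
The compatibility with brackets and connections is expressed on restrictions to `U` of sections of
`A`; at a point of `U`, the right-hand sides depend on `inv` only near this point. -/
structure ActionAlgebroidIso (ρ : Anchor I F A)
    (bkt : Cₛ^∞⟮I; F, A⟯ → Cₛ^∞⟮I; F, A⟯ → Cₛ^∞⟮I; F, A⟯)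
    (cov : CovariantDerivative I F A) (a : LieAlgebraAction I 𝔤 U) where
  hom : ∀ x : M, 𝔤 →L[ℝ] A x
  inv : ∀ x : M, A x →L[ℝ] 𝔤
  inv_hom : ∀ x ∈ U, ∀ ξ : 𝔤, inv x (hom x ξ) = ξ
  hom_inv : ∀ x ∈ U, ∀ v : A x, hom x (inv x v) = v
  contMDiffOn_hom : ContMDiffOn (I.prod 𝓘(ℝ, 𝔤)) (I.prod 𝓘(ℝ, F)) ∞
    (fun p : M × 𝔤 => (⟨p.1, hom p.1 p.2⟩ : TotalSpace F A)) {p | p.1 ∈ U}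
  contMDiffOn_inv : ContMDiffOn (I.prod 𝓘(ℝ, F)) (I.prod 𝓘(ℝ, 𝔤)) ∞
    (fun p : TotalSpace F A => ((p.1, inv p.1 p.2) : M × 𝔤)) {p | p.1 ∈ U}
  anchor_hom : ∀ x ∈ U, ∀ ξ : 𝔤, ρ.toFun x (hom x ξ) = a.anchor x ξ
  inv_bracket : ∀ X Y : Cₛ^∞⟮I; F, A⟯, ∀ x ∈ U,
    inv x (bkt X Y x) = a.bracket (fun y => inv y (X y)) (fun y => inv y (Y y)) x
  inv_connection : ∀ Y : Cₛ^∞⟮I; F, A⟯, ∀ x ∈ U, ∀ w : TangentSpace I x,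
    inv x (cov Y x w) = a.canonicalFlatConnection (fun y => inv y (Y y)) x w

/-- Over `U`, `(A, ρ, ⟦·,·⟧)` is isomorphic to the action algebroid of a transitive action on `U` of
some finite-dimensional real Lie algebra, with `cov` the canonical flat connection. -/
def IsTransitiveActionAlgebroidOver (U : TopologicalSpace.Opens M) (ρ : Anchor I F A)
    (bkt : Cₛ^∞⟮I; F, A⟯ → Cₛ^∞⟮I; F, A⟯ → Cₛ^∞⟮I; F, A⟯)
    (cov : CovariantDerivative I F A) : Prop :=
  ∃ (𝔤 : Type) (_ : NormedLieRing 𝔤) (_ : NormedLieAlgebra 𝔤) (_ : FiniteDimensional ℝ 𝔤)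
    (a : LieAlgebraAction I 𝔤 U), a.IsTransitive ∧ Nonempty (ActionAlgebroidIso ρ bkt cov a)

/-- Every point of `M` has an open neighborhood over which `(A, ρ, ⟦·,·⟧)` is isomorphic to a
transitive action algebroid, with `cov` the canonical flat connection. -/
def IsLocallyTransitiveActionAlgebroid (ρ : Anchor I F A)
    (bkt : Cₛ^∞⟮I; F, A⟯ → Cₛ^∞⟮I; F, A⟯ → Cₛ^∞⟮I; F, A⟯)
    (cov : CovariantDerivative I F A) : Prop :=
  ∀ x : M, ∃ U : TopologicalSpace.Opens M, x ∈ U ∧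
    IsTransitiveActionAlgebroidOver U ρ bkt cov

end Actions

end Algebroid

end

open Algebroid

open Bundle
open scoped Manifold ContDiff

noncomputable section

/-! Written with `⟦X, Y⟧`, the axiom for `[X, Y] ▷ Z` says `⟦X, Y⟧ ▷ Z = X ▷ (Y ▷ Z) - Y ▷ (X ▷ Z)`
(`flat_algebroidBracket`). Replacing `Z` by `f • Z` and comparing the terms that contain `Z`
undifferentiated gives `ρ⟦X, Y⟧ = [ρX, ρY]` (`anchorField_algebroidBracket`). Since `ρ` is onto, the
two facts together say that `∇` has zero curvature (`IsLocalCoords.flat`).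

A flat connection has parallel frames near every point (`exists_isParallelFrame`). This is the
linear case of the Frobenius theorem, `exists_flat_solution`, which is proved by solving an ODE
along each ray and using flatness to differentiate the endpoint in the direction of the ray.

The derivation axiom says that the tensor `[·,·]` is parallel, so its structure constants in a
parallel frame are locally constant (`eventually_frameBracket_eq`). Over a connected open set they
define a single Lie algebra `𝔤`. On parallel sections `⟦·,·⟧` and `[·,·]` agree, so `ρ` turns
parallel sections into a `𝔤`-action (`anchor_hom_frameBracket`), and the frame is the required
isomorphism (`IsParallelFrame.isTransitiveActionAlgebroidOver`).

Conversely, in an action algebroid the derivative terms of the bracket are the `∇`-terms of `⟦·,·⟧`,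
so `[·,·]` is the pointwise bracket of `𝔤` (`ActionAlgebroidIso.inv_br`). The axioms can then be
checked point by point: the derivation rule is the product rule, and the last axiom is the formula
for a vector field commutator acting on functions.

If `M` is simply connected, the locally constant transition functions between parallel frames define
covering spaces with sections through every point, hence global parallel sections and a global frame
(`exists_section_of_locally_constant_cocycle`, `exists_isParallelFrame_top`). -/

namespace Algebroid

set_option maxSynthPendingDepth 3
set_option linter.unusedSectionVars false

/-! ### Frobenius theorem for linear total differential systems. -/

section FlatSystem

open Metric Set

variable {E : Type*} [NormedAddCommGroup E] [NormedSpace ℝ E]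
  {W : Type*} [NormedAddCommGroup W] [NormedSpace ℝ W]

/-- The integrability condition of the total differential system `dy = L y`. -/
def IsFlatSystemAt (L : E → E →L[ℝ] W →L[ℝ] W) (z : E) : Prop :=
  ∀ h k : E, fderiv ℝ L z h k + (L z k).comp (L z h) = fderiv ℝ L z k h + (L z h).comp (L z k)

/-- Along a ray the system becomes a linear ODE whose coefficient has norm at most `1 / 2`, so
Picard–Lindelöf reaches time `1` without any continuation argument. -/
theorem exists_radial_solution [CompleteSpace W] {L : E → E →L[ℝ] W →L[ℝ] W} {z₀ : E} {r C : ℝ}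
    (hL : ContinuousOn L (ball z₀ r)) (hC : ∀ z ∈ ball z₀ r, ‖L z‖ ≤ C) (hCr : C * r ≤ 1 / 2)
    (y₀ : W) {x : E} (hx : ‖x‖ < r) :
    ∃ Y : ℝ → W, Y 0 = y₀ ∧ ∀ t ∈ Icc (0 : ℝ) 1,
      HasDerivWithinAt Y (L (z₀ + t • x) x (Y t)) (Icc 0 1) t := by
  have hmem : ∀ t ∈ Icc (0 : ℝ) 1, z₀ + t • x ∈ ball z₀ r := by
    intro t ht
    rw [mem_ball_iff_norm, add_sub_cancel_left, norm_smul, Real.norm_of_nonneg ht.1]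
    nlinarith [ht.2, norm_nonneg x]
  have hr : 0 < r := (norm_nonneg x).trans_lt hx
  have hC0 : 0 ≤ C := (norm_nonneg _).trans (hC z₀ (mem_ball_self hr))
  have hop : ∀ t ∈ Icc (0 : ℝ) 1, ‖L (z₀ + t • x) x‖ ≤ 1 / 2 := fun t ht =>
    ((L _).le_opNorm x).trans
      ((mul_le_mul (hC _ (hmem t ht)) hx.le (norm_nonneg _) hC0).trans hCr)
  -- On the ball of radius `‖y₀‖ + 1` around `y₀` the speed is at most `(2‖y₀‖ + 1) / 2 ≤ ‖y₀‖ + 1`,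
  -- so a solution cannot leave this ball before time `1`.
  have hpl : IsPicardLindelof (fun t y => L (z₀ + t • x) x y) (tmin := 0) (tmax := 1)
      ⟨0, by simp⟩ y₀ (‖y₀‖₊ + 1) 0 (‖y₀‖₊ + 1) 1 := by
    refine ⟨fun t ht => ?_, fun y _ => ?_, fun t ht y hy => ?_, by simp⟩
    · refine (LipschitzWith.lipschitzOnWith ?_)
      refine ((L (z₀ + t • x) x).lipschitz).weaken ?_
      rw [← NNReal.coe_le_coe]
      exact (hop t ht).trans (by norm_num)
    · have h1 : ContinuousOn (fun t : ℝ => L (z₀ + t • x)) (Icc 0 1) :=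
        hL.comp (by fun_prop) hmem
      exact (h1.clm_apply continuousOn_const).clm_apply continuousOn_const
    · refine ((L (z₀ + t • x) x).le_opNorm y).trans ?_
      have h2 : ‖y‖ ≤ ‖y₀‖ + (‖y₀‖ + 1) := by
        have := norm_le_norm_add_norm_sub' y y₀
        have h3 : ‖y - y₀‖ ≤ ‖y₀‖ + 1 := by simpa [dist_eq_norm] using hy
        linarith
      have := mul_le_mul (hop t ht) h2 (norm_nonneg _) (by norm_num)
      push_cast
      linarith [norm_nonneg y₀]
  exact hpl.exists_eq_forall_mem_Icc_hasDerivWithinAt₀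

/-- Mean value inequality on the segment, where the derivative differs from its value at `z` by at
most `K * ‖z' - z‖`. The sharp constant `K / 2` is not needed. -/
theorem norm_taylor_le {G : Type*} [NormedAddCommGroup G] [NormedSpace ℝ G]
    {f : E → G} {s : Set E} (hs : Convex ℝ s) (ho : IsOpen s)
    (hf : DifferentiableOn ℝ f s) {K : NNReal} (hK : LipschitzOnWith K (fderiv ℝ f) s)
    {z z' : E} (hz : z ∈ s) (hz' : z' ∈ s) :
    ‖f z' - f z - fderiv ℝ f z (z' - z)‖ ≤ K * ‖z' - z‖ ^ 2 := by
  have hseg : segment ℝ z z' ⊆ s := hs.segment_subset hz hz'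
  have := (convex_segment z z').norm_image_sub_le_of_norm_hasFDerivWithin_le'
    (f := f) (f' := fderiv ℝ f) (φ := fderiv ℝ f z) (C := K * ‖z' - z‖)
    (fun w hw => ((hf.differentiableAt (ho.mem_nhds (hseg hw))).hasFDerivAt).hasFDerivWithinAt)
    (fun w hw => ((hK.norm_sub_le (hseg hw) hz)).trans
      (mul_le_mul_of_nonneg_left (by
        obtain ⟨a, b, ha, hb, hab, rfl⟩ := hw
        have : a • z + b • z' - z = b • (z' - z) := by
          rw [← eq_sub_iff_add_eq] at hab
          rw [hab]; module
        rw [this, norm_smul, Real.norm_of_nonneg hb]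
        exact mul_le_of_le_one_left (norm_nonneg _) (by linarith)) K.coe_nonneg))
    (left_mem_segment ℝ z z') (right_mem_segment ℝ z z')
  rw [pow_two, ← mul_assoc]
  exact this

/-- The infinitesimal heart of the Frobenius argument. Here `A` and `A'` stand for `L` at `z₀ + t •
x` and `z₀ + t • (x + h)`, and `D` for the derivative of `L` at the former. The curve `y + t • A h
y` solves the ODE of the ray `x + h` up to an error quadratic in `h`. -/
theorem norm_flat_error_le {A A' : E →L[ℝ] W →L[ℝ] W} {D : E →L[ℝ] E →L[ℝ] W →L[ℝ] W}
    {x h : E} {t C K : ℝ} (ht : t ∈ Icc (0 : ℝ) 1) (hA : ‖A‖ ≤ C) (hD : ‖D‖ ≤ C)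
    (hflat : D x h + (A h).comp (A x) = D h x + (A x).comp (A h))
    (hR : ‖A' - A - D (t • h)‖ ≤ K * ‖t • h‖ ^ 2) (hxh : ‖x + h‖ ≤ 1) (hh : ‖h‖ ≤ 1)
    (hK : 0 ≤ K) (y : W) :
    ‖(A x y + (A h y + t • (D x h y + A h (A x y)))) - A' (x + h) (y + t • A h y)‖ ≤
      (C * C + C + C * C + K * (1 + C)) * ‖y‖ * ‖h‖ ^ 2 := by
  have hC : 0 ≤ C := (norm_nonneg _).trans hA
  have hf := congrArg (fun T : W →L[ℝ] W => T y) hflat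
  simp only [add_apply, ContinuousLinearMap.comp_apply] at hf
  set R := A' - A - D (t • h) with hRdef
  have hA' : A' = A + D (t • h) + R := by rw [hRdef]; abel
  -- Flatness cancels all terms of first order in `h`; what is left is quadratic in `h` or contains
  -- the Taylor remainder `R`.
  have key : (A x y + (A h y + t • (D x h y + A h (A x y)))) - A' (x + h) (y + t • A h y) =
      -(t • A h (A h y) + t • D h h y + (t * t) • D h (x + h) (A h y)
        + R (x + h) (y + t • A h y)) := by
    rw [hA', hf]
    simp only [add_apply, map_add, map_smul, smul_add, FunLike.coe_smul, Pi.smul_apply,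
      mul_smul]
    abel
  rw [key, norm_neg]
  have n1 : ‖A h y‖ ≤ C * ‖h‖ * ‖y‖ :=
    (A.le_opNorm₂ h y).trans (by gcongr)
  have t1 : ‖t‖ ≤ 1 := by rw [Real.norm_of_nonneg ht.1]; exact ht.2
  have b1 : ‖t • A h (A h y)‖ ≤ C * C * ‖y‖ * ‖h‖ ^ 2 := by
    rw [norm_smul]
    calc ‖t‖ * ‖A h (A h y)‖ ≤ 1 * (C * ‖h‖ * (C * ‖h‖ * ‖y‖)) := by
          gcongr
          exact (A.le_opNorm₂ h _).trans (by gcongr)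
      _ = _ := by ring
  have b2 : ‖t • D h h y‖ ≤ C * ‖y‖ * ‖h‖ ^ 2 := by
    rw [norm_smul]
    calc ‖t‖ * ‖D h h y‖ ≤ 1 * (C * ‖h‖ * ‖h‖ * ‖y‖) := by
          gcongr
          refine ((D h h).le_opNorm y).trans ?_
          gcongr
          exact (D.le_opNorm₂ h h).trans (by gcongr)
      _ = _ := by ring
  have b3 : ‖(t * t) • D h (x + h) (A h y)‖ ≤ C * C * ‖y‖ * ‖h‖ ^ 2 := by
    rw [norm_smul, norm_mul]
    calc ‖t‖ * ‖t‖ * ‖D h (x + h) (A h y)‖ ≤ 1 * 1 * (C * ‖h‖ * 1 * (C * ‖h‖ * ‖y‖)) := by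
          gcongr
          refine ((D h (x + h)).le_opNorm _).trans ?_
          gcongr
          exact (D.le_opNorm₂ h (x + h)).trans (by gcongr)
      _ = _ := by ring
  have b4 : ‖R (x + h) (y + t • A h y)‖ ≤ K * (1 + C) * ‖y‖ * ‖h‖ ^ 2 := by
    have c1 : ‖y + t • A h y‖ ≤ (1 + C) * ‖y‖ := by
      refine (norm_add_le _ _).trans ?_
      rw [norm_smul]
      calc ‖y‖ + ‖t‖ * ‖A h y‖ ≤ ‖y‖ + 1 * (C * 1 * ‖y‖) := by
            gcongr
            exact n1.trans (by gcongr)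
        _ = _ := by ring
    have c2 : ‖R‖ ≤ K * ‖h‖ ^ 2 := hR.trans (by
      rw [norm_smul]
      gcongr
      exact mul_le_of_le_one_left (norm_nonneg _) t1)
    calc ‖R (x + h) (y + t • A h y)‖ ≤ ‖R‖ * ‖x + h‖ * ‖y + t • A h y‖ := R.le_opNorm₂ _ _
      _ ≤ (K * ‖h‖ ^ 2) * 1 * ((1 + C) * ‖y‖) := by gcongr
      _ = _ := by ring
  refine (norm_add_le _ _).trans ?_
  refine (add_le_add ((norm_add_le _ _).trans (add_le_add ((norm_add_le _ _).trans
    (add_le_add b1 b2)) b3)) b4).trans (le_of_eq ?_)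
  ring

/-- The solution at `z` is the value at time `1` of the radial solution towards `z`. Its derivative
is found by comparing neighbouring rays with Grönwall's inequality. -/
theorem exists_flat_solution_of_bounds [CompleteSpace W] {L : E → E →L[ℝ] W →L[ℝ] W} {z₀ : E}
    {r C : ℝ} {K : NNReal} (hL : DifferentiableOn ℝ L (ball z₀ r))
    (hC : ∀ z ∈ ball z₀ r, ‖L z‖ ≤ C) (hC' : ∀ z ∈ ball z₀ r, ‖fderiv ℝ L z‖ ≤ C)
    (hK : LipschitzOnWith K (fderiv ℝ L) (ball z₀ r)) (hCr : C * r ≤ 1 / 2) (hr1 : r ≤ 1)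
    (hflat : ∀ z ∈ ball z₀ r, IsFlatSystemAt L z) (y₀ : W) (hr : 0 < r) :
    ∃ y : E → W, y z₀ = y₀ ∧ ∀ z ∈ ball z₀ r, HasFDerivAt y ((L z).flip (y z)) z := by
  have hLc := hL.continuousOn
  have hC0 : 0 ≤ C := (norm_nonneg _).trans (hC z₀ (mem_ball_self hr))
  have hex : ∀ x : E, ∃ Y : ℝ → W, ‖x‖ < r → Y 0 = y₀ ∧ ∀ t ∈ Icc (0 : ℝ) 1,
      HasDerivWithinAt Y (L (z₀ + t • x) x (Y t)) (Icc 0 1) t := by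
    intro x
    by_cases hx : ‖x‖ < r
    · obtain ⟨Y, hY⟩ := exists_radial_solution hLc hC hCr y₀ hx
      exact ⟨Y, fun _ => hY⟩
    · exact ⟨0, fun h => absurd h hx⟩
  choose Y hY using hex
  have hmem : ∀ x : E, ‖x‖ < r → ∀ t ∈ Icc (0 : ℝ) 1, z₀ + t • x ∈ ball z₀ r := by
    intro x hx t ht
    rw [mem_ball_iff_norm, add_sub_cancel_left, norm_smul, Real.norm_of_nonneg ht.1]
    nlinarith [ht.2, norm_nonneg x]
  have hop : ∀ x : E, ‖x‖ < r → ∀ t ∈ Icc (0 : ℝ) 1, ‖L (z₀ + t • x) x‖ ≤ 1 := fun x hx t ht =>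
    (((L _).le_opNorm x).trans
      ((mul_le_mul (hC _ (hmem x hx t ht)) hx.le (norm_nonneg _) hC0).trans hCr)).trans
        (by norm_num)
  have hcont : ∀ x, ‖x‖ < r → ContinuousOn (Y x) (Icc 0 1) := fun x hx t ht =>
    ((hY x hx).2 t ht).continuousWithinAt
  have hIci : ∀ {f : ℝ → W} {f' : W} {t : ℝ}, t ∈ Ico (0 : ℝ) 1 →
      HasDerivWithinAt f f' (Icc 0 1) t → HasDerivWithinAt f f' (Ici t) t := by
    intro f f' t ht hf
    refine (hf.mono (Icc_subset_Icc_left ht.1)).mono_of_mem_nhdsWithin ?_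
    exact Icc_mem_nhdsGE ht.2
  have hbd : ∀ x, ‖x‖ < r → ∀ t ∈ Icc (0 : ℝ) 1, ‖Y x t‖ ≤ ‖y₀‖ * Real.exp 1 := by
    intro x hx t ht
    have := norm_le_gronwallBound_of_norm_deriv_right_le (K := 1) (ε := 0) (δ := ‖y₀‖)
      (hcont x hx)
      (fun t ht => hIci ht ((hY x hx).2 t (Ico_subset_Icc_self ht)))
      (by rw [(hY x hx).1])
      (fun t ht => by
        rw [add_zero]
        exact ((L _ x).le_opNorm _).trans (mul_le_mul_of_nonneg_right
          (hop x hx t (Ico_subset_Icc_self ht)) (norm_nonneg _))) t ht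
    rw [gronwallBound_ε0] at this
    refine this.trans ?_
    gcongr
    linarith [ht.2]
  refine ⟨fun z => Y (z - z₀) 1, ?_, ?_⟩
  · simp only [sub_self]
    have h0 : ‖(0 : E)‖ < r := by simpa using hr
    have : ∀ t ∈ Icc (0 : ℝ) 1, Y 0 t = Y 0 0 :=
      constant_of_has_deriv_right_zero (hcont 0 h0) (fun t ht => by
        simpa using hIci ht ((hY 0 h0).2 t (Ico_subset_Icc_self ht)))
    rw [this 1 (by simp), (hY 0 h0).1]
  · intro z hz
    obtain ⟨x, rfl⟩ : ∃ x, z = z₀ + x := ⟨z - z₀, by abel⟩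
    have hx : ‖x‖ < r := by simpa [mem_ball_iff_norm] using hz
    have hmem1 := hmem x hx
    set B := (C * C + C + C * C + K * (1 + C)) * (‖y₀‖ * Real.exp 1)
    have main : ∀ᶠ h in nhds (0 : E),
        ‖Y (x + h) 1 - Y x 1 - L (z₀ + x) h (Y x 1)‖ ≤ (B * (Real.exp 1 - 1)) * ‖h‖ ^ 2 := by
      have e1 : ∀ᶠ h in nhds (0 : E), ‖x + h‖ < r := by
        have : ContinuousAt (fun h : E => ‖x + h‖) 0 := by fun_prop
        exact this.eventually_lt continuousAt_const (by simpa using hx)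
      have e2 : ∀ᶠ h in nhds (0 : E), ‖h‖ < 1 := by
        have : ContinuousAt (fun h : E => ‖h‖) 0 := by fun_prop
        exact this.eventually_lt continuousAt_const (by simp)
      filter_upwards [e1, e2] with h hxh hh
      -- The first-order guess for `Y (x + h)`: the variation along the ray should be `t • L h Y`,
      -- which at `t = 1` is the claimed derivative.
      have hder : ∀ t ∈ Icc (0 : ℝ) 1, HasDerivWithinAt
          (fun t : ℝ => Y x t + t • L (z₀ + t • x) h (Y x t))
          (L (z₀ + t • x) x (Y x t) + (L (z₀ + t • x) h (Y x t) +
            t • (fderiv ℝ L (z₀ + t • x) x h (Y x t) +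
              L (z₀ + t • x) h (L (z₀ + t • x) x (Y x t))))) (Icc 0 1) t := by
        intro t ht
        have d1 := (hY x hx).2 t ht
        have d2 : HasDerivAt (fun t : ℝ => z₀ + t • x) x t := by
          simpa using ((hasDerivAt_id t).smul_const x).const_add z₀
        have d3 : HasDerivWithinAt (fun t : ℝ => L (z₀ + t • x))
            (fderiv ℝ L (z₀ + t • x) x) (Icc 0 1) t :=
          (((hL.differentiableAt (isOpen_ball.mem_nhds (hmem1 t ht))).hasFDerivAt).comp_hasDerivAt
            t d2).hasDerivWithinAt
        have d4 := (d3.clm_apply (hasDerivWithinAt_const t _ h)).clm_apply d1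
        have d5 := d1.add ((hasDerivWithinAt_id t _).smul d4)
        refine d5.congr_deriv ?_
        simp only [id, map_zero, add_zero, one_smul]
        abel
      -- Both curves start at `y₀`, so `δ = 0`, and only the defect `B * ‖h‖ ^ 2` of the guess
      -- contributes; over unit time it grows by the factor `Real.exp 1 - 1`.
      have hgr := dist_le_of_approx_trajectories_ODE_of_mem (a := 0) (b := 1) (K := 1)
        (δ := 0) (εf := 0) (εg := B * ‖h‖ ^ 2)
        (v := fun t w => L (z₀ + t • (x + h)) (x + h) w) (s := fun _ => univ)
        (f := Y (x + h)) (g := fun t : ℝ => Y x t + t • L (z₀ + t • x) h (Y x t))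
        (fun t ht => ((L (z₀ + t • (x + h)) (x + h)).lipschitz.weaken
          (by
            rw [← NNReal.coe_le_coe]
            exact hop _ hxh t (Ico_subset_Icc_self ht))).lipschitzOnWith)
        (hcont _ hxh) (fun t ht => hIci ht ((hY _ hxh).2 t (Ico_subset_Icc_self ht)))
        (fun t ht => by simp) (fun _ _ => trivial)
        (fun t ht => (hder t ht).continuousWithinAt)
        (fun t ht => hIci ht (hder t (Ico_subset_Icc_self ht)))
        (fun t ht => by
          have ht' := Ico_subset_Icc_self ht
          rw [dist_eq_norm]
          have hz1 := hmem1 t ht'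
          have hz2 := hmem _ hxh t ht'
          have htay := norm_taylor_le (convex_ball z₀ r) isOpen_ball hL hK hz1 hz2
          have hdiff : z₀ + t • (x + h) - (z₀ + t • x) = t • h := by
            rw [smul_add]; abel
          rw [hdiff] at htay
          refine (norm_flat_error_le ht' (hC _ hz1) (hC' _ hz1) (hflat _ hz1 x h) htay
            (hxh.le.trans hr1) hh.le K.coe_nonneg _).trans ?_
          exact mul_le_mul_of_nonneg_right (mul_le_mul_of_nonneg_left (hbd x hx t ht')
            (by positivity)) (by positivity))
        (fun _ _ => trivial)
        (by rw [(hY _ hxh).1, zero_smul, add_zero, (hY _ hx).1, dist_self])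
        1 (by simp)
      rw [dist_eq_norm, gronwallBound_of_K_ne_0 (by simp)] at hgr
      simp only [one_smul, zero_add, sub_zero, zero_mul, NNReal.coe_one, div_one, mul_one] at hgr
      rw [sub_sub]
      exact hgr.trans (le_of_eq (by ring))
    rw [hasFDerivAt_iff_isLittleO_nhds_zero]
    have hO : (fun h : E => Y (x + h) 1 - Y x 1 - L (z₀ + x) h (Y x 1)) =O[nhds 0]
        (fun h => ‖h‖ ^ 2) :=
      Asymptotics.IsBigO.of_bound _ (main.mono fun h hh => by simpa using hh)
    have := hO.trans_isLittleO (Asymptotics.isLittleO_norm_pow_id one_lt_two)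
    refine this.congr_left fun h => ?_
    simp only [ContinuousLinearMap.flip_apply, add_sub_cancel_left]
    rw [show z₀ + x + h - z₀ = x + h by abel]

/-- Bootstrapping: if `y` is `C^n`, then so is its derivative `L y`, hence `y` is `C^(n+1)`. -/
theorem contDiffOn_of_hasFDerivAt_flat {L : E → E →L[ℝ] W →L[ℝ] W} {s : Set E} (hs : IsOpen s)
    (hL : ContDiffOn ℝ ∞ L s) {y : E → W} (hy : ∀ z ∈ s, HasFDerivAt y ((L z).flip (y z)) z) :
    ContDiffOn ℝ ∞ y s := by
  have hd : DifferentiableOn ℝ y s := fun z hz =>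
    (hy z hz).differentiableAt.differentiableWithinAt
  have hall : ∀ n : ℕ, ContDiffOn ℝ n y s := by
    intro n
    induction n with
    | zero => exact contDiffOn_zero.2 hd.continuousOn
    | succ n ih =>
      push_cast
      rw [contDiffOn_succ_iff_fderiv_of_isOpen hs]
      refine ⟨hd, by simp, ?_⟩
      have h1 : ContDiffOn ℝ n (fun z => (L z).flip (y z)) s :=
        (((ContinuousLinearMap.flipₗᵢ ℝ E W W).contDiff.comp_contDiffOn
          (hL.of_le (by exact_mod_cast le_top)))).clm_apply ih
      exact h1.congr fun z hz => (hy z hz).fderiv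
  exact contDiffOn_infty.2 hall

/-- A flat linear total differential system has local solutions with any initial value. -/
theorem exists_flat_solution [CompleteSpace W] {L : E → E →L[ℝ] W →L[ℝ] W} {z₀ : E}
    {s : Set E} (hs : s ∈ nhds z₀) (hL : ContDiffOn ℝ ∞ L s)
    (hflat : ∀ z ∈ s, IsFlatSystemAt L z) (y₀ : W) :
    ∃ r > 0, ball z₀ r ⊆ s ∧ ∃ y : E → W, y z₀ = y₀ ∧ ContDiffOn ℝ ∞ y (ball z₀ r) ∧
      ∀ z ∈ ball z₀ r, HasFDerivAt y ((L z).flip (y z)) z := by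
  have hLat : ContDiffAt ℝ 2 L z₀ := by
    exact_mod_cast (contDiffOn_infty.1 hL 2).contDiffAt hs
  have hD : ContDiffAt ℝ 1 (fderiv ℝ L) z₀ := hLat.fderiv_right (by norm_num)
  obtain ⟨K, u, hu, hKu⟩ := hD.exists_lipschitzOnWith
  -- The summand `1` makes both bounds strict at `z₀`, so that they persist nearby, and makes `C`
  -- positive for the radius `1 / (2 * C)`.
  set C := ‖L z₀‖ + ‖fderiv ℝ L z₀‖ + 1
  have hCpos : 0 < C := by positivity
  have e1 : ∀ᶠ z in nhds z₀, ‖L z‖ < C :=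
    hLat.continuousAt.norm.eventually_lt continuousAt_const
      (by have := norm_nonneg (fderiv ℝ L z₀); simp only [C]; linarith)
  have e2 : ∀ᶠ z in nhds z₀, ‖fderiv ℝ L z‖ < C :=
    hD.continuousAt.norm.eventually_lt continuousAt_const
      (by have := norm_nonneg (L z₀); simp only [C]; linarith)
  obtain ⟨r₀, hr₀, hball⟩ := Metric.mem_nhds_iff.1
    (Filter.inter_mem (Filter.inter_mem hs hu) (Filter.inter_mem e1 e2))
  set r := min r₀ (min 1 (1 / (2 * C)))
  have hr : 0 < r := by positivity
  have hsub : ball z₀ r ⊆ ball z₀ r₀ := ball_subset_ball (min_le_left _ _)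
  have hb := hsub.trans hball
  have hrC : C * r ≤ 1 / 2 := by
    have : r ≤ 1 / (2 * C) := (min_le_right _ _).trans (min_le_right _ _)
    calc C * r ≤ C * (1 / (2 * C)) := by gcongr
      _ = 1 / 2 := by field_simp
  have hbs : ball z₀ r ⊆ s := fun z hz => (hb hz).1.1
  obtain ⟨y, hy0, hy⟩ := exists_flat_solution_of_bounds
    ((hL.mono hbs).differentiableOn (by simp)) (fun z hz => (hb hz).2.1.le)
    (fun z hz => (hb hz).2.2.le) (hKu.mono fun z hz => (hb hz).1.2) hrC
    ((min_le_right _ _).trans (min_le_left _ _)) (fun z hz => hflat z (hbs hz)) y₀ hr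
  exact ⟨r, hr, hbs, y, hy0, contDiffOn_of_hasFDerivAt_flat isOpen_ball (hL.mono hbs) hy, hy⟩

end FlatSystem

/-! ### Derivatives in charts and commutators of vector fields. -/

section Charts

open Set Filter Topology VectorField

variable {E : Type*} [NormedAddCommGroup E] [NormedSpace ℝ E]
  {M : Type*} [TopologicalSpace M] [ChartedSpace E M]
  {G : Type*} [NormedAddCommGroup G] [NormedSpace ℝ G]

theorem mdifferentiableAt_extChartAt_symm [IsManifold 𝓘(ℝ, E) ∞ M] {x : M} {z : E}
    (hz : z ∈ (extChartAt 𝓘(ℝ, E) x).target) :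
    MDifferentiableAt 𝓘(ℝ, E) 𝓘(ℝ, E) (extChartAt 𝓘(ℝ, E) x).symm z := by
  have := mdifferentiableWithinAt_extChartAt_symm (I := 𝓘(ℝ, E)) hz
  simpa [mdifferentiableWithinAt_univ] using this

/-- The derivative at `y` of the chart centered at `x`. -/
def dChart (x y : M) : TangentSpace 𝓘(ℝ, E) y →L[ℝ] E :=
  mfderiv 𝓘(ℝ, E) 𝓘(ℝ, E) (extChartAt 𝓘(ℝ, E) x) y

/-- The derivative at `z` of the inverse of the chart centered at `x`. -/
def dChartSymm (x : M) (z : E) :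
    E →L[ℝ] TangentSpace 𝓘(ℝ, E) ((extChartAt 𝓘(ℝ, E) x).symm z) :=
  mfderiv 𝓘(ℝ, E) 𝓘(ℝ, E) (extChartAt 𝓘(ℝ, E) x).symm z

theorem mfderiv_extChartAt_comp_symm [IsManifold 𝓘(ℝ, E) ∞ M] {x : M} {z : E}
    (hz : z ∈ (extChartAt 𝓘(ℝ, E) x).target) (v : E) :
    mfderiv 𝓘(ℝ, E) 𝓘(ℝ, E) (extChartAt 𝓘(ℝ, E) x) ((extChartAt 𝓘(ℝ, E) x).symm z)
      (mfderiv 𝓘(ℝ, E) 𝓘(ℝ, E) (extChartAt 𝓘(ℝ, E) x).symm z v) = v := by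
  have := mfderiv_extChartAt_comp_mfderivWithin_extChartAt_symm (I := 𝓘(ℝ, E)) hz
  simp only [modelWithCornersSelf_coe, range_id, mfderivWithin_univ] at this
  exact DFunLike.congr_fun this v

theorem mfderiv_extChartAt_symm_comp [IsManifold 𝓘(ℝ, E) ∞ M] {x y : M}
    (hy : y ∈ (extChartAt 𝓘(ℝ, E) x).source) (v : TangentSpace 𝓘(ℝ, E) y) :
    mfderiv 𝓘(ℝ, E) 𝓘(ℝ, E) (extChartAt 𝓘(ℝ, E) x).symm (extChartAt 𝓘(ℝ, E) x y)
      (mfderiv 𝓘(ℝ, E) 𝓘(ℝ, E) (extChartAt 𝓘(ℝ, E) x) y v) = v := by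
  have := mfderivWithin_extChartAt_symm_comp_mfderiv_extChartAt' (I := 𝓘(ℝ, E)) hy
  simp only [modelWithCornersSelf_coe, range_id, mfderivWithin_univ] at this
  exact DFunLike.congr_fun this v

theorem mvfderiv_congr_of_eventuallyEq {f g : M → G} {x : M} (h : f =ᶠ[𝓝 x] g) :
    mvfderiv 𝓘(ℝ, E) f x = mvfderiv 𝓘(ℝ, E) g x := by
  ext w
  exact DFunLike.congr_fun (h.mfderiv_eq (I := 𝓘(ℝ, E)) (I' := 𝓘(ℝ, G))) w

theorem dChart_dChartSymm [IsManifold 𝓘(ℝ, E) ∞ M] {x : M} {z : E}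
    (hz : z ∈ (extChartAt 𝓘(ℝ, E) x).target) (v : E) :
    dChart x ((extChartAt 𝓘(ℝ, E) x).symm z) (dChartSymm x z v) = v :=
  mfderiv_extChartAt_comp_symm hz v

theorem dChart_injective [IsManifold 𝓘(ℝ, E) ∞ M] {x y : M}
    (hy : y ∈ (extChartAt 𝓘(ℝ, E) x).source) : Function.Injective (dChart (E := E) x y) := by
  intro v w h
  rw [← mfderiv_extChartAt_symm_comp hy v, ← mfderiv_extChartAt_symm_comp hy w]
  exact congrArg (mfderiv 𝓘(ℝ, E) 𝓘(ℝ, E) (extChartAt 𝓘(ℝ, E) x).symm _) h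

/-- The derivative of a function on a manifold, computed in a chart. -/
theorem mvfderiv_eq_fderiv_chart [IsManifold 𝓘(ℝ, E) ∞ M] {f : M → G} {x y : M}
    (hy : y ∈ (extChartAt 𝓘(ℝ, E) x).source) (hf : MDifferentiableAt 𝓘(ℝ, E) 𝓘(ℝ, G) f y)
    (w : TangentSpace 𝓘(ℝ, E) y) :
    mvfderiv 𝓘(ℝ, E) f y w = fderiv ℝ (f ∘ (extChartAt 𝓘(ℝ, E) x).symm)
      (extChartAt 𝓘(ℝ, E) x y) (dChart x y w) := by
  unfold dChart
  have hz := (extChartAt 𝓘(ℝ, E) x).map_source hy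
  have hinv := (extChartAt 𝓘(ℝ, E) x).left_inv hy
  rw [← mfderiv_eq_fderiv, mfderiv_comp_of_eq
    (y := y) hf (mdifferentiableAt_extChartAt_symm hz) hinv]
  have h2 := mfderiv_extChartAt_symm_comp hy w
  change _ = mfderiv _ _ f _ (mfderiv _ _ (extChartAt 𝓘(ℝ, E) x).symm _ (mfderiv _ _ _ _ w))
  rw [h2]
  change mfderiv _ _ f y w = _
  congr 1
  rw [hinv]

theorem differentiableAt_chart [IsManifold 𝓘(ℝ, E) ∞ M] {f : M → G} {x y : M}
    (hy : y ∈ (extChartAt 𝓘(ℝ, E) x).source) (hf : MDifferentiableAt 𝓘(ℝ, E) 𝓘(ℝ, G) f y) :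
    DifferentiableAt ℝ (f ∘ (extChartAt 𝓘(ℝ, E) x).symm) (extChartAt 𝓘(ℝ, E) x y) := by
  rw [← mdifferentiableAt_iff_differentiableAt]
  exact hf.comp_of_eq _ (mdifferentiableAt_extChartAt_symm
    ((extChartAt 𝓘(ℝ, E) x).map_source hy)) ((extChartAt 𝓘(ℝ, E) x).left_inv hy)

theorem fderiv_chart_eq_mvfderiv [IsManifold 𝓘(ℝ, E) ∞ M] {f : M → G} {x : M} {z : E}
    (hz : z ∈ (extChartAt 𝓘(ℝ, E) x).target)
    (hf : MDifferentiableAt 𝓘(ℝ, E) 𝓘(ℝ, G) f ((extChartAt 𝓘(ℝ, E) x).symm z)) (v : E) :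
    fderiv ℝ (f ∘ (extChartAt 𝓘(ℝ, E) x).symm) z v =
      mvfderiv 𝓘(ℝ, E) f ((extChartAt 𝓘(ℝ, E) x).symm z)
        (dChartSymm x z v) := by
  rw [mvfderiv_eq_fderiv_chart ((extChartAt 𝓘(ℝ, E) x).map_target hz) hf,
    dChart_dChartSymm hz, (extChartAt 𝓘(ℝ, E) x).right_inv hz]

theorem mvfderiv_comp_chart [IsManifold 𝓘(ℝ, E) ∞ M] {g : E → G} {x y : M}
    (hy : y ∈ (extChartAt 𝓘(ℝ, E) x).source)
    (hg : DifferentiableAt ℝ g (extChartAt 𝓘(ℝ, E) x y)) (w : TangentSpace 𝓘(ℝ, E) y) :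
    mvfderiv 𝓘(ℝ, E) (g ∘ extChartAt 𝓘(ℝ, E) x) y w = fderiv ℝ g (extChartAt 𝓘(ℝ, E) x y)
      (dChart x y w) := by
  have h := mfderiv_comp_apply (I := 𝓘(ℝ, E)) (I' := 𝓘(ℝ, E)) (I'' := 𝓘(ℝ, G))
    (f := extChartAt 𝓘(ℝ, E) x) (g := g) y (mdifferentiableAt_iff_differentiableAt.2 hg)
    (mdifferentiableAt_extChartAt (by simpa using hy)) w
  rw [mfderiv_eq_fderiv] at h
  exact h

/-- A vector field commutator acts on functions as the commutator of derivations. -/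
theorem mvfderiv_mlieBracket [CompleteSpace E] [IsManifold 𝓘(ℝ, E) ∞ M] {f : M → G}
    {V W : ∀ x : M, TangentSpace 𝓘(ℝ, E) x} {x : M}
    (hf : ContMDiffAt 𝓘(ℝ, E) 𝓘(ℝ, G) 2 f x)
    (hV : MDifferentiableAt 𝓘(ℝ, E) (𝓘(ℝ, E).prod 𝓘(ℝ, E))
      (fun y => (⟨y, V y⟩ : TotalSpace E (TangentSpace 𝓘(ℝ, E) : M → Type _))) x)
    (hW : MDifferentiableAt 𝓘(ℝ, E) (𝓘(ℝ, E).prod 𝓘(ℝ, E))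
      (fun y => (⟨y, W y⟩ : TotalSpace E (TangentSpace 𝓘(ℝ, E) : M → Type _))) x) :
    mvfderiv 𝓘(ℝ, E) f x (mlieBracket 𝓘(ℝ, E) V W x) =
      mvfderiv 𝓘(ℝ, E) (fun y => mvfderiv 𝓘(ℝ, E) f y (W y)) x (V x) -
      mvfderiv 𝓘(ℝ, E) (fun y => mvfderiv 𝓘(ℝ, E) f y (V y)) x (W x) := by
  set φ := extChartAt 𝓘(ℝ, E) x with hφ
  have hx : x ∈ φ.source := mem_extChartAt_source x
  set F : E → G := f ∘ φ.symm with hF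
  have hFc : ContDiffAt ℝ 2 F (φ x) := by
    rw [← contMDiffAt_iff_contDiffAt]
    refine ContMDiffAt.comp_of_eq (I' := 𝓘(ℝ, E)) hf ?_ (φ.left_inv hx)
    exact ((contMDiffOn_extChartAt_symm x).contMDiffAt
      (extChartAt_target_mem_nhds x)).of_le le_rfl
  let chartField (Z : ∀ x : M, TangentSpace 𝓘(ℝ, E) x) (z : E) : E :=
    dChart x (φ.symm z) (Z (φ.symm z))
  have hpull (Z : ∀ x : M, TangentSpace 𝓘(ℝ, E) x) :
      mpullbackWithin 𝓘(ℝ, E) 𝓘(ℝ, E) φ.symm Z (range 𝓘(ℝ, E)) =ᶠ[𝓝 (φ x)] chartField Z := by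
    filter_upwards [extChartAt_target_mem_nhds (I := 𝓘(ℝ, E)) x] with z hz
    have h1 : ContinuousLinearMap.inverse (mfderiv 𝓘(ℝ, E) 𝓘(ℝ, E) φ.symm z) =
        mfderiv 𝓘(ℝ, E) 𝓘(ℝ, E) φ (φ.symm z) := by
      apply ContinuousLinearMap.inverse_eq
      · ext v
        have := mfderiv_extChartAt_symm_comp (φ.map_target hz) v
        rw [φ.right_inv hz] at this
        exact this
      · ext v
        exact mfderiv_extChartAt_comp_symm hz v
    simp only [mpullbackWithin_apply, modelWithCornersSelf_coe, range_id, mfderivWithin_univ,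
      chartField]
    rw [h1]
    rfl
  have hdiff {Z : ∀ x : M, TangentSpace 𝓘(ℝ, E) x}
      (hZ : MDifferentiableAt 𝓘(ℝ, E) (𝓘(ℝ, E).prod 𝓘(ℝ, E))
      (fun y => (⟨y, Z y⟩ : TotalSpace E (TangentSpace 𝓘(ℝ, E) : M → Type _))) x) :
      DifferentiableAt ℝ (chartField Z) (φ x) := by
    have := (mdifferentiableWithinAt_univ.2 hZ).differentiableWithinAt_mpullbackWithin_vectorField
    simp only [preimage_univ, modelWithCornersSelf_coe, range_id, inter_self] at this
    have h2 := hpull Z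
    simp only [modelWithCornersSelf_coe, range_id] at h2
    exact (differentiableWithinAt_univ.1 this).congr_of_eventuallyEq h2.symm
  have hfev : ∀ᶠ y in 𝓝 x, ContMDiffAt 𝓘(ℝ, E) 𝓘(ℝ, G) 2 f y :=
    (contMDiffAt_iff_contMDiffAt_nhds (by simp)).1 hf
  have hder (Z : ∀ x : M, TangentSpace 𝓘(ℝ, E) x) :
      (fun y => mvfderiv 𝓘(ℝ, E) f y (Z y)) =ᶠ[𝓝 x]
        ((fun z => fderiv ℝ F z (chartField Z z)) ∘ φ) := by
    filter_upwards [hfev, extChartAt_source_mem_nhds (I := 𝓘(ℝ, E)) x] with y hy hys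
    rw [mvfderiv_eq_fderiv_chart hys (hy.mdifferentiableAt (by simp))]
    simp only [Function.comp_apply, chartField]
    rw [φ.left_inv hys]
  have hDF : DifferentiableAt ℝ (fderiv ℝ F) (φ x) :=
    (hFc.fderiv_right (m := 1) (by norm_num)).differentiableAt (by simp)
  have hcalc {Z Z' : ∀ x : M, TangentSpace 𝓘(ℝ, E) x}
      (hZ : DifferentiableAt ℝ (chartField Z) (φ x)) :
      mvfderiv 𝓘(ℝ, E) (fun y => mvfderiv 𝓘(ℝ, E) f y (Z y)) x (Z' x) =
        fderiv ℝ (fderiv ℝ F) (φ x) (chartField Z' (φ x)) (chartField Z (φ x)) +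
        fderiv ℝ F (φ x) (fderiv ℝ (chartField Z) (φ x) (chartField Z' (φ x))) := by
    have e1 : mvfderiv 𝓘(ℝ, E) (fun y => mvfderiv 𝓘(ℝ, E) f y (Z y)) x =
        mvfderiv 𝓘(ℝ, E) ((fun z => fderiv ℝ F z (chartField Z z)) ∘ φ) x :=
      mvfderiv_congr_of_eventuallyEq (hder Z)
    have e2 : dChart x x (Z' x) = chartField Z' (φ x) := by
      simp only [chartField]
      rw [φ.left_inv hx]
    rw [e1, mvfderiv_comp_chart hx (hDF.clm_apply hZ), fderiv_clm_apply hDF hZ, e2,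
      add_comm]
    rfl
  rw [hcalc (hdiff hW), hcalc (hdiff hV)]
  -- The second-order terms of the two iterated derivatives cancel by symmetry, leaving the
  -- derivative of `F` along the coordinate commutator.
  have hsymm : fderiv ℝ (fderiv ℝ F) (φ x) (chartField V (φ x)) (chartField W (φ x)) =
      fderiv ℝ (fderiv ℝ F) (φ x) (chartField W (φ x)) (chartField V (φ x)) :=
    (hFc.isSymmSndFDerivAt (by simp)).eq _ _
  rw [hsymm, add_sub_add_left_eq_sub, ← map_sub]
  rw [mvfderiv_eq_fderiv_chart hx (hf.mdifferentiableAt (by simp))]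
  congr 1
  rw [← mlieBracketWithin_univ, mlieBracketWithin_apply]
  have hb : lieBracketWithin ℝ (mpullbackWithin 𝓘(ℝ, E) 𝓘(ℝ, E) φ.symm V (range 𝓘(ℝ, E)))
      (mpullbackWithin 𝓘(ℝ, E) 𝓘(ℝ, E) φ.symm W (range 𝓘(ℝ, E)))
      (φ.symm ⁻¹' univ ∩ range 𝓘(ℝ, E)) (φ x) =
      fderiv ℝ (chartField W) (φ x) (chartField V (φ x)) -
        fderiv ℝ (chartField V) (φ x) (chartField W (φ x)) := by
    simp only [preimage_univ, modelWithCornersSelf_coe, range_id, inter_self] at hpull ⊢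
    rw [(hpull V).lieBracketWithin_vectorField_eq_nhds (hpull W), lieBracketWithin_univ]
    rfl
  rw [hb]
  have hinv : ContinuousLinearMap.IsInvertible (mfderiv 𝓘(ℝ, E) 𝓘(ℝ, E) φ x) :=
    isInvertible_mfderiv_extChartAt hx
  obtain ⟨e, he⟩ := hinv
  rw [dChart, ← hφ, ← he, ContinuousLinearMap.inverse_equiv]
  exact e.apply_symm_apply _

end Charts

/-! ### Product rule, local constancy, and extension of local data by bump functions. -/

section Locality

open Set Filter Topology VectorField

variable {E : Type*} [NormedAddCommGroup E] [NormedSpace ℝ E]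
  {M : Type*} [TopologicalSpace M] [ChartedSpace E M] [IsManifold 𝓘(ℝ, E) ∞ M]
  {G : Type*} [NormedAddCommGroup G] [NormedSpace ℝ G]
  {G' : Type*} [NormedAddCommGroup G'] [NormedSpace ℝ G']
  {G'' : Type*} [NormedAddCommGroup G''] [NormedSpace ℝ G'']

theorem mvfderiv_bilinear (B : G →L[ℝ] G' →L[ℝ] G'') {f : M → G} {g : M → G'} {x : M}
    (hf : MDifferentiableAt 𝓘(ℝ, E) 𝓘(ℝ, G) f x) (hg : MDifferentiableAt 𝓘(ℝ, E) 𝓘(ℝ, G') g x)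
    (w : TangentSpace 𝓘(ℝ, E) x) :
    mvfderiv 𝓘(ℝ, E) (fun y => B (f y) (g y)) x w =
      B (mvfderiv 𝓘(ℝ, E) f x w) (g x) + B (f x) (mvfderiv 𝓘(ℝ, E) g x w) := by
  have hx : x ∈ (extChartAt 𝓘(ℝ, E) x).source := mem_extChartAt_source x
  have hB : MDifferentiableAt 𝓘(ℝ, E) 𝓘(ℝ, G'') (fun y => B (f y) (g y)) x := by
    have h1 : MDifferentiableAt 𝓘(ℝ, E) 𝓘(ℝ, G × G') (fun y => (f y, g y)) x :=
      hf.prodMk_space hg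
    exact MDifferentiableAt.comp (I' := 𝓘(ℝ, G × G')) (g := fun p : G × G' => B p.1 p.2) x
      (B.isBoundedBilinearMap.differentiableAt _).mdifferentiableAt h1
  rw [mvfderiv_eq_fderiv_chart hx hB, mvfderiv_eq_fderiv_chart hx hf,
    mvfderiv_eq_fderiv_chart hx hg]
  have hf' := differentiableAt_chart hx hf
  have hg' := differentiableAt_chart hx hg
  have := (B.hasFDerivAt_of_bilinear hf'.hasFDerivAt hg'.hasFDerivAt).fderiv
  change fderiv ℝ (fun z => B ((f ∘ (extChartAt 𝓘(ℝ, E) x).symm) z)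
    ((g ∘ (extChartAt 𝓘(ℝ, E) x).symm) z)) _ _ = _
  rw [this]
  simp [add_comm, ContinuousLinearMap.precompR, ContinuousLinearMap.precompL]

theorem mvfderiv_clm_comp (T : G →L[ℝ] G') {f : M → G} {x : M}
    (hf : MDifferentiableAt 𝓘(ℝ, E) 𝓘(ℝ, G) f x) (w : TangentSpace 𝓘(ℝ, E) x) :
    mvfderiv 𝓘(ℝ, E) (fun y => T (f y)) x w = T (mvfderiv 𝓘(ℝ, E) f x w) := by
  have h := mfderiv_comp_apply (I := 𝓘(ℝ, E)) (I' := 𝓘(ℝ, G)) (I'' := 𝓘(ℝ, G'))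
    (f := f) (g := T) x T.differentiableAt.mdifferentiableAt hf w
  rw [mfderiv_eq_fderiv, T.fderiv] at h
  exact h

/-- A function with vanishing derivative is locally constant. -/
theorem eventually_eq_of_mvfderiv_eq_zero {f : M → G} {x : M}
    (hf : ∀ᶠ y in 𝓝 x, MDifferentiableAt 𝓘(ℝ, E) 𝓘(ℝ, G) f y)
    (h0 : ∀ᶠ y in 𝓝 x, ∀ w, mvfderiv 𝓘(ℝ, E) f y w = 0) : ∀ᶠ y in 𝓝 x, f y = f x := by
  set φ := extChartAt 𝓘(ℝ, E) x with hφ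
  have hsymm : Tendsto φ.symm (𝓝 (φ x)) (𝓝 x) := by
    have := continuousAt_extChartAt_symm (I := 𝓘(ℝ, E)) x
    rwa [ContinuousAt, extChartAt_to_inv] at this
  have hev : ∀ᶠ z in 𝓝 (φ x), z ∈ φ.target ∧ MDifferentiableAt 𝓘(ℝ, E) 𝓘(ℝ, G) f (φ.symm z) ∧
      ∀ w, mvfderiv 𝓘(ℝ, E) f (φ.symm z) w = 0 :=
    (Filter.Eventually.and (extChartAt_target_mem_nhds (I := 𝓘(ℝ, E)) x)
      ((hsymm.eventually hf).and (hsymm.eventually h0)))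
  obtain ⟨r, hr, hball⟩ := Metric.eventually_nhds_iff_ball.1 hev
  -- A ball in the chart is convex, so a vanishing derivative there forces constancy.
  have hconst : ∀ z ∈ Metric.ball (φ x) r, f (φ.symm z) = f (φ.symm (φ x)) := by
    intro z hz
    refine (convex_ball (φ x) r).is_const_of_fderivWithin_eq_zero (𝕜 := ℝ) (f := f ∘ φ.symm)
      (fun z hz => ?_) (fun z hz => ?_) hz (Metric.mem_ball_self hr)
    · have := differentiableAt_chart (φ.map_target (hball z hz).1) (hball z hz).2.1
      rw [φ.right_inv (hball z hz).1] at this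
      exact this.differentiableWithinAt
    · rw [fderivWithin_of_isOpen Metric.isOpen_ball hz]
      ext v
      rw [fderiv_chart_eq_mvfderiv (hball z hz).1 (hball z hz).2.1, (hball z hz).2.2]
      rfl
  have hc : ∀ᶠ y in 𝓝 x, φ y ∈ Metric.ball (φ x) r :=
    (continuousAt_extChartAt (I := 𝓘(ℝ, E)) x).eventually (Metric.ball_mem_nhds _ hr)
  filter_upwards [hc, extChartAt_source_mem_nhds (I := 𝓘(ℝ, E)) x] with y hy hys
  have := hconst (φ y) hy
  rwa [φ.left_inv hys, φ.left_inv (mem_extChartAt_source x)] at this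

variable [FiniteDimensional ℝ E] [T2Space M]

theorem exists_bump {x : M} {U : Set M} (hU : U ∈ 𝓝 x) :
    ∃ f : C^∞⟮𝓘(ℝ, E), M; ℝ⟯, tsupport f ⊆ U ∧ ∀ᶠ y in 𝓝 x, f y = 1 := by
  obtain ⟨f, -, hf⟩ := (SmoothBumpFunction.nhds_basis_tsupport (I := 𝓘(ℝ, E)) x).mem_iff.1 hU
  exact ⟨⟨f, f.contMDiff⟩, hf, f.eventuallyEq_one⟩

variable {F : Type*} [NormedAddCommGroup F] [NormedSpace ℝ F]
  {A : M → Type*} [TopologicalSpace (TotalSpace F A)]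
  [∀ x, AddCommGroup (A x)] [∀ x, Module ℝ (A x)] [∀ x, TopologicalSpace (A x)]
  [FiberBundle F A] [VectorBundle ℝ F A]

/-- A section that is smooth near `x` agrees near `x` with a global smooth section. -/
theorem exists_section_eventuallyEq {s : ∀ x, A x} {U : Set M} {x : M} (hU : U ∈ 𝓝 x)
    (hs : ContMDiffOn 𝓘(ℝ, E) (𝓘(ℝ, E).prod 𝓘(ℝ, F)) ∞
      (fun y => (⟨y, s y⟩ : TotalSpace F A)) U) :
    ∃ X : Cₛ^∞⟮𝓘(ℝ, E); F, A⟯, ∀ᶠ y in 𝓝 x, X y = s y := by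
  obtain ⟨f, hf, hf1⟩ := exists_bump (E := E) (interior_mem_nhds.2 hU)
  refine ⟨⟨fun y => f y • s y, fun y => ?_⟩, ?_⟩
  -- On the support of the bump function `s` is smooth; off it the product vanishes in a whole
  -- neighbourhood, so no boundary case remains.
  · by_cases hy : y ∈ tsupport f
    · have hyU := isOpen_interior.mem_nhds (hf hy)
      exact (f.contMDiff y).smul_section (hs.contMDiffAt (mem_of_superset hyU interior_subset))
    · have h0 : ∀ᶠ z in 𝓝 y, f z = 0 := by
        have := (isClosed_tsupport f).isOpen_compl.mem_nhds hy
        filter_upwards [this] with z hz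
        exact image_eq_zero_of_notMem_tsupport hz
      refine ((contMDiff_zeroSection ℝ A) y).congr_of_eventuallyEq ?_
      filter_upwards [h0] with z hz
      rw [hz, zero_smul]
      rfl
  · filter_upwards [hf1] with y hy
    change f y • s y = s y
    rw [hy, one_smul]

theorem exists_contMDiffMap_eventuallyEq {g : M → ℝ} {U : Set M} {x : M} (hU : U ∈ 𝓝 x)
    (hg : ContMDiffOn 𝓘(ℝ, E) 𝓘(ℝ, ℝ) ∞ g U) :
    ∃ f : C^∞⟮𝓘(ℝ, E), M; ℝ⟯, ∀ᶠ y in 𝓝 x, f y = g y := by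
  obtain ⟨f, hf, hf1⟩ := exists_bump (E := E) (interior_mem_nhds.2 hU)
  refine ⟨⟨fun y => f y * g y, fun y => ?_⟩, ?_⟩
  · by_cases hy : y ∈ tsupport f
    · have hyU := isOpen_interior.mem_nhds (hf hy)
      exact (f.contMDiff y).mul (hg.contMDiffAt (mem_of_superset hyU interior_subset))
    · have h0 : ∀ᶠ z in 𝓝 y, f z = 0 := by
        have := (isClosed_tsupport f).isOpen_compl.mem_nhds hy
        filter_upwards [this] with z hz
        exact image_eq_zero_of_notMem_tsupport hz
      refine (contMDiffAt_const (c := (0 : ℝ))).congr_of_eventuallyEq ?_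
      filter_upwards [h0] with z hz
      rw [hz, zero_mul]
  · filter_upwards [hf1] with y hy
    change f y * g y = g y
    rw [hy, one_mul]

/-- Tangent vectors are determined by their action on global smooth functions. -/
theorem tangent_eq_of_forall_mvfderiv_eq {x : M} {v w : TangentSpace 𝓘(ℝ, E) x}
    (h : ∀ f : C^∞⟮𝓘(ℝ, E), M; ℝ⟯, mvfderiv 𝓘(ℝ, E) f x v = mvfderiv 𝓘(ℝ, E) f x w) :
    v = w := by
  have hx : x ∈ (extChartAt 𝓘(ℝ, E) x).source := mem_extChartAt_source x
  refine dChart_injective hx ?_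
  -- The test functions are linear functionals of the chart, cut off to global functions without
  -- change near `x`.
  refine (SeparatingDual.eq_iff_forall_dual_eq (R := ℝ)).2 fun l : E →L[ℝ] ℝ => ?_
  obtain ⟨f, hf⟩ := exists_contMDiffMap_eventuallyEq (E := E) (x := x)
    (g := l ∘ extChartAt 𝓘(ℝ, E) x) (extChartAt_source_mem_nhds (I := 𝓘(ℝ, E)) x) (by
      rw [extChartAt_source]
      exact l.contMDiff.comp_contMDiffOn contMDiffOn_extChartAt)
  have := h f
  rw [mvfderiv_congr_of_eventuallyEq hf, mvfderiv_comp_chart hx l.differentiableAt,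
    mvfderiv_comp_chart hx l.differentiableAt, l.fderiv] at this
  exact this

end Locality

/-! ### Sections, anchor fields and derivatives along them. -/

section Sections

open Set Filter Topology VectorField

variable {E : Type*} [NormedAddCommGroup E] [NormedSpace ℝ E]
  {M : Type*} [TopologicalSpace M] [ChartedSpace E M] [IsManifold 𝓘(ℝ, E) ∞ M]
  {F : Type*} [NormedAddCommGroup F] [NormedSpace ℝ F]
  {A : M → Type*} [TopologicalSpace (TotalSpace F A)]
  [∀ x, AddCommGroup (A x)] [∀ x, Module ℝ (A x)] [∀ x, TopologicalSpace (A x)]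
  [FiberBundle F A] [VectorBundle ℝ F A]

theorem section_add_apply (X Y : Cₛ^∞⟮𝓘(ℝ, E); F, A⟯) (x : M) : (X + Y) x = X x + Y x := rfl

theorem section_sub_apply (X Y : Cₛ^∞⟮𝓘(ℝ, E); F, A⟯) (x : M) : (X - Y) x = X x - Y x := rfl

theorem section_smul_apply (r : ℝ) (X : Cₛ^∞⟮𝓘(ℝ, E); F, A⟯) (x : M) : (r • X) x = r • X x := rfl

theorem section_smulFn_apply (f : C^∞⟮𝓘(ℝ, E), M; ℝ⟯) (X : Cₛ^∞⟮𝓘(ℝ, E); F, A⟯) (x : M) :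
    (f • X) x = f x • X x :=
  rfl

theorem section_sum_apply {ι : Type*} (s : Finset ι) (X : ι → Cₛ^∞⟮𝓘(ℝ, E); F, A⟯) (x : M) :
    (∑ i ∈ s, X i) x = ∑ i ∈ s, X i x := by
  have := congrFun (map_sum (ContMDiffSection.coeAddHom 𝓘(ℝ, E) F ∞ A) X s) x
  exact this.trans (Finset.sum_apply x s _)

theorem section_mdifferentiableAt (X : Cₛ^∞⟮𝓘(ℝ, E); F, A⟯) (x : M) :
    MDifferentiableAt 𝓘(ℝ, E) (𝓘(ℝ, E).prod 𝓘(ℝ, F))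
      (fun y => (⟨y, X y⟩ : TotalSpace F A)) x :=
  (X.contMDiff x).mdifferentiableAt (by simp)

theorem smoothMap_mdifferentiableAt (f : C^∞⟮𝓘(ℝ, E), M; ℝ⟯) (x : M) :
    MDifferentiableAt 𝓘(ℝ, E) 𝓘(ℝ, ℝ) f x :=
  (f.contMDiff x).mdifferentiableAt (by simp)

/-- The derivative of a smooth function along a smooth vector field is smooth. -/
theorem contMDiff_mvfderiv_apply {f : M → ℝ} (hf : ContMDiff 𝓘(ℝ, E) 𝓘(ℝ, ℝ) ∞ f)
    {V : ∀ x : M, TangentSpace 𝓘(ℝ, E) x}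
    (hV : ContMDiff 𝓘(ℝ, E) (𝓘(ℝ, E).prod 𝓘(ℝ, E)) ∞
      (fun y => (⟨y, V y⟩ : TotalSpace E (TangentSpace 𝓘(ℝ, E) : M → Type _)))) :
    ContMDiff 𝓘(ℝ, E) 𝓘(ℝ, ℝ) ∞ (fun y => mvfderiv 𝓘(ℝ, E) f y (V y)) := by
  have h1 := (hf.contMDiff_tangentMap (m := ∞) (by simp)).comp hV
  exact ((contMDiff_snd_tangentBundle_modelSpace ℝ 𝓘(ℝ, ℝ)).of_le le_top).comp h1

/-- The vector field `ρ(X)`. -/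
def anchorField (ρ : Anchor 𝓘(ℝ, E) F A) (X : Cₛ^∞⟮𝓘(ℝ, E); F, A⟯) (x : M) :
    TangentSpace 𝓘(ℝ, E) x :=
  ρ.toFun x (X x)

theorem contMDiff_anchorField (ρ : Anchor 𝓘(ℝ, E) F A) (X : Cₛ^∞⟮𝓘(ℝ, E); F, A⟯) :
    ContMDiff 𝓘(ℝ, E) (𝓘(ℝ, E).prod 𝓘(ℝ, E)) ∞
      (fun y => (⟨y, anchorField ρ X y⟩ : TotalSpace E (TangentSpace 𝓘(ℝ, E) : M → Type _))) :=
  ρ.contMDiff_toFun.comp X.contMDiff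

/-- The derivative `ρ(X)[f]`. -/
def anchorDeriv (ρ : Anchor 𝓘(ℝ, E) F A) (X : Cₛ^∞⟮𝓘(ℝ, E); F, A⟯) (f : C^∞⟮𝓘(ℝ, E), M; ℝ⟯) :
    C^∞⟮𝓘(ℝ, E), M; ℝ⟯ :=
  ⟨fun y => mvfderiv 𝓘(ℝ, E) f y (anchorField ρ X y),
    contMDiff_mvfderiv_apply f.contMDiff (contMDiff_anchorField ρ X)⟩

/-! ### Local generators and tensoriality of function-linear operations. -/

section Local

variable [FiniteDimensional ℝ E] [T2Space M] [FiniteDimensional ℝ F]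
  [ContMDiffVectorBundle ∞ F A 𝓘(ℝ, E)]

theorem contMDiffOn_symmL (e : Trivialization F (π F A)) [MemTrivializationAtlas e] (v : F) :
    ContMDiffOn 𝓘(ℝ, E) (𝓘(ℝ, E).prod 𝓘(ℝ, F)) ∞
      (fun y => (⟨y, e.symmL ℝ y v⟩ : TotalSpace F A)) e.baseSet := by
  have := (e.contMDiffOn_section_baseSet_iff (IB := 𝓘(ℝ, E)) (n := ∞)
    (s := fun y => e.symmL ℝ y v)).2
  refine this ((contMDiffOn_const (c := v)).congr fun y hy => ?_)
  simp [hy]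

theorem exists_section_symmL (e : Trivialization F (π F A)) [MemTrivializationAtlas e] (v : F)
    {x : M} (hx : x ∈ e.baseSet) :
    ∃ X : Cₛ^∞⟮𝓘(ℝ, E); F, A⟯, ∀ᶠ y in 𝓝 x, X y = e.symmL ℝ y v :=
  exists_section_eventuallyEq (e.open_baseSet.mem_nhds hx) (contMDiffOn_symmL e v)

theorem exists_section_apply_eq {x : M} (v : A x) : ∃ X : Cₛ^∞⟮𝓘(ℝ, E); F, A⟯, X x = v := by
  let e := trivializationAt F A x
  have hx : x ∈ e.baseSet := FiberBundle.mem_baseSet_trivializationAt' x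
  obtain ⟨X, hX⟩ := exists_section_symmL (E := E) e (e.continuousLinearMapAt ℝ x v) hx
  exact ⟨X, hX.self_of_nhds.trans (e.symmL_continuousLinearMapAt hx v)⟩

theorem contMDiffOn_coord (e : Trivialization F (π F A)) [MemTrivializationAtlas e]
    (X : Cₛ^∞⟮𝓘(ℝ, E); F, A⟯) :
    ContMDiffOn 𝓘(ℝ, E) 𝓘(ℝ, F) ∞ (fun y => (e ⟨y, X y⟩).2) e.baseSet :=
  (e.contMDiffOn_section_baseSet_iff (IB := 𝓘(ℝ, E)) (n := ∞)).1 X.contMDiff.contMDiffOn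

/-- Near a point, all sections are combinations of finitely many sections, with coefficients whose
value at the point is determined by the value of the section. -/
theorem exists_local_generators (x : M) :
    ∃ (n : ℕ) (σ : Fin n → Cₛ^∞⟮𝓘(ℝ, E); F, A⟯) (c : Fin n → A x → ℝ), ∀ X : Cₛ^∞⟮𝓘(ℝ, E); F, A⟯,
      ∃ f : Fin n → C^∞⟮𝓘(ℝ, E), M; ℝ⟯,
        (∀ i, f i x = c i (X x)) ∧ ∀ᶠ y in 𝓝 x, X y = (∑ i, f i • σ i) y := by
  let e := trivializationAt F A x
  have hx : x ∈ e.baseSet := FiberBundle.mem_baseSet_trivializationAt' x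
  let b := Module.finBasis ℝ F
  have hσ : ∀ i, ∃ X : Cₛ^∞⟮𝓘(ℝ, E); F, A⟯, ∀ᶠ y in 𝓝 x, X y = e.symmL ℝ y (b i) :=
    fun i => exists_section_symmL e (b i) hx
  choose σ hσ using hσ
  refine ⟨_, σ, fun i v => b.repr (e ⟨x, v⟩).2 i, fun X => ?_⟩
  have hf : ∀ i, ∃ f : C^∞⟮𝓘(ℝ, E), M; ℝ⟯, ∀ᶠ y in 𝓝 x, f y = b.repr (e ⟨y, X y⟩).2 i := by
    intro i
    have h1 := (LinearMap.toContinuousLinearMap (b.coord i)).contMDiff.comp_contMDiffOn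
      (contMDiffOn_coord e X)
    exact exists_contMDiffMap_eventuallyEq (e.open_baseSet.mem_nhds hx) h1
  choose f hf using hf
  refine ⟨f, fun i => (hf i).self_of_nhds, ?_⟩
  filter_upwards [eventually_all.2 hσ, eventually_all.2 hf, e.open_baseSet.mem_nhds hx]
    with y hσy hfy hy
  simp only [section_sum_apply, section_smulFn_apply, hσy, hfy]
  simp only [← map_smul, ← map_sum, b.sum_repr]
  have := e.symmL_continuousLinearMapAt (R := ℝ) hy (X y)
  rw [Trivialization.continuousLinearMapAt_apply, e.coe_linearMapAt_of_mem hy] at this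
  exact this.symm

variable {N : Type*} [AddCommGroup N] [Module ℝ N]

/-- Function-linear operations on sections are local. -/
theorem apply_eq_of_eventuallyEq {T : Cₛ^∞⟮𝓘(ℝ, E); F, A⟯ → N} {x : M}
    (hs : ∀ (f : C^∞⟮𝓘(ℝ, E), M; ℝ⟯) X, T (f • X) = f x • T X) {X Y : Cₛ^∞⟮𝓘(ℝ, E); F, A⟯}
    (h : ∀ᶠ y in 𝓝 x, X y = Y y) : T X = T Y := by
  obtain ⟨f, hf, hf1⟩ := exists_bump (E := E) h
  -- `f` is supported where `X` and `Y` agree, so the two products agree globally, while `f x = 1`.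
  have hXY : f • X = f • Y := by
    ext y
    by_cases hy : y ∈ tsupport f
    · rw [section_smulFn_apply, section_smulFn_apply, hf hy]
    · rw [section_smulFn_apply, section_smulFn_apply, image_eq_zero_of_notMem_tsupport hy,
        zero_smul, zero_smul]
  have h1 := hf1.self_of_nhds
  have := hs f X
  rw [hXY, hs f Y, h1, one_smul, one_smul] at this
  exact this.symm

/-- Function-linear operations on sections are pointwise. -/
theorem apply_eq_of_apply_eq {T : Cₛ^∞⟮𝓘(ℝ, E); F, A⟯ → N} {x : M}
    (ha : ∀ X Y, T (X + Y) = T X + T Y)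
    (hs : ∀ (f : C^∞⟮𝓘(ℝ, E), M; ℝ⟯) X, T (f • X) = f x • T X) {X Y : Cₛ^∞⟮𝓘(ℝ, E); F, A⟯}
    (h : X x = Y x) : T X = T Y := by
  obtain ⟨n, σ, c, H⟩ := exists_local_generators (E := E) (F := F) (A := A) x
  -- The coefficients `c i (Z x)` see only the value of `Z` at `x`, and the generators `σ i` do not
  -- depend on `Z`.
  have key : ∀ Z : Cₛ^∞⟮𝓘(ℝ, E); F, A⟯, T Z = ∑ i, c i (Z x) • T (σ i) := by
    intro Z
    obtain ⟨f, hf, hZ⟩ := H Z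
    rw [apply_eq_of_eventuallyEq hs hZ]
    have := map_sum (AddMonoidHom.mk' T ha) (fun i => f i • σ i) Finset.univ
    simp only [AddMonoidHom.mk'_apply, hs, hf] at this
    exact this
  rw [key X, key Y, h]

end Local

/-! ### The connection on sections: flatness and the anchor as a bracket morphism. -/

section Connection

variable [∀ x, IsTopologicalAddGroup (A x)] [∀ x, ContinuousSMul ℝ (A x)]
  (ρ : Anchor 𝓘(ℝ, E) F A) (cov : CovariantDerivative 𝓘(ℝ, E) F A)

theorem cov_add_apply (X Y : Cₛ^∞⟮𝓘(ℝ, E); F, A⟯) (x : M) :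
    cov (X + Y : Cₛ^∞⟮𝓘(ℝ, E); F, A⟯) x = cov X x + cov Y x :=
  cov.isCovariantDerivativeOnUniv.add (section_mdifferentiableAt X x)
    (section_mdifferentiableAt Y x)

theorem cov_smulFn_apply (f : C^∞⟮𝓘(ℝ, E), M; ℝ⟯) (X : Cₛ^∞⟮𝓘(ℝ, E); F, A⟯) (x : M)
    (w : TangentSpace 𝓘(ℝ, E) x) :
    cov (f • X : Cₛ^∞⟮𝓘(ℝ, E); F, A⟯) x w = mvfderiv 𝓘(ℝ, E) f x w • X x + f x • cov X x w := by
  have := cov.isCovariantDerivativeOnUniv.leibniz (g := f) (section_mdifferentiableAt X x)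
    (smoothMap_mdifferentiableAt f x)
  have h2 := DFunLike.congr_fun this w
  refine h2.trans ?_
  simp [add_comm]

theorem cov_smul_apply (r : ℝ) (X : Cₛ^∞⟮𝓘(ℝ, E); F, A⟯) (x : M) :
    cov (r • X : Cₛ^∞⟮𝓘(ℝ, E); F, A⟯) x = r • cov X x :=
  cov.isCovariantDerivativeOnUniv.smul_const r (section_mdifferentiableAt X x)

theorem cov_eq_of_eventuallyEq {X Y : Cₛ^∞⟮𝓘(ℝ, E); F, A⟯} {x : M} (h : ∀ᶠ y in 𝓝 x, X y = Y y) :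
    cov X x = cov Y x :=
  cov.isCovariantDerivativeOnUniv.congr_of_eventuallyEq (section_mdifferentiableAt X x)
    (section_mdifferentiableAt Y x) univ_mem h

theorem cov_sum_smulFn_apply {ι : Type*} (s : Finset ι) (f : ι → C^∞⟮𝓘(ℝ, E), M; ℝ⟯)
    (X : ι → Cₛ^∞⟮𝓘(ℝ, E); F, A⟯)
    (x : M) (w : TangentSpace 𝓘(ℝ, E) x) :
    cov (∑ i ∈ s, f i • X i : Cₛ^∞⟮𝓘(ℝ, E); F, A⟯) x w =
      ∑ i ∈ s, (mvfderiv 𝓘(ℝ, E) (f i) x w • X i x + f i x • cov (X i) x w) := by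
  have ha : ∀ Y Z : Cₛ^∞⟮𝓘(ℝ, E); F, A⟯, cov (Y + Z : Cₛ^∞⟮𝓘(ℝ, E); F, A⟯) x w =
      cov Y x w + cov Z x w := fun Y Z => by
    rw [cov_add_apply]; rfl
  have := map_sum (AddMonoidHom.mk' (fun Y : Cₛ^∞⟮𝓘(ℝ, E); F, A⟯ => cov Y x w) ha)
    (fun i => f i • X i) s
  simp only [AddMonoidHom.mk'_apply, cov_smulFn_apply] at this
  exact this

variable [hcov : CovariantDerivative.ContMDiffCovariantDerivative cov ∞]

theorem inducedConnection_apply (X Y : Cₛ^∞⟮𝓘(ℝ, E); F, A⟯) (x : M) :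
    inducedConnection ρ cov X Y x = cov Y x (anchorField ρ X x) := rfl

theorem isAConnection_inducedConnection : IsAConnection ρ (inducedConnection ρ cov) where
  add_left X Y Z := by
    ext x
    simp [inducedConnection_apply, section_add_apply, anchorField]
  add_right X Y Z := by
    ext x
    exact DFunLike.congr_fun (cov_add_apply cov Y Z x) _
  smul_left r X Y := by
    ext x
    simp [inducedConnection_apply, section_smul_apply, anchorField]
  smul_right r X Y := by
    ext x
    exact DFunLike.congr_fun (cov_smul_apply cov r Y x) _
  smooth_smul_left f X Y := by
    ext x
    simp [inducedConnection_apply, section_smulFn_apply, anchorField]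
  leibniz f X Y x := cov_smulFn_apply cov f Y x _

variable {ρ cov}

/-- The Leibniz rule as an identity of global sections, so that it can be iterated. -/
theorem nab_smulFn (f : C^∞⟮𝓘(ℝ, E), M; ℝ⟯) (X Y : Cₛ^∞⟮𝓘(ℝ, E); F, A⟯) :
    inducedConnection ρ cov X (f • Y) =
      anchorDeriv ρ X f • Y + f • inducedConnection ρ cov X Y := by
  ext x
  exact cov_smulFn_apply cov f Y x _

/-- In a post-Lie algebroid the connection is flat with respect to `⟦·,·⟧`. -/
theorem flat_algebroidBracket
    {br : Cₛ^∞⟮𝓘(ℝ, E); F, A⟯ → Cₛ^∞⟮𝓘(ℝ, E); F, A⟯ → Cₛ^∞⟮𝓘(ℝ, E); F, A⟯}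
    (h : IsPostLieAlgebroid ρ br (inducedConnection ρ cov))
    (X Y Z : Cₛ^∞⟮𝓘(ℝ, E); F, A⟯) :
    inducedConnection ρ cov (algebroidBracket br (inducedConnection ρ cov) X Y) Z =
      inducedConnection ρ cov X (inducedConnection ρ cov Y Z) -
        inducedConnection ρ cov Y (inducedConnection ρ cov X Z) := by
  have h1 := h.postLie.bracket_tri X Y Z
  have hsub : ∀ X Y Z : Cₛ^∞⟮𝓘(ℝ, E); F, A⟯, inducedConnection ρ cov (X - Y) Z =
      inducedConnection ρ cov X Z - inducedConnection ρ cov Y Z := by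
    intro X Y Z
    ext x
    simp [inducedConnection_apply, section_sub_apply, anchorField]
  rw [algebroidBracket, h.postLie.tri_add_left, hsub, h1, tripleBracket, assoc, assoc]
  abel

variable [FiniteDimensional ℝ E] [T2Space M] [FiniteDimensional ℝ F]
  [ContMDiffVectorBundle ∞ F A 𝓘(ℝ, E)]

/-- In a transitive post-Lie algebroid the anchor maps `⟦·,·⟧` to the bracket of vector fields. -/
theorem anchorField_algebroidBracket
    {br : Cₛ^∞⟮𝓘(ℝ, E); F, A⟯ → Cₛ^∞⟮𝓘(ℝ, E); F, A⟯ → Cₛ^∞⟮𝓘(ℝ, E); F, A⟯}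
    (hρ : ρ.IsTransitive)
    (h : IsPostLieAlgebroid ρ br (inducedConnection ρ cov)) (X Y : Cₛ^∞⟮𝓘(ℝ, E); F, A⟯) (x : M) :
    anchorField ρ (algebroidBracket br (inducedConnection ρ cov) X Y) x =
      mlieBracket 𝓘(ℝ, E) (anchorField ρ X) (anchorField ρ Y) x := by
  -- Comparing coefficients of `Z x` needs a nonzero value. If the fiber is zero, surjectivity of
  -- the anchor makes the tangent space zero as well.
  by_cases hA : ∃ v : A x, v ≠ 0
  · obtain ⟨v, hv⟩ := hA
    obtain ⟨Z, hZ⟩ := exists_section_apply_eq (E := E) (F := F) v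
    refine tangent_eq_of_forall_mvfderiv_eq fun f => ?_
    have hdf : ∀ W : Cₛ^∞⟮𝓘(ℝ, E); F, A⟯, MDifferentiableAt 𝓘(ℝ, E) (𝓘(ℝ, E).prod 𝓘(ℝ, E)) (fun y =>
        (⟨y, anchorField ρ W y⟩ : TotalSpace E (TangentSpace 𝓘(ℝ, E) : M → Type _))) x :=
      fun W => (contMDiff_anchorField ρ W x).mdifferentiableAt (by simp)
    rw [mvfderiv_mlieBracket ((f.contMDiff x).of_le (by exact_mod_cast ENat.LEInfty.out))
      (hdf X) (hdf Y)]
    have hadd := (isAConnection_inducedConnection ρ cov).add_right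
    -- Expanding flatness on `f • Z` and removing flatness on `Z`, the mixed first-order terms
    -- cancel and only derivatives of `f` multiplying `Z` remain.
    have e1 := flat_algebroidBracket h X Y (f • Z)
    have e0 := flat_algebroidBracket h X Y Z
    rw [nab_smulFn f Y, nab_smulFn f X, hadd, hadd, nab_smulFn, nab_smulFn, nab_smulFn, nab_smulFn,
      nab_smulFn, e0] at e1
    have e2 := DFunLike.congr_fun e1 x
    simp only [section_add_apply, section_sub_apply, section_smulFn_apply, smul_sub] at e2
    have e3 : (anchorDeriv ρ (algebroidBracket br (inducedConnection ρ cov) X Y) f x -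
        (anchorDeriv ρ X (anchorDeriv ρ Y f) x - anchorDeriv ρ Y (anchorDeriv ρ X f) x)) • Z x
          = 0 := by
      rw [sub_smul, sub_smul, sub_eq_zero]
      refine (sub_eq_zero.1 ?_)
      rw [← sub_eq_zero] at e2
      rw [← e2]
      abel
    have e4 := (smul_eq_zero.1 e3).resolve_right (by rw [hZ]; exact hv)
    exact sub_eq_zero.1 e4
  · push Not at hA
    have : ∀ w : TangentSpace 𝓘(ℝ, E) x, w = 0 := by
      intro w
      obtain ⟨v, rfl⟩ := hρ x w
      rw [hA v, map_zero]
    rw [this (mlieBracket _ _ _ _)]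
    exact this _

end Connection

end Sections

/-! ### Parallel frames of a connection. -/

section ParallelFrame

open Set Filter Topology VectorField

variable {E : Type*} [NormedAddCommGroup E] [NormedSpace ℝ E]
  {M : Type*} [TopologicalSpace M] [ChartedSpace E M] [IsManifold 𝓘(ℝ, E) ∞ M]
  {F : Type*} [NormedAddCommGroup F] [NormedSpace ℝ F]
  {A : M → Type*} [TopologicalSpace (TotalSpace F A)]
  [∀ x, AddCommGroup (A x)] [∀ x, Module ℝ (A x)] [∀ x, TopologicalSpace (A x)]
  [FiberBundle F A] [VectorBundle ℝ F A]
  [∀ x, IsTopologicalAddGroup (A x)] [∀ x, ContinuousSMul ℝ (A x)]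
  {V : Type*} [NormedAddCommGroup V] [NormedSpace ℝ V]
  {V' : Type*} [NormedAddCommGroup V'] [NormedSpace ℝ V']

/-- `hom` and `inv` are mutually inverse isomorphisms between `V × U` and `A|_U` that carry the
connection `cov` to the differentiation of `V`-valued functions. -/
structure IsParallelFrame (cov : CovariantDerivative 𝓘(ℝ, E) F A) (U : TopologicalSpace.Opens M)
    (hom : ∀ x : M, V →L[ℝ] A x) (inv : ∀ x : M, A x →L[ℝ] V) : Prop where
  inv_hom : ∀ x ∈ U, ∀ v : V, inv x (hom x v) = v
  hom_inv : ∀ x ∈ U, ∀ a : A x, hom x (inv x a) = a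
  contMDiffOn_hom : ContMDiffOn (𝓘(ℝ, E).prod 𝓘(ℝ, V)) (𝓘(ℝ, E).prod 𝓘(ℝ, F)) ∞
    (fun p : M × V => (⟨p.1, hom p.1 p.2⟩ : TotalSpace F A)) {p | p.1 ∈ U}
  contMDiffOn_inv : ContMDiffOn (𝓘(ℝ, E).prod 𝓘(ℝ, F)) (𝓘(ℝ, E).prod 𝓘(ℝ, V)) ∞
    (fun p : TotalSpace F A => ((p.1, inv p.1 p.2) : M × V)) {p | p.1 ∈ U}
  inv_cov : ∀ Y : Cₛ^∞⟮𝓘(ℝ, E); F, A⟯, ∀ x ∈ U, ∀ w : TangentSpace 𝓘(ℝ, E) x,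
    inv x (cov Y x w) = mvfderiv 𝓘(ℝ, E) (fun y => inv y (Y y)) x w

namespace IsParallelFrame

variable {cov : CovariantDerivative 𝓘(ℝ, E) F A} {U U' : TopologicalSpace.Opens M}
  {hom : ∀ x : M, V →L[ℝ] A x} {inv : ∀ x : M, A x →L[ℝ] V}
  {hom' : ∀ x : M, V' →L[ℝ] A x} {inv' : ∀ x : M, A x →L[ℝ] V'}

theorem contMDiffOn_hom_apply (h : IsParallelFrame cov U hom inv) (v : V) :
    ContMDiffOn 𝓘(ℝ, E) (𝓘(ℝ, E).prod 𝓘(ℝ, F)) ∞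
      (fun y => (⟨y, hom y v⟩ : TotalSpace F A)) U :=
  h.contMDiffOn_hom.comp (contMDiffOn_id.prodMk contMDiffOn_const) fun _ hy => hy

theorem contMDiffOn_inv_apply (h : IsParallelFrame cov U hom inv) (X : Cₛ^∞⟮𝓘(ℝ, E); F, A⟯) :
    ContMDiffOn 𝓘(ℝ, E) 𝓘(ℝ, V) ∞ (fun y => inv y (X y)) U :=
  contMDiffOn_snd.comp (t := univ)
    (h.contMDiffOn_inv.comp X.contMDiff.contMDiffOn fun _ hy => hy) (fun _ _ => mem_univ _)

theorem mdifferentiableAt_inv_apply (h : IsParallelFrame cov U hom inv) (X : Cₛ^∞⟮𝓘(ℝ, E); F, A⟯)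
    {x : M}
    (hx : x ∈ U) : MDifferentiableAt 𝓘(ℝ, E) 𝓘(ℝ, V) (fun y => inv y (X y)) x :=
  ((h.contMDiffOn_inv_apply X).contMDiffAt (U.isOpen.mem_nhds hx)).mdifferentiableAt (by simp)

theorem mono (h : IsParallelFrame cov U hom inv) (hU : U' ≤ U) :
    IsParallelFrame cov U' hom inv where
  inv_hom x hx := h.inv_hom x (hU hx)
  hom_inv x hx := h.hom_inv x (hU hx)
  contMDiffOn_hom := h.contMDiffOn_hom.mono fun _ hp => hU hp
  contMDiffOn_inv := h.contMDiffOn_inv.mono fun _ hp => hU hp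
  inv_cov Y x hx := h.inv_cov Y x (hU hx)

/-- A family of maps that locally agrees with parallel frames up to constant isomorphisms is a
parallel frame. -/
theorem of_locally (H : ∀ x ∈ U, ∃ (U' : TopologicalSpace.Opens M) (hom' : ∀ x : M, V' →L[ℝ] A x)
    (inv' : ∀ x : M, A x →L[ℝ] V') (T : V ≃L[ℝ] V'), x ∈ U' ∧ IsParallelFrame cov U' hom' inv' ∧
      (∀ y ∈ U', ∀ v, hom y v = hom' y (T v)) ∧ ∀ y ∈ U', ∀ a, inv y a = T.symm (inv' y a)) :
    IsParallelFrame cov U hom inv where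
  inv_hom x hx v := by
    obtain ⟨U', hom', inv', T, hxU, h, h1, h2⟩ := H x hx
    rw [h2 x hxU, h1 x hxU, h.inv_hom x hxU, T.symm_apply_apply]
  hom_inv x hx v := by
    obtain ⟨U', hom', inv', T, hxU, h, h1, h2⟩ := H x hx
    rw [h1 x hxU, h2 x hxU, T.apply_symm_apply, h.hom_inv x hxU]
  contMDiffOn_hom := by
    rintro ⟨x, v⟩ hx
    obtain ⟨U', hom', inv', T, hxU, h, h1, h2⟩ := H x hx
    have hS : {p : M × V | p.1 ∈ U'} ∈ 𝓝 (x, v) :=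
      continuous_fst.continuousAt (U'.isOpen.mem_nhds hxU)
    have h3 : ContMDiffOn (𝓘(ℝ, E).prod 𝓘(ℝ, V)) (𝓘(ℝ, E).prod 𝓘(ℝ, V')) ∞
        (fun p : M × V => ((p.1, T p.2) : M × V')) {p | p.1 ∈ U'} :=
      contMDiffOn_fst.prodMk
        (((T : V →L[ℝ] V').contMDiff.comp contMDiff_snd).contMDiffOn)
    have h4 := h.contMDiffOn_hom.comp h3 fun _ hp => hp
    exact ((h4.congr fun p hp => by simp only [Function.comp, h1 p.1 hp]).contMDiffAt
      hS).contMDiffWithinAt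
  contMDiffOn_inv := by
    rintro ⟨x, a⟩ hx
    obtain ⟨U', hom', inv', T, hxU, h, h1, h2⟩ := H x hx
    have hS : {p : TotalSpace F A | p.1 ∈ U'} ∈ 𝓝 (⟨x, a⟩ : TotalSpace F A) :=
      (FiberBundle.continuous_proj F A).continuousAt (U'.isOpen.mem_nhds hxU)
    have h3 : ContMDiff (𝓘(ℝ, E).prod 𝓘(ℝ, V')) (𝓘(ℝ, E).prod 𝓘(ℝ, V)) ∞
        (fun p : M × V' => ((p.1, T.symm p.2) : M × V)) :=
      contMDiff_fst.prodMk ((T.symm : V' →L[ℝ] V).contMDiff.comp contMDiff_snd)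
    have h4 := h3.comp_contMDiffOn h.contMDiffOn_inv
    exact ((h4.congr fun p hp => by simp only [Function.comp, h2 p.1 hp]).contMDiffAt
      hS).contMDiffWithinAt
  inv_cov Y x hx w := by
    obtain ⟨U', hom', inv', T, hxU, h, h1, h2⟩ := H x hx
    rw [h2 x hxU, h.inv_cov Y x hxU]
    have h3 := mvfderiv_clm_comp (T.symm : V' →L[ℝ] V) (h.mdifferentiableAt_inv_apply Y hxU) w
    refine h3.symm.trans ?_
    rw [mvfderiv_congr_of_eventuallyEq]
    filter_upwards [U'.isOpen.mem_nhds hxU] with y hy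
    exact (h2 y hy _).symm

theorem comp_equiv (h : IsParallelFrame cov U hom inv) (T : V' ≃L[ℝ] V) :
    IsParallelFrame cov U (fun x => (hom x).comp (T : V' →L[ℝ] V))
      (fun x => (T.symm : V →L[ℝ] V').comp (inv x)) :=
  of_locally fun _ hx => ⟨U, hom, inv, T, hx, h, fun _ _ _ => rfl, fun _ _ _ => rfl⟩

/-- In the frame such a section has constant coordinates near `x`, and `∇` is differentiation of
coordinates. -/
theorem cov_eq_zero (h : IsParallelFrame cov U hom inv) {S : Cₛ^∞⟮𝓘(ℝ, E); F, A⟯} {v : V} {x : M}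
    (hx : x ∈ U)
    (hS : ∀ᶠ y in 𝓝 x, S y = hom y v) (w : TangentSpace 𝓘(ℝ, E) x) : cov S x w = 0 := by
  rw [← h.hom_inv x hx (cov S x w), h.inv_cov S x hx]
  have h1 : (fun y => inv y (S y)) =ᶠ[𝓝 x] fun _ => v := by
    filter_upwards [hS, U.isOpen.mem_nhds hx] with y hy hyU
    rw [hy, h.inv_hom y hyU]
  rw [mvfderiv_congr_of_eventuallyEq h1, mvfderiv_const]
  simp

variable [FiniteDimensional ℝ E] [T2Space M]

theorem exists_section (h : IsParallelFrame cov U hom inv) (v : V) {x : M} (hx : x ∈ U) :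
    ∃ S : Cₛ^∞⟮𝓘(ℝ, E); F, A⟯, ∀ᶠ y in 𝓝 x, S y = hom y v :=
  exists_section_eventuallyEq (U.isOpen.mem_nhds hx) (h.contMDiffOn_hom_apply v)

/-- The transition functions between parallel frames are locally constant. -/
theorem eventually_inv_hom_eq (h : IsParallelFrame cov U hom inv)
    (h' : IsParallelFrame cov U' hom' inv') (v : V) {x : M} (hx : x ∈ U) (hx' : x ∈ U') :
    ∀ᶠ y in 𝓝 x, inv' y (hom y v) = inv' x (hom x v) := by
  obtain ⟨S, hS⟩ := h.exists_section v hx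
  have hU := U.isOpen.mem_nhds hx
  have hU' := U'.isOpen.mem_nhds hx'
  -- `S` is parallel near `x`, so its coordinates in the second frame have zero derivative.
  have h1 := eventually_eq_of_mvfderiv_eq_zero (E := E) (f := fun y => inv' y (S y)) (x := x)
    (by filter_upwards [hU'] with y hy using h'.mdifferentiableAt_inv_apply S hy)
    (by
      filter_upwards [hU, hU', hS.eventually_nhds] with y hy hy' hSy w
      rw [← h'.inv_cov S y hy', h.cov_eq_zero hy hSy, map_zero])
  filter_upwards [h1, hS] with y hy hSy
  rw [← hSy, hy, hS.self_of_nhds]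

end IsParallelFrame

end ParallelFrame

/-- The normed Lie ring given by a Lie bracket on a normed space. -/
abbrev IsLieBracket.normedLieRing {V : Type*} [NormedAddCommGroup V] [NormedSpace ℝ V]
    {b : V → V → V} (hb : IsLieBracket b) : NormedLieRing V :=
  { ‹NormedAddCommGroup V› with
    bracket := b
    add_lie := hb.add_left
    lie_add := hb.add_right
    lie_self := hb.self
    leibniz_lie := fun X Y Z => by
      have hn : ∀ X Y, b X (-Y) = -b X Y := fun X Y => by
        rw [← neg_one_smul ℝ Y, hb.smul_right, neg_one_smul]
      have hs : ∀ X Y, b X Y = -b Y X := fun X Y => by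
        have := hb.self (X + Y)
        rw [hb.add_left, hb.add_right, hb.add_right, hb.self, hb.self, zero_add, add_zero] at this
        exact eq_neg_of_add_eq_zero_left this
      have := hb.jacobi X Y Z
      change b X (b Y Z) = b (b X Y) Z + b Y (b X Z)
      rw [hs (b X Y) Z, hs X Z, hn]
      rw [add_assoc] at this
      rw [eq_neg_of_add_eq_zero_left this]
      abel }

/-- The normed Lie algebra given by a Lie bracket on a normed space. -/
abbrev IsLieBracket.normedLieAlgebra {V : Type*} [NormedAddCommGroup V] [i : NormedSpace ℝ V]
    {b : V → V → V} (hb : IsLieBracket b) :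
    letI := hb.normedLieRing
    NormedLieAlgebra V :=
  letI := hb.normedLieRing
  { i with
    lie_smul := hb.smul_right }

/-! ### From a parallel frame to an action algebroid. -/

section Frame

open Set Filter Topology VectorField

variable {E : Type*} [NormedAddCommGroup E] [NormedSpace ℝ E]
  {M : Type*} [TopologicalSpace M] [ChartedSpace E M] [IsManifold 𝓘(ℝ, E) ∞ M]
  {F : Type*} [NormedAddCommGroup F] [NormedSpace ℝ F]
  {A : M → Type*} [TopologicalSpace (TotalSpace F A)]
  [∀ x, AddCommGroup (A x)] [∀ x, Module ℝ (A x)] [∀ x, TopologicalSpace (A x)]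
  [FiberBundle F A] [VectorBundle ℝ F A]
  [FiniteDimensional ℝ E] [T2Space M] [FiniteDimensional ℝ F]
  [ContMDiffVectorBundle ∞ F A 𝓘(ℝ, E)]

/-- A global section with a given value at a point. -/
def extendSection {x : M} (a : A x) : Cₛ^∞⟮𝓘(ℝ, E); F, A⟯ :=
  (exists_section_apply_eq (E := E) (F := F) a).choose

theorem extendSection_apply {x : M} (a : A x) :
    (extendSection a : Cₛ^∞⟮𝓘(ℝ, E); F, A⟯) x = a :=
  (exists_section_apply_eq (E := E) (F := F) a).choose_spec

/-- The bilinear map on the fiber at `x` given by a function-bilinear operation on sections. -/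
def fiberBracket (br : Cₛ^∞⟮𝓘(ℝ, E); F, A⟯ → Cₛ^∞⟮𝓘(ℝ, E); F, A⟯ → Cₛ^∞⟮𝓘(ℝ, E); F, A⟯)
    (x : M) (a b : A x) : A x :=
  br (extendSection a) (extendSection b) x

section Bracket

variable [∀ x, IsTopologicalAddGroup (A x)] [∀ x, ContinuousSMul ℝ (A x)]
  {ρ : Anchor 𝓘(ℝ, E) F A}
  {br nab : Cₛ^∞⟮𝓘(ℝ, E); F, A⟯ → Cₛ^∞⟮𝓘(ℝ, E); F, A⟯ → Cₛ^∞⟮𝓘(ℝ, E); F, A⟯}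

/-- The bracket is function-linear in each slot, so each argument may be replaced in turn by any
section with the same value at `x`; the chosen extensions do not matter. -/
theorem fiberBracket_apply (h : IsPostLieAlgebroid ρ br nab) (X Y : Cₛ^∞⟮𝓘(ℝ, E); F, A⟯) (x : M) :
    fiberBracket br x (X x) (Y x) = br X Y x := by
  have h1 : ∀ Z : Cₛ^∞⟮𝓘(ℝ, E); F, A⟯, br (extendSection (X x)) Z x = br X Z x := fun Z =>
    apply_eq_of_apply_eq (T := fun X : Cₛ^∞⟮𝓘(ℝ, E); F, A⟯ => br X Z x)
      (fun X Y => by rw [h.postLie.lie.add_left, section_add_apply])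
      (fun f X => by rw [h.tensorial_left, section_smulFn_apply]) (extendSection_apply _)
  have h2 : br X (extendSection (Y x)) x = br X Y x :=
    apply_eq_of_apply_eq (T := fun Z : Cₛ^∞⟮𝓘(ℝ, E); F, A⟯ => br X Z x)
      (fun Y Z => by rw [h.postLie.lie.add_right, section_add_apply])
      (fun f Z => by rw [h.tensorial_right, section_smulFn_apply]) (extendSection_apply _)
  rw [fiberBracket, h1, h2]

/-- Every fiber vector is the value of a global section, so the identities descend from sections to
fibers. -/
theorem isLieBracket_fiberBracket (h : IsPostLieAlgebroid ρ br nab) (x : M) :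
    IsLieBracket (fiberBracket br x) := by
  have hs : ∀ a : A x, ∃ X : Cₛ^∞⟮𝓘(ℝ, E); F, A⟯, X x = a := exists_section_apply_eq
  have hl := h.postLie.lie
  constructor
  · intro a b c
    obtain ⟨⟨X, rfl⟩, ⟨Y, rfl⟩, ⟨Z, rfl⟩⟩ := And.intro (hs a) (And.intro (hs b) (hs c))
    rw [← section_add_apply, fiberBracket_apply h, fiberBracket_apply h, fiberBracket_apply h,
      hl.add_left, section_add_apply]
  · intro a b c
    obtain ⟨⟨X, rfl⟩, ⟨Y, rfl⟩, ⟨Z, rfl⟩⟩ := And.intro (hs a) (And.intro (hs b) (hs c))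
    rw [← section_add_apply, fiberBracket_apply h, fiberBracket_apply h, fiberBracket_apply h,
      hl.add_right, section_add_apply]
  · intro r a b
    obtain ⟨⟨X, rfl⟩, ⟨Y, rfl⟩⟩ := And.intro (hs a) (hs b)
    rw [← section_smul_apply, fiberBracket_apply h, fiberBracket_apply h, hl.smul_left,
      section_smul_apply]
  · intro r a b
    obtain ⟨⟨X, rfl⟩, ⟨Y, rfl⟩⟩ := And.intro (hs a) (hs b)
    rw [← section_smul_apply, fiberBracket_apply h, fiberBracket_apply h, hl.smul_right,
      section_smul_apply]
  · intro a
    obtain ⟨X, rfl⟩ := hs a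
    rw [fiberBracket_apply h, hl.self]
    rfl
  · intro a b c
    obtain ⟨⟨X, rfl⟩, ⟨Y, rfl⟩, ⟨Z, rfl⟩⟩ := And.intro (hs a) (And.intro (hs b) (hs c))
    simp only [fiberBracket_apply h]
    rw [← section_add_apply, ← section_add_apply, hl.jacobi]
    rfl

end Bracket

namespace IsParallelFrame

variable [∀ x, IsTopologicalAddGroup (A x)] [∀ x, ContinuousSMul ℝ (A x)]
  {V : Type*} [NormedAddCommGroup V] [NormedSpace ℝ V]
  {ρ : Anchor 𝓘(ℝ, E) F A}
  {br : Cₛ^∞⟮𝓘(ℝ, E); F, A⟯ → Cₛ^∞⟮𝓘(ℝ, E); F, A⟯ → Cₛ^∞⟮𝓘(ℝ, E); F, A⟯}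
  {cov : CovariantDerivative 𝓘(ℝ, E) F A}
  [hcov : CovariantDerivative.ContMDiffCovariantDerivative cov ∞]
  {U : TopologicalSpace.Opens M}
  {hom : ∀ x : M, V →L[ℝ] A x} {inv : ∀ x : M, A x →L[ℝ] V}

/-- The bracket of a post-Lie algebroid in a parallel frame. -/
def frameBracket (br : Cₛ^∞⟮𝓘(ℝ, E); F, A⟯ → Cₛ^∞⟮𝓘(ℝ, E); F, A⟯ → Cₛ^∞⟮𝓘(ℝ, E); F, A⟯)
    (hom : ∀ x : M, V →L[ℝ] A x) (inv : ∀ x : M, A x →L[ℝ] V) (x : M) (v w : V) : V :=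
  inv x (fiberBracket br x (hom x v) (hom x w))

theorem isLieBracket_frameBracket (hP : IsPostLieAlgebroid ρ br (inducedConnection ρ cov))
    (h : IsParallelFrame cov U hom inv) {x : M} (hx : x ∈ U) :
    IsLieBracket (frameBracket br hom inv x) := by
  have hl := isLieBracket_fiberBracket hP x
  constructor
  · intro a b c; simp only [frameBracket, map_add, hl.add_left]
  · intro a b c; simp only [frameBracket, map_add, hl.add_right]
  · intro r a b; simp only [frameBracket, map_smul, hl.smul_left]
  · intro r a b; simp only [frameBracket, map_smul, hl.smul_right]
  · intro a; simp only [frameBracket, hl.self, map_zero]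
  · intro a b c
    simp only [frameBracket, h.hom_inv x hx]
    rw [← map_add, ← map_add, hl.jacobi, map_zero]

/-- For parallel `S` and `T` the derivation axiom gives `X ▷ [S, T] = 0`. Transitivity lets `ρ(X)`
run through all tangent directions, so the coordinates of `[S, T]` have zero derivative. -/
theorem eventually_frameBracket_eq (hρ : ρ.IsTransitive)
    (hP : IsPostLieAlgebroid ρ br (inducedConnection ρ cov))
    (h : IsParallelFrame cov U hom inv) (v w : V) {x : M} (hx : x ∈ U) :
    ∀ᶠ y in 𝓝 x, frameBracket br hom inv y v w = frameBracket br hom inv x v w := by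
  obtain ⟨S, hS⟩ := h.exists_section v hx
  obtain ⟨T, hT⟩ := h.exists_section w hx
  have hU := U.isOpen.mem_nhds hx
  have hST : ∀ᶠ y in 𝓝 x, frameBracket br hom inv y v w = inv y (br S T y) := by
    filter_upwards [hS, hT] with y hy hy'
    rw [frameBracket, ← hy, ← hy', fiberBracket_apply hP]
  have h1 := eventually_eq_of_mvfderiv_eq_zero (E := E) (f := fun y => inv y (br S T y)) (x := x)
    (by filter_upwards [hU] with y hy using h.mdifferentiableAt_inv_apply _ hy)
    (by
      filter_upwards [hU, hS.eventually_nhds, hT.eventually_nhds] with y hy hSy hTy u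
      obtain ⟨a, rfl⟩ := hρ y u
      obtain ⟨X, rfl⟩ := exists_section_apply_eq (E := E) (F := F) a
      rw [← h.inv_cov _ y hy]
      have h2 := DFunLike.congr_fun (hP.postLie.derivation X S T) y
      rw [section_add_apply, ← fiberBracket_apply hP, ← fiberBracket_apply hP,
        inducedConnection_apply, inducedConnection_apply, inducedConnection_apply,
        h.cov_eq_zero hy hSy, h.cov_eq_zero hy hTy] at h2
      have hl := isLieBracket_fiberBracket hP y
      have hz1 : ∀ b, fiberBracket br y 0 b = 0 := fun b => by
        simpa using hl.smul_left 0 0 b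
      have hz2 : ∀ b, fiberBracket br y b 0 = 0 := fun b => by
        simpa using hl.smul_right 0 b 0
      rw [hz1, hz2, add_zero] at h2
      have h3 : cov (br S T) y (ρ.toFun y (X y)) = 0 := h2
      rw [h3, map_zero])
  filter_upwards [h1, hST] with y hy hy'
  rw [hy', hy, hST.self_of_nhds]

theorem frameBracket_eq (hρ : ρ.IsTransitive)
    (hP : IsPostLieAlgebroid ρ br (inducedConnection ρ cov))
    (h : IsParallelFrame cov U hom inv) (hU : IsPreconnected (U : Set M)) (v w : V) {x y : M}
    (hx : x ∈ U) (hy : y ∈ U) :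
    frameBracket br hom inv y v w = frameBracket br hom inv x v w := by
  -- With the discrete topology on the target, local constancy is continuity, and a continuous map
  -- on a preconnected set is constant.
  let _ : TopologicalSpace V := ⊥
  have : DiscreteTopology V := ⟨rfl⟩
  refine hU.constant (f := fun y => frameBracket br hom inv y v w) (fun z hz => ?_) hy hx
  exact (continuousAt_const.congr
    (EventuallyEq.symm (h.eventually_frameBracket_eq hρ hP v w hz))).continuousWithinAt

/-- For sections parallel near `x` the two `∇`-terms vanish, so `⟦S, T⟧` and `[S, T]` agree at `x`,
and the anchor intertwines `⟦·,·⟧` with the commutator. This is the homomorphism property of the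
action. -/
theorem anchor_hom_frameBracket (hρ : ρ.IsTransitive)
    (hP : IsPostLieAlgebroid ρ br (inducedConnection ρ cov))
    (h : IsParallelFrame cov U hom inv) (v w : V) {x : M} (hx : x ∈ U) :
    ρ.toFun x (hom x (frameBracket br hom inv x v w)) =
      mlieBracket 𝓘(ℝ, E) (fun y => ρ.toFun y (hom y v)) (fun y => ρ.toFun y (hom y w)) x := by
  obtain ⟨S, hS⟩ := h.exists_section v hx
  obtain ⟨T, hT⟩ := h.exists_section w hx
  have e1 : anchorField ρ S =ᶠ[𝓝 x] fun y => ρ.toFun y (hom y v) := by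
    filter_upwards [hS] with y hy
    rw [anchorField, hy]
  have e2 : anchorField ρ T =ᶠ[𝓝 x] fun y => ρ.toFun y (hom y w) := by
    filter_upwards [hT] with y hy
    rw [anchorField, hy]
  rw [← e1.mlieBracket_vectorField_eq e2, ← anchorField_algebroidBracket hρ hP, anchorField,
    frameBracket, h.hom_inv x hx, ← hS.self_of_nhds, ← hT.self_of_nhds, fiberBracket_apply hP]
  congr 1
  rw [algebroidBracket, section_add_apply, section_sub_apply, inducedConnection_apply,
    inducedConnection_apply, h.cov_eq_zero hx hS, h.cov_eq_zero hx hT]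
  simp

end IsParallelFrame

/-- A transitive post-Lie algebroid with a parallel frame over a connected open set is a
transitive action algebroid. -/
theorem IsParallelFrame.isTransitiveActionAlgebroidOver
    [∀ x, IsTopologicalAddGroup (A x)] [∀ x, ContinuousSMul ℝ (A x)]
    {V : Type} [NormedAddCommGroup V] [NormedSpace ℝ V] [FiniteDimensional ℝ V]
    {ρ : Anchor 𝓘(ℝ, E) F A}
    {br : Cₛ^∞⟮𝓘(ℝ, E); F, A⟯ → Cₛ^∞⟮𝓘(ℝ, E); F, A⟯ → Cₛ^∞⟮𝓘(ℝ, E); F, A⟯}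
    {cov : CovariantDerivative 𝓘(ℝ, E) F A}
    [hcov : CovariantDerivative.ContMDiffCovariantDerivative cov ∞]
    {U : TopologicalSpace.Opens M}
    {hom : ∀ x : M, V →L[ℝ] A x} {inv : ∀ x : M, A x →L[ℝ] V}
    (h : IsParallelFrame cov U hom inv) (hU : IsPreconnected (U : Set M))
    (hne : (U : Set M).Nonempty)
    (hρ : ρ.IsTransitive) (hP : IsPostLieAlgebroid ρ br (inducedConnection ρ cov)) :
    IsTransitiveActionAlgebroidOver U ρ
      (algebroidBracket br (inducedConnection ρ cov)) cov := by
  obtain ⟨x₀, hx₀⟩ := hne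
  -- The Lie algebra is `V` with the structure constants at the base point `x₀`; `hbx` identifies
  -- them with those at any other point of `U`.
  have hb := h.isLieBracket_frameBracket hP hx₀
  have hbx : ∀ {x}, x ∈ U → ∀ v w, frameBracket br hom inv x₀ v w = frameBracket br hom inv x v w :=
    fun hx v w => h.frameBracket_eq hρ hP hU v w hx hx₀
  let action : @LieAlgebraAction E _ _ E _ M _ _ 𝓘(ℝ, E) V hb.normedLieRing
      hb.normedLieAlgebra _ U :=
    letI := hb.normedLieRing
    letI := hb.normedLieAlgebra
    { toFun :=
        { toFun := fun v x => ρ.toFun x (hom x v)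
          map_add' := fun v w => by
            ext x
            simp only [map_add, Pi.add_apply]
          map_smul' := fun r v => by
            ext x
            simp only [map_smul, Pi.smul_apply, RingHom.id_apply] }
      contMDiffOn_toFun := fun v => ρ.contMDiff_toFun.comp_contMDiffOn (h.contMDiffOn_hom_apply v)
      map_lie := fun v w x hx => by
        have := h.anchor_hom_frameBracket hρ hP v w hx
        rw [← hbx hx] at this
        exact this }
  refine ⟨V, hb.normedLieRing, hb.normedLieAlgebra, ‹_›, action, ?_, ⟨?_⟩⟩
  · intro x hx w
    obtain ⟨a, rfl⟩ := hρ x w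
    refine ⟨inv x a, ?_⟩
    change ρ.toFun x (hom x (inv x a)) = _
    rw [h.hom_inv x hx]
  · letI := hb.normedLieRing
    letI := hb.normedLieAlgebra
    exact
    { hom := hom
      inv := inv
      inv_hom := h.inv_hom
      hom_inv := h.hom_inv
      contMDiffOn_hom := h.contMDiffOn_hom
      contMDiffOn_inv := h.contMDiffOn_inv
      anchor_hom := fun x _ v => rfl
      inv_bracket := fun X Y x hx => by
        -- The derivatives of coordinates in the action bracket are the `∇`-terms of `⟦X, Y⟧`, and
        -- the bracket of `𝔤` is the remaining `[X, Y]`.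
        change _ = frameBracket br hom inv x₀ (inv x (X x)) (inv x (Y x)) +
          mvfderiv 𝓘(ℝ, E) (fun y => inv y (Y y)) x (ρ.toFun x (hom x (inv x (X x)))) -
          mvfderiv 𝓘(ℝ, E) (fun y => inv y (X y)) x (ρ.toFun x (hom x (inv x (Y x))))
        rw [hbx hx, frameBracket, h.hom_inv x hx, h.hom_inv x hx, fiberBracket_apply hP,
          ← h.inv_cov X x hx, ← h.inv_cov Y x hx, algebroidBracket, section_add_apply,
          section_sub_apply, map_add, map_sub, inducedConnection_apply, inducedConnection_apply]
        simp only [anchorField]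
        abel
      inv_connection := h.inv_cov }

end Frame

/-! ### Action algebroids are post-Lie algebroids. -/

section Converse

open Set Filter Topology VectorField

variable {E : Type*} [NormedAddCommGroup E] [NormedSpace ℝ E]
  {M : Type*} [TopologicalSpace M] [ChartedSpace E M] [IsManifold 𝓘(ℝ, E) ∞ M]
  {F : Type*} [NormedAddCommGroup F] [NormedSpace ℝ F]
  {A : M → Type*} [TopologicalSpace (TotalSpace F A)]
  [∀ x, AddCommGroup (A x)] [∀ x, Module ℝ (A x)] [∀ x, TopologicalSpace (A x)]
  [∀ x, IsTopologicalAddGroup (A x)] [∀ x, ContinuousSMul ℝ (A x)]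
  [FiberBundle F A] [VectorBundle ℝ F A]

variable {ρ : Anchor 𝓘(ℝ, E) F A}
  {br : Cₛ^∞⟮𝓘(ℝ, E); F, A⟯ → Cₛ^∞⟮𝓘(ℝ, E); F, A⟯ → Cₛ^∞⟮𝓘(ℝ, E); F, A⟯}
  {cov : CovariantDerivative 𝓘(ℝ, E) F A}
  [hcov : CovariantDerivative.ContMDiffCovariantDerivative cov ∞]
  {U : TopologicalSpace.Opens M} {𝔤 : Type*} [NormedLieRing 𝔤] [NormedLieAlgebra 𝔤]
  {a : LieAlgebraAction 𝓘(ℝ, E) 𝔤 U}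

namespace ActionAlgebroidIso

variable (φ : ActionAlgebroidIso ρ (algebroidBracket br (inducedConnection ρ cov)) cov a)

theorem isParallelFrame : IsParallelFrame cov U φ.hom φ.inv where
  inv_hom := φ.inv_hom
  hom_inv := φ.hom_inv
  contMDiffOn_hom := φ.contMDiffOn_hom
  contMDiffOn_inv := φ.contMDiffOn_inv
  inv_cov := φ.inv_connection

theorem anchor_inv {x : M} (hx : x ∈ U) (v : A x) : a.anchor x (φ.inv x v) = ρ.toFun x v := by
  rw [← φ.anchor_hom x hx, φ.hom_inv x hx]

/-- The derivative terms of the action bracket cancel against the `∇`-terms of `⟦X, Y⟧`, so `[·,·]`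
is the pointwise bracket of `𝔤`. All algebraic axioms for `br` follow from this. -/
theorem inv_br (X Y : Cₛ^∞⟮𝓘(ℝ, E); F, A⟯) {x : M} (hx : x ∈ U) :
    φ.inv x (br X Y x) = ⁅φ.inv x (X x), φ.inv x (Y x)⁆ := by
  have h := φ.inv_bracket X Y x hx
  have hX := φ.inv_connection X x hx (ρ.toFun x (Y x))
  have hY := φ.inv_connection Y x hx (ρ.toFun x (X x))
  rw [LieAlgebraAction.canonicalFlatConnection] at hX hY
  rw [LieAlgebraAction.bracket, φ.anchor_inv hx, φ.anchor_inv hx, ← hX, ← hY,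
    algebroidBracket, section_add_apply, section_sub_apply, map_add, map_sub,
    inducedConnection_apply, inducedConnection_apply, anchorField, anchorField] at h
  have h2 : ∀ p q r s : 𝔤, p - q + r = s + p - q → r = s := fun p q r s h => by
    have : r - s = (p - q + r) - (s + p - q) := by abel
    rw [← sub_eq_zero, this, h, sub_self]
  exact h2 _ _ _ _ h

theorem br_apply (X Y : Cₛ^∞⟮𝓘(ℝ, E); F, A⟯) {x : M} (hx : x ∈ U) :
    br X Y x = φ.hom x ⁅φ.inv x (X x), φ.inv x (Y x)⁆ := by
  rw [← φ.inv_br X Y hx, φ.hom_inv x hx]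

variable [FiniteDimensional ℝ E] [T2Space M] [FiniteDimensional ℝ F]
  [ContMDiffVectorBundle ∞ F A 𝓘(ℝ, E)]

include φ in
/-- The anchor of an action algebroid maps the bracket to the bracket of vector fields. -/
theorem anchorField_algebroidBracket (X Y : Cₛ^∞⟮𝓘(ℝ, E); F, A⟯) {x : M} (hx : x ∈ U) :
    anchorField ρ (algebroidBracket br (inducedConnection ρ cov) X Y) x =
      mlieBracket 𝓘(ℝ, E) (anchorField ρ X) (anchorField ρ Y) x := by
  have hc := isAConnection_inducedConnection ρ cov
  have hd : ∀ W : Cₛ^∞⟮𝓘(ℝ, E); F, A⟯, MDifferentiableAt 𝓘(ℝ, E) (𝓘(ℝ, E).prod 𝓘(ℝ, E)) (fun y =>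
      (⟨y, anchorField ρ W y⟩ : TotalSpace E (TangentSpace 𝓘(ℝ, E) : M → Type _))) x :=
    fun W => (contMDiff_anchorField ρ W x).mdifferentiableAt (by simp)
  -- `T` is the defect of the anchor as a bracket morphism. It is tensorial because both brackets
  -- obey the same Leibniz rule, so it suffices to evaluate it on sections that are constant in the
  -- frame near `x`.
  let T : Cₛ^∞⟮𝓘(ℝ, E); F, A⟯ → Cₛ^∞⟮𝓘(ℝ, E); F, A⟯ → TangentSpace 𝓘(ℝ, E) x := fun X Y =>
    anchorField ρ (algebroidBracket br (inducedConnection ρ cov) X Y) x -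
      mlieBracket 𝓘(ℝ, E) (anchorField ρ X) (anchorField ρ Y) x
  have hT_add : ∀ X Y Z, T X (Y + Z) = T X Y + T X Z := by
    intro X Y Z
    have e1 : anchorField ρ (Y + Z) = anchorField ρ Y + anchorField ρ Z := by
      ext y
      exact map_add (ρ.toFun y) _ _
    have e2 : br X (Y + Z) x = br X Y x + br X Z x := by
      rw [φ.br_apply _ _ hx, φ.br_apply _ _ hx, φ.br_apply _ _ hx, section_add_apply, map_add,
        lie_add, map_add]
    simp only [T, e1, mlieBracket_add_right (hd Y) (hd Z)]
    simp only [anchorField, algebroidBracket, section_add_apply, section_sub_apply, e2,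
      hc.add_right, hc.add_left, map_add, map_sub]
    abel
  have hT_smul : ∀ X (f : C^∞⟮𝓘(ℝ, E), M; ℝ⟯) Y, T X (f • Y) = f x • T X Y := by
    intro X f Y
    have e1 : anchorField ρ (f • Y) = (f : M → ℝ) • anchorField ρ Y := by
      ext y
      exact map_smul (ρ.toFun y) _ _
    have e2 : br X (f • Y) x = f x • br X Y x := by
      rw [φ.br_apply _ _ hx, φ.br_apply _ _ hx, section_smulFn_apply, map_smul, lie_smul, map_smul]
    simp only [T, e1, mlieBracket_smul_right (smoothMap_mdifferentiableAt f x) (hd Y)]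
    simp only [anchorField, algebroidBracket, section_add_apply, section_sub_apply, e2,
      hc.smooth_smul_left, hc.leibniz, section_smulFn_apply, map_add, map_sub, map_smul, smul_sub,
      smul_add]
    abel
  have hT_swap : ∀ X Y, T X Y = -T Y X := by
    intro X Y
    have e2 : br X Y x = - br Y X x := by
      rw [φ.br_apply _ _ hx, φ.br_apply _ _ hx, ← lie_skew, map_neg]
    simp only [T]
    rw [mlieBracket_swap_apply]
    simp only [anchorField, algebroidBracket, section_add_apply, section_sub_apply, e2, map_add,
      map_sub, map_neg]
    abel
  obtain ⟨S, hS⟩ := φ.isParallelFrame.exists_section (φ.inv x (X x)) hx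
  obtain ⟨S', hS'⟩ := φ.isParallelFrame.exists_section (φ.inv x (Y x)) hx
  have hX : S x = X x := by rw [hS.self_of_nhds, φ.hom_inv x hx]
  have hY : S' x = Y x := by rw [hS'.self_of_nhds, φ.hom_inv x hx]
  -- Linearity was shown in the second slot only; antisymmetry transfers it to the first.
  have h1 : T X Y = T S S' := by
    rw [apply_eq_of_apply_eq (hT_add X) (hT_smul X) hY.symm, hT_swap,
      apply_eq_of_apply_eq (hT_add S') (hT_smul S') hX.symm, ← hT_swap]
  refine sub_eq_zero.1 (h1.trans (sub_eq_zero.2 ?_))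
  have e1 : anchorField ρ S =ᶠ[𝓝 x] a.toFun (φ.inv x (X x)) := by
    filter_upwards [hS, U.isOpen.mem_nhds hx] with y hy hyU
    rw [anchorField, hy, φ.anchor_hom y hyU, LieAlgebraAction.anchor]
  have e2 : anchorField ρ S' =ᶠ[𝓝 x] a.toFun (φ.inv x (Y x)) := by
    filter_upwards [hS', U.isOpen.mem_nhds hx] with y hy hyU
    rw [anchorField, hy, φ.anchor_hom y hyU, LieAlgebraAction.anchor]
  rw [e1.mlieBracket_vectorField_eq e2, ← a.map_lie _ _ x hx, anchorField, algebroidBracket,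
    section_add_apply, section_sub_apply, inducedConnection_apply, inducedConnection_apply,
    φ.isParallelFrame.cov_eq_zero hx hS, φ.isParallelFrame.cov_eq_zero hx hS',
    φ.br_apply _ _ hx, hX, hY]
  simp only [sub_zero, zero_add]
  rw [φ.anchor_hom x hx, LieAlgebraAction.anchor]

include φ in
-- In the frame this is the product rule for the constant bilinear bracket of `𝔤`.
theorem derivation_apply [FiniteDimensional ℝ 𝔤] (X Y Z : Cₛ^∞⟮𝓘(ℝ, E); F, A⟯) {x : M}
    (hx : x ∈ U) :
    inducedConnection ρ cov X (br Y Z) x =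
      br (inducedConnection ρ cov X Y) Z x + br Y (inducedConnection ρ cov X Z) x := by
  have h := φ.isParallelFrame
  -- The norm of `𝔤` is unrelated to its bracket; continuity of the bracket comes from finite
  -- dimension.
  let B : 𝔤 →L[ℝ] 𝔤 →L[ℝ] 𝔤 := LinearMap.toContinuousLinearMap
    ((LinearMap.toContinuousLinearMap : (𝔤 →ₗ[ℝ] 𝔤) ≃ₗ[ℝ] (𝔤 →L[ℝ] 𝔤)).toLinearMap ∘ₗ
      (LieAlgebra.ad ℝ 𝔤 : 𝔤 →ₗ[ℝ] Module.End ℝ 𝔤))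
  have hB : ∀ u v, B u v = ⁅u, v⁆ := fun u v => rfl
  have e1 : (fun y => φ.inv y (br Y Z y)) =ᶠ[𝓝 x] fun y => B (φ.inv y (Y y)) (φ.inv y (Z y)) := by
    filter_upwards [U.isOpen.mem_nhds hx] with y hy
    rw [φ.inv_br Y Z hy, hB]
  have e2 := mvfderiv_bilinear B (h.mdifferentiableAt_inv_apply Y hx)
    (h.mdifferentiableAt_inv_apply Z hx) (anchorField ρ X x)
  rw [← mvfderiv_congr_of_eventuallyEq e1, ← h.inv_cov _ x hx, ← h.inv_cov _ x hx,
    ← h.inv_cov _ x hx, hB, hB] at e2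
  rw [← φ.hom_inv x hx (inducedConnection ρ cov X (br Y Z) x), φ.br_apply _ _ hx,
    φ.br_apply _ _ hx, ← map_add]
  exact congrArg _ e2

include φ in
-- The commutator formula, applied to the `𝔤`-valued coordinates of `Z`, is flatness along `⟦X, Y⟧`.
-- Subtracting the `∇`-terms of `⟦X, Y⟧` turns it into the triple bracket.
theorem bracket_tri_apply (X Y Z : Cₛ^∞⟮𝓘(ℝ, E); F, A⟯) {x : M} (hx : x ∈ U) :
    inducedConnection ρ cov (br X Y) Z x = tripleBracket (inducedConnection ρ cov) X Y Z x := by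
  have h := φ.isParallelFrame
  have hd : ∀ W : Cₛ^∞⟮𝓘(ℝ, E); F, A⟯, MDifferentiableAt 𝓘(ℝ, E) (𝓘(ℝ, E).prod 𝓘(ℝ, E)) (fun y =>
      (⟨y, anchorField ρ W y⟩ : TotalSpace E (TangentSpace 𝓘(ℝ, E) : M → Type _))) x :=
    fun W => (contMDiff_anchorField ρ W x).mdifferentiableAt (by simp)
  have hs : ContMDiffAt 𝓘(ℝ, E) 𝓘(ℝ, 𝔤) 2 (fun y => φ.inv y (Z y)) x :=
    ((h.contMDiffOn_inv_apply Z).contMDiffAt (U.isOpen.mem_nhds hx)).of_le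
      (by exact_mod_cast ENat.LEInfty.out)
  have e1 := mvfderiv_mlieBracket hs (hd X) (hd Y)
  have e2 : ∀ X Y : Cₛ^∞⟮𝓘(ℝ, E); F, A⟯,
      mvfderiv 𝓘(ℝ, E) (fun y => mvfderiv 𝓘(ℝ, E) (fun y => φ.inv y (Z y)) y
      (anchorField ρ Y y)) x (anchorField ρ X x) =
        φ.inv x (inducedConnection ρ cov X (inducedConnection ρ cov Y Z) x) := by
    intro X Y
    rw [inducedConnection_apply, h.inv_cov _ x hx]
    refine DFunLike.congr_fun (mvfderiv_congr_of_eventuallyEq ?_) _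
    filter_upwards [U.isOpen.mem_nhds hx] with y hy
    rw [inducedConnection_apply, h.inv_cov Z y hy]
  rw [e2, e2, ← φ.anchorField_algebroidBracket X Y hx, ← h.inv_cov Z x hx, ← map_sub] at e1
  have e3 := congrArg (φ.hom x) e1
  rw [φ.hom_inv x hx, φ.hom_inv x hx, algebroidBracket, anchorField, section_add_apply,
    section_sub_apply] at e3
  simp only [map_add, map_sub] at e3
  simp only [tripleBracket, assoc, section_sub_apply]
  simp only [inducedConnection_apply, anchorField] at e3 ⊢
  rw [eq_sub_iff_add_eq'.symm.1 e3]
  abel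

end ActionAlgebroidIso

variable [FiniteDimensional ℝ E] [T2Space M] [FiniteDimensional ℝ F]
  [ContMDiffVectorBundle ∞ F A 𝓘(ℝ, E)]

/-- A locally transitive action algebroid is a post-Lie algebroid. -/
theorem IsLocallyTransitiveActionAlgebroid.isPostLieAlgebroid
    (H : IsLocallyTransitiveActionAlgebroid ρ
      (algebroidBracket br (inducedConnection ρ cov)) cov) :
    IsPostLieAlgebroid ρ br (inducedConnection ρ cov) := by
  have hc := isAConnection_inducedConnection ρ cov
  refine ⟨hc, fun f X Y => ?_, fun f X Y => ?_, ⟨⟨fun X Y Z => ?_, fun X Y Z => ?_,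
    fun r X Y => ?_, fun r X Y => ?_, fun X => ?_, fun X Y Z => ?_⟩, hc.add_left, hc.add_right,
    -- All axioms are equalities of sections, so each can be tested at a point, in an isomorphism
    -- around that point.
    hc.smul_left, hc.smul_right, fun X Y Z => ?_, fun X Y Z => ?_⟩⟩ <;> ext x <;>
    obtain ⟨U, hx, 𝔤, _, _, _, a, -, ⟨φ⟩⟩ := H x
  · rw [section_smulFn_apply, φ.br_apply _ _ hx, φ.br_apply _ _ hx, section_smulFn_apply,
      map_smul, smul_lie, map_smul]
  · rw [section_smulFn_apply, φ.br_apply _ _ hx, φ.br_apply _ _ hx, section_smulFn_apply,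
      map_smul, lie_smul, map_smul]
  · rw [section_add_apply, φ.br_apply _ _ hx, φ.br_apply _ _ hx, φ.br_apply _ _ hx,
      section_add_apply, map_add, add_lie, map_add]
  · rw [section_add_apply, φ.br_apply _ _ hx, φ.br_apply _ _ hx, φ.br_apply _ _ hx,
      section_add_apply, map_add, lie_add, map_add]
  · rw [section_smul_apply, φ.br_apply _ _ hx, φ.br_apply _ _ hx, section_smul_apply,
      map_smul, smul_lie, map_smul]
  · rw [section_smul_apply, φ.br_apply _ _ hx, φ.br_apply _ _ hx, section_smul_apply,
      map_smul, lie_smul, map_smul]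
  · rw [φ.br_apply _ _ hx, lie_self, map_zero]
    rfl
  · rw [section_add_apply, section_add_apply, φ.br_apply X (br Y Z) hx,
      φ.br_apply Y (br Z X) hx, φ.br_apply Z (br X Y) hx, φ.inv_br _ _ hx, φ.inv_br _ _ hx,
      φ.inv_br _ _ hx, ← map_add, ← map_add,
      lie_jacobi, map_zero]
    rfl
  · rw [section_add_apply, φ.derivation_apply X Y Z hx]
  · exact φ.bracket_tri_apply X Y Z hx

end Converse

/-! ### The connection form in a chart and a trivialization. -/

section ConnectionForm

open Set Filter Topology VectorField

variable {E : Type*} [NormedAddCommGroup E] [NormedSpace ℝ E]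
  {M : Type*} [TopologicalSpace M] [ChartedSpace E M] [IsManifold 𝓘(ℝ, E) ∞ M]
  {F : Type*} [NormedAddCommGroup F] [NormedSpace ℝ F]
  {A : M → Type*} [TopologicalSpace (TotalSpace F A)]
  [∀ x, AddCommGroup (A x)] [∀ x, Module ℝ (A x)] [∀ x, TopologicalSpace (A x)]
  [FiberBundle F A] [VectorBundle ℝ F A]

variable (F A) in
/-- The fiber coordinate at `y` in the trivialization around `x₀`. -/
def fiberCoord (x₀ y : M) : A y →L[ℝ] F :=
  (trivializationAt F A x₀).continuousLinearMapAt ℝ y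

theorem fiberCoord_symmL {x₀ y : M} (hy : y ∈ (trivializationAt F A x₀).baseSet) (v : F) :
    fiberCoord F A x₀ y ((trivializationAt F A x₀).symmL ℝ y v) = v :=
  (trivializationAt F A x₀).continuousLinearMapAt_symmL hy v

theorem symmL_fiberCoord {x₀ y : M} (hy : y ∈ (trivializationAt F A x₀).baseSet) (a : A y) :
    (trivializationAt F A x₀).symmL ℝ y (fiberCoord F A x₀ y a) = a :=
  (trivializationAt F A x₀).symmL_continuousLinearMapAt hy a

theorem fiberCoord_apply {x₀ y : M} (hy : y ∈ (trivializationAt F A x₀).baseSet) (a : A y) :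
    fiberCoord F A x₀ y a = (trivializationAt F A x₀ ⟨y, a⟩).2 := by
  rw [fiberCoord, Trivialization.continuousLinearMapAt_apply,
    (trivializationAt F A x₀).coe_linearMapAt_of_mem hy]

/-- `W` is contained in the domains of the chart and of the trivialization around `x₀`, and the
sections `σ i` have constant coordinates `b i` on `W`. -/
structure IsLocalCoords {ι : Type*} (x₀ : M) (b : Module.Basis ι ℝ F) (σ : ι → Cₛ^∞⟮𝓘(ℝ, E); F, A⟯)
    (W : TopologicalSpace.Opens M) : Prop where
  mem_source : ∀ y ∈ W, y ∈ (extChartAt 𝓘(ℝ, E) x₀).source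
  mem_baseSet : ∀ y ∈ W, y ∈ (trivializationAt F A x₀).baseSet
  section_eq : ∀ y ∈ W, ∀ i, σ i y = (trivializationAt F A x₀).symmL ℝ y (b i)

theorem exists_isLocalCoords [FiniteDimensional ℝ E] [FiniteDimensional ℝ F] [T2Space M]
    [ContMDiffVectorBundle ∞ F A 𝓘(ℝ, E)] {ι : Type*} [Finite ι] (b : Module.Basis ι ℝ F) (x₀ : M) :
    ∃ (σ : ι → Cₛ^∞⟮𝓘(ℝ, E); F, A⟯) (W : TopologicalSpace.Opens M), x₀ ∈ W ∧
      IsLocalCoords x₀ b σ W := by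
  have hx : x₀ ∈ (trivializationAt F A x₀).baseSet := FiberBundle.mem_baseSet_trivializationAt' x₀
  have hσ : ∀ i, ∃ X : Cₛ^∞⟮𝓘(ℝ, E); F, A⟯, ∀ᶠ y in 𝓝 x₀,
      X y = (trivializationAt F A x₀).symmL ℝ y (b i) :=
    fun i => exists_section_eventuallyEq ((trivializationAt F A x₀).open_baseSet.mem_nhds hx)
      (contMDiffOn_symmL _ (b i))
  choose σ hσ using hσ
  have h := ((eventually_all.2 hσ).and
    ((trivializationAt F A x₀).open_baseSet.eventually_mem hx)).and
    (extChartAt_source_mem_nhds (I := 𝓘(ℝ, E)) x₀)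
  obtain ⟨W, hW, hWo, hxW⟩ := eventually_nhds_iff.1 h
  exact ⟨σ, ⟨W, hWo⟩, hxW, fun y hy => (hW y hy).2, fun y hy => (hW y hy).1.2,
    fun y hy => (hW y hy).1.1⟩

variable [∀ x, IsTopologicalAddGroup (A x)] [∀ x, ContinuousSMul ℝ (A x)]
  [FiniteDimensional ℝ F] {ι : Type*} [Fintype ι]

/-- The connection form of `cov` with respect to the sections `σ`. -/
def connForm (cov : CovariantDerivative 𝓘(ℝ, E) F A) (x₀ : M) (b : Module.Basis ι ℝ F)
    (σ : ι → Cₛ^∞⟮𝓘(ℝ, E); F, A⟯) (y : M) : TangentSpace 𝓘(ℝ, E) y →L[ℝ] F →L[ℝ] F :=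
  ∑ i, ((ContinuousLinearMap.smulRightL ℝ F F (LinearMap.toContinuousLinearMap (b.coord i))).comp
    (fiberCoord F A x₀ y)).comp (cov (σ i) y)

/-- The connection form of `cov` in the chart around `x₀`. -/
def chartConnForm (cov : CovariantDerivative 𝓘(ℝ, E) F A) (x₀ : M) (b : Module.Basis ι ℝ F)
    (σ : ι → Cₛ^∞⟮𝓘(ℝ, E); F, A⟯) (z : E) : E →L[ℝ] F →L[ℝ] F :=
  (connForm cov x₀ b σ ((extChartAt 𝓘(ℝ, E) x₀).symm z)).comp (dChartSymm x₀ z)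

variable {cov : CovariantDerivative 𝓘(ℝ, E) F A}
  {x₀ : M} {b : Module.Basis ι ℝ F} {σ : ι → Cₛ^∞⟮𝓘(ℝ, E); F, A⟯}
  {W : TopologicalSpace.Opens M}

theorem connForm_apply (y : M) (w : TangentSpace 𝓘(ℝ, E) y) (v : F) :
    connForm cov x₀ b σ y w v = ∑ i, b.repr v i • fiberCoord F A x₀ y (cov (σ i) y w) := by
  simp [connForm]

theorem chartConnForm_dChart {y : M} (hy : y ∈ (extChartAt 𝓘(ℝ, E) x₀).source)
    (w : TangentSpace 𝓘(ℝ, E) y) :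
    chartConnForm cov x₀ b σ (extChartAt 𝓘(ℝ, E) x₀ y) (dChart x₀ y w) =
      connForm cov x₀ b σ y w := by
  obtain ⟨z, hz, rfl⟩ : ∃ z ∈ (extChartAt 𝓘(ℝ, E) x₀).target,
      (extChartAt 𝓘(ℝ, E) x₀).symm z = y :=
    ⟨_, (extChartAt 𝓘(ℝ, E) x₀).map_source hy, (extChartAt 𝓘(ℝ, E) x₀).left_inv hy⟩
  rw [(extChartAt 𝓘(ℝ, E) x₀).right_inv hz, chartConnForm, ContinuousLinearMap.comp_apply]
  congr 1
  exact dChart_injective hy (dChart_dChartSymm hz _)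

variable [FiniteDimensional ℝ E] [T2Space M] [ContMDiffVectorBundle ∞ F A 𝓘(ℝ, E)]

theorem contMDiffOn_fiberCoord (X : Cₛ^∞⟮𝓘(ℝ, E); F, A⟯) :
    ContMDiffOn 𝓘(ℝ, E) 𝓘(ℝ, F) ∞ (fun y => fiberCoord F A x₀ y (X y))
      (trivializationAt F A x₀).baseSet :=
  (contMDiffOn_coord (trivializationAt F A x₀) X).congr fun _ hy => fiberCoord_apply hy _

theorem mdifferentiableAt_fiberCoord (X : Cₛ^∞⟮𝓘(ℝ, E); F, A⟯) {y : M}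
    (hy : y ∈ (trivializationAt F A x₀).baseSet) :
    MDifferentiableAt 𝓘(ℝ, E) 𝓘(ℝ, F) (fun y => fiberCoord F A x₀ y (X y)) y :=
  ((contMDiffOn_fiberCoord X).contMDiffAt
    ((trivializationAt F A x₀).open_baseSet.mem_nhds hy)).mdifferentiableAt (by simp)

/-- The connection in coordinates. -/
theorem IsLocalCoords.fiberCoord_cov (h : IsLocalCoords x₀ b σ W) (Y : Cₛ^∞⟮𝓘(ℝ, E); F, A⟯) {y : M}
    (hy : y ∈ W)
    (w : TangentSpace 𝓘(ℝ, E) y) :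
    fiberCoord F A x₀ y (cov Y y w) =
      mvfderiv 𝓘(ℝ, E) (fun y => fiberCoord F A x₀ y (Y y)) y w +
        connForm cov x₀ b σ y w (fiberCoord F A x₀ y (Y y)) := by
  have hb := h.mem_baseSet y hy
  have hf : ∀ i, ∃ f : C^∞⟮𝓘(ℝ, E), M; ℝ⟯, ∀ᶠ y in 𝓝 y,
      f y = LinearMap.toContinuousLinearMap (b.coord i) (fiberCoord F A x₀ y (Y y)) := by
    intro i
    have h1 := (LinearMap.toContinuousLinearMap (b.coord i)).contMDiff.comp_contMDiffOn
      (contMDiffOn_fiberCoord (x₀ := x₀) Y)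
    exact exists_contMDiffMap_eventuallyEq
      ((trivializationAt F A x₀).open_baseSet.mem_nhds hb) h1
  choose f hf using hf
  -- Near `y` the section is a combination of the `σ i` with global smooth coefficients, so the
  -- Leibniz rule computes `∇Y`: derivatives of coefficients give the first term, derivatives of the
  -- `σ i` the connection form.
  have hY : ∀ᶠ y in 𝓝 y, Y y = (∑ i, f i • σ i : Cₛ^∞⟮𝓘(ℝ, E); F, A⟯) y := by
    filter_upwards [eventually_all.2 hf, W.isOpen.mem_nhds hy] with y' hfy hy'
    simp only [section_sum_apply, section_smulFn_apply, hfy, h.section_eq y' hy']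
    simp only [← map_smul, ← map_sum]
    have := b.sum_repr (fiberCoord F A x₀ y' (Y y'))
    simp only [LinearMap.coe_toContinuousLinearMap', Module.Basis.coord_apply]
    rw [this, symmL_fiberCoord (h.mem_baseSet y' hy')]
  have hdf : ∀ i, mvfderiv 𝓘(ℝ, E) (f i) y w =
      b.repr (mvfderiv 𝓘(ℝ, E) (fun y => fiberCoord F A x₀ y (Y y)) y w) i := by
    intro i
    rw [mvfderiv_congr_of_eventuallyEq (hf i),
      mvfderiv_clm_comp _ (mdifferentiableAt_fiberCoord Y hb)]
    simp
  rw [cov_eq_of_eventuallyEq cov hY, cov_sum_smulFn_apply, map_sum, connForm_apply,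
    ← b.sum_repr (mvfderiv 𝓘(ℝ, E) (fun y => fiberCoord F A x₀ y (Y y)) y w),
    ← Finset.sum_add_distrib]
  refine Finset.sum_congr rfl fun i _ => ?_
  rw [map_add, map_smul, map_smul, hdf, (hf i).self_of_nhds, h.section_eq y hy,
    fiberCoord_symmL hb]
  simp

variable [hcov : CovariantDerivative.ContMDiffCovariantDerivative cov ∞]

/-- The tangent bundle trivialization at `x₀` is the derivative of the chart. Coordinate vector
fields are therefore smooth local sections, which is what smoothness of the connection form
requires. -/
theorem dChartSymm_eq_symmL {z h : E} (hz : z ∈ (extChartAt 𝓘(ℝ, E) x₀).target) :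
    dChartSymm x₀ z h = (trivializationAt E (TangentSpace 𝓘(ℝ, E) : M → Type _) x₀).symmL ℝ
      ((extChartAt 𝓘(ℝ, E) x₀).symm z) h := by
  have hy := (extChartAt 𝓘(ℝ, E) x₀).map_target hz
  have hy' : (extChartAt 𝓘(ℝ, E) x₀).symm z ∈ (chartAt E x₀).source := by
    rwa [extChartAt_source] at hy
  refine dChart_injective hy ?_
  rw [dChart_dChartSymm hz, dChart, ← TangentBundle.continuousLinearMapAt_trivializationAt hy']
  exact (Trivialization.continuousLinearMapAt_symmL _ (by simpa using hy') h).symm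

/-- As `E` is finite-dimensional, smoothness may be tested on a fixed vector `k`; there the form
consists of coordinates of `∇ (σ i)` along the coordinate field of `k`. -/
theorem contDiffOn_chartConnForm (h : IsLocalCoords x₀ b σ W) :
    ContDiffOn ℝ ∞ (chartConnForm cov x₀ b σ)
      ((extChartAt 𝓘(ℝ, E) x₀).target ∩ (extChartAt 𝓘(ℝ, E) x₀).symm ⁻¹' W) := by
  refine contDiffOn_clm_apply.2 fun k => ?_
  let eT := trivializationAt E (TangentSpace 𝓘(ℝ, E) : M → Type _) x₀
  have hH : ContMDiffOn 𝓘(ℝ, E) (𝓘(ℝ, E).prod 𝓘(ℝ, E)) ∞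
      (fun y => (⟨y, eT.symmL ℝ y k⟩ : TotalSpace E (TangentSpace 𝓘(ℝ, E) : M → Type _))) W :=
    (contMDiffOn_symmL eT k).mono fun y hy => by
      have := h.mem_source y hy
      rw [extChartAt_source] at this
      simpa [eT] using this
  have h1 : ∀ i, ContMDiffOn 𝓘(ℝ, E) 𝓘(ℝ, F) ∞
      (fun y => fiberCoord F A x₀ y (cov (σ i) y (eT.symmL ℝ y k))) W := by
    intro i
    have h2 := hcov.contMDiff.contMDiff (σ := fun x => σ i x) (σ i).contMDiff.contMDiffOn
    have h3 : ContMDiffOn 𝓘(ℝ, E) (𝓘(ℝ, E).prod 𝓘(ℝ, F)) ∞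
        (fun y => (⟨y, cov (σ i) y (eT.symmL ℝ y k)⟩ : TotalSpace F A)) W := fun y hy =>
      (((contMDiffOn_univ.1 h2) y).contMDiffWithinAt).clm_bundle_apply (hH y hy)
    have hWb : (W : Set M) ⊆ (trivializationAt F A x₀).baseSet := h.mem_baseSet
    have h4 := ((trivializationAt F A x₀).contMDiffOn_section_iff (IB := 𝓘(ℝ, E)) (n := ∞)
      W.isOpen hWb).1 h3
    exact h4.congr fun y hy => fiberCoord_apply (hWb hy) _
  have h5 : ContMDiffOn 𝓘(ℝ, E) 𝓘(ℝ, F →L[ℝ] F) ∞ (fun y => ∑ i,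
      ContinuousLinearMap.smulRightL ℝ F F (LinearMap.toContinuousLinearMap (b.coord i))
        (fiberCoord F A x₀ y (cov (σ i) y (eT.symmL ℝ y k)))) W :=
    contMDiffOn_finsetSum fun i _ => (ContinuousLinearMap.smulRightL ℝ F F
      (LinearMap.toContinuousLinearMap (b.coord i))).contMDiff.comp_contMDiffOn (h1 i)
  have h6 := h5.comp ((contMDiffOn_extChartAt_symm (I := 𝓘(ℝ, E)) (n := ∞) x₀).mono
    inter_subset_left) (fun z (hz : z ∈ (extChartAt 𝓘(ℝ, E) x₀).target ∩
      (extChartAt 𝓘(ℝ, E) x₀).symm ⁻¹' W) => hz.2)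
  refine (contMDiffOn_iff_contDiffOn.1 h6).congr fun z hz => ?_
  rw [chartConnForm, ContinuousLinearMap.comp_apply, dChartSymm_eq_symmL hz.1, connForm,
    sum_apply]
  rfl

end ConnectionForm

/-! ### Zero curvature in coordinates. -/

section LocalFrame

open Set Filter Topology VectorField

variable {E : Type*} [NormedAddCommGroup E] [NormedSpace ℝ E]
  {M : Type*} [TopologicalSpace M] [ChartedSpace E M] [IsManifold 𝓘(ℝ, E) ∞ M]
  {F : Type*} [NormedAddCommGroup F] [NormedSpace ℝ F]
  {A : M → Type*} [TopologicalSpace (TotalSpace F A)]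
  [∀ x, AddCommGroup (A x)] [∀ x, Module ℝ (A x)] [∀ x, TopologicalSpace (A x)]
  [FiberBundle F A] [VectorBundle ℝ F A]
  [∀ x, IsTopologicalAddGroup (A x)] [∀ x, ContinuousSMul ℝ (A x)]
  [FiniteDimensional ℝ F] {ι : Type*} [Fintype ι]
  [FiniteDimensional ℝ E] [T2Space M] [ContMDiffVectorBundle ∞ F A 𝓘(ℝ, E)]
  {ρ : Anchor 𝓘(ℝ, E) F A}
  {br : Cₛ^∞⟮𝓘(ℝ, E); F, A⟯ → Cₛ^∞⟮𝓘(ℝ, E); F, A⟯ → Cₛ^∞⟮𝓘(ℝ, E); F, A⟯}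
  {cov : CovariantDerivative 𝓘(ℝ, E) F A}
  [hcov : CovariantDerivative.ContMDiffCovariantDerivative cov ∞]
  {x₀ : M} {b : Module.Basis ι ℝ F} {σ : ι → Cₛ^∞⟮𝓘(ℝ, E); F, A⟯}
  {W : TopologicalSpace.Opens M}

theorem isOpen_chart_target_inter (x₀ : M) (W : TopologicalSpace.Opens M) :
    IsOpen ((extChartAt 𝓘(ℝ, E) x₀).target ∩ (extChartAt 𝓘(ℝ, E) x₀).symm ⁻¹' W) :=
  (continuousOn_extChartAt_symm x₀).isOpen_inter_preimage (isOpen_extChartAt_target x₀) W.isOpen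

theorem mdifferentiableAt_dChart {V : ∀ x : M, TangentSpace 𝓘(ℝ, E) x}
    (hV : ContMDiff 𝓘(ℝ, E) (𝓘(ℝ, E).prod 𝓘(ℝ, E)) ∞
      (fun y => (⟨y, V y⟩ : TotalSpace E (TangentSpace 𝓘(ℝ, E) : M → Type _)))) {y : M}
    (hy : y ∈ (extChartAt 𝓘(ℝ, E) x₀).source) :
    MDifferentiableAt 𝓘(ℝ, E) 𝓘(ℝ, E) (fun y => dChart x₀ y (V y)) y := by
  let e := trivializationAt E (TangentSpace 𝓘(ℝ, E) : M → Type _) x₀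
  have hsrc : ∀ y, y ∈ e.baseSet ↔ y ∈ (chartAt E x₀).source := by simp [e]
  rw [extChartAt_source, ← hsrc] at hy
  have h1 := (e.contMDiffOn_section_baseSet_iff (IB := 𝓘(ℝ, E)) (n := ∞)).1 hV.contMDiffOn
  have h2 : ContMDiffOn 𝓘(ℝ, E) 𝓘(ℝ, E) ∞ (fun y => dChart x₀ y (V y)) e.baseSet :=
    h1.congr fun y hy => by
      rw [dChart, ← TangentBundle.continuousLinearMapAt_trivializationAt ((hsrc y).1 hy)]
      exact fiberCoord_apply hy _
  exact (h2.contMDiffAt (e.open_baseSet.mem_nhds hy)).mdifferentiableAt (by simp)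

/-- The second derivative of a section with constant coordinates. -/
theorem IsLocalCoords.fiberCoord_cov_cov (h : IsLocalCoords x₀ b σ W) {y : M} (hy : y ∈ W)
    (Y S : Cₛ^∞⟮𝓘(ℝ, E); F, A⟯) {v : F} (hS : ∀ᶠ y' in 𝓝 y, fiberCoord F A x₀ y' (S y') = v)
    (w : TangentSpace 𝓘(ℝ, E) y) :
    fiberCoord F A x₀ y (cov (inducedConnection ρ cov Y S) y w) =
      fderiv ℝ (chartConnForm cov x₀ b σ) (extChartAt 𝓘(ℝ, E) x₀ y) (dChart x₀ y w)
          (dChart x₀ y (anchorField ρ Y y)) v +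
        chartConnForm cov x₀ b σ (extChartAt 𝓘(ℝ, E) x₀ y)
          (mvfderiv 𝓘(ℝ, E) (fun y' => mvfderiv 𝓘(ℝ, E) (extChartAt 𝓘(ℝ, E) x₀) y'
            (anchorField ρ Y y')) y w) v +
        connForm cov x₀ b σ y w (connForm cov x₀ b σ y (anchorField ρ Y y) v) := by
  set φ := extChartAt 𝓘(ℝ, E) x₀ with hφ
  have hys : y ∈ φ.source := h.mem_source y hy
  have hcoord : ∀ᶠ y' in 𝓝 y, ∀ w' : TangentSpace 𝓘(ℝ, E) y',
      fiberCoord F A x₀ y' (cov S y' w') = connForm cov x₀ b σ y' w' v := by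
    filter_upwards [W.isOpen.mem_nhds hy, hS.eventually_nhds] with y' hy' hS' w'
    rw [h.fiberCoord_cov S hy', mvfderiv_congr_of_eventuallyEq hS', mvfderiv_const,
      hS'.self_of_nhds]
    simp
  -- `B θ u` is `θ u v`, so the coordinates of `Y ▷ S` are a bilinear expression in the connection
  -- form and the chart image of `ρ(Y)`, ready for the product rule.
  let B := ContinuousLinearMap.compL ℝ E (F →L[ℝ] F) F (ContinuousLinearMap.apply ℝ F v)
  have e1 : (fun y' => fiberCoord F A x₀ y' (inducedConnection ρ cov Y S y')) =ᶠ[𝓝 y]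
      fun y' => B ((chartConnForm cov x₀ b σ ∘ φ) y')
        (mvfderiv 𝓘(ℝ, E) φ y' (anchorField ρ Y y')) := by
    filter_upwards [W.isOpen.mem_nhds hy, hcoord] with y' hy' hS'
    rw [inducedConnection_apply, hS', ← chartConnForm_dChart (h.mem_source y' hy')]
    rfl
  have hzs : φ y ∈ φ.target ∩ φ.symm ⁻¹' W :=
    ⟨φ.map_source hys, by rw [mem_preimage, φ.left_inv hys]; exact hy⟩
  have hdc : DifferentiableAt ℝ (chartConnForm cov x₀ b σ) (φ y) :=
    ((contDiffOn_chartConnForm (cov := cov) h).contDiffAt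
      ((isOpen_chart_target_inter x₀ W).mem_nhds hzs)).differentiableAt (by simp)
  have hφs : ContMDiffAt 𝓘(ℝ, E) 𝓘(ℝ, E) ∞ φ y := contMDiffAt_extChartAt' (by
    rwa [← extChartAt_source 𝓘(ℝ, E)])
  have hdf : MDifferentiableAt 𝓘(ℝ, E) 𝓘(ℝ, E →L[ℝ] F →L[ℝ] F)
      (chartConnForm cov x₀ b σ ∘ φ) y :=
    (mdifferentiableAt_iff_differentiableAt.2 hdc).comp y (hφs.mdifferentiableAt (by simp))
  have hdg : MDifferentiableAt 𝓘(ℝ, E) 𝓘(ℝ, E)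
      (fun y' => mvfderiv 𝓘(ℝ, E) φ y' (anchorField ρ Y y')) y :=
    mdifferentiableAt_dChart (contMDiff_anchorField ρ Y) hys
  rw [h.fiberCoord_cov _ hy, mvfderiv_congr_of_eventuallyEq e1, mvfderiv_bilinear B hdf hdg,
    mvfderiv_comp_chart hys hdc, inducedConnection_apply, hcoord.self_of_nhds]
  rfl

/-- The connection form of a post-Lie algebroid is flat. -/
theorem IsLocalCoords.flat (h : IsLocalCoords x₀ b σ W) (hρ : ρ.IsTransitive)
    (hP : IsPostLieAlgebroid ρ br (inducedConnection ρ cov)) {z : E}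
    (hz : z ∈ (extChartAt 𝓘(ℝ, E) x₀).target ∩ (extChartAt 𝓘(ℝ, E) x₀).symm ⁻¹' W) (k l : E) :
    fderiv ℝ (chartConnForm cov x₀ b σ) z k l +
        (chartConnForm cov x₀ b σ z k).comp (chartConnForm cov x₀ b σ z l) =
      fderiv ℝ (chartConnForm cov x₀ b σ) z l k +
        (chartConnForm cov x₀ b σ z l).comp (chartConnForm cov x₀ b σ z k) := by
  set φ := extChartAt 𝓘(ℝ, E) x₀ with hφ
  obtain ⟨y, hy, rfl⟩ : ∃ y ∈ φ.source, φ y = z :=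
    ⟨_, φ.map_target hz.1, φ.right_inv hz.1⟩
  have hyW : y ∈ W := by
    have := hz.2
    rwa [mem_preimage, φ.left_inv hy] at this
  -- Transitivity enters here: every coordinate vector at `y` is the value of some `ρ(X)`, so
  -- flatness along sections tests all directions.
  have hex : ∀ k : E, ∃ X : Cₛ^∞⟮𝓘(ℝ, E); F, A⟯, dChart x₀ y (anchorField ρ X y) = k := by
    intro k
    obtain ⟨w, hw⟩ : ∃ w : TangentSpace 𝓘(ℝ, E) y, dChart x₀ y w = k := by
      have := dChart_dChartSymm hz.1 k
      rw [φ.left_inv hy] at this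
      exact ⟨_, this⟩
    obtain ⟨a, rfl⟩ := hρ y w
    obtain ⟨X, rfl⟩ := exists_section_apply_eq (E := E) (F := F) a
    exact ⟨X, hw⟩
  obtain ⟨X, hX⟩ := hex k
  obtain ⟨Y, hY⟩ := hex l
  ext v
  obtain ⟨S, hS⟩ := exists_section_symmL (E := E) (trivializationAt F A x₀) v
    (h.mem_baseSet y hyW)
  have hS' : ∀ᶠ y' in 𝓝 y, fiberCoord F A x₀ y' (S y') = v := by
    filter_upwards [W.isOpen.mem_nhds hyW, hS] with y' hy' hSy
    rw [hSy, fiberCoord_symmL (h.mem_baseSet y' hy')]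
  have hd : ∀ W : Cₛ^∞⟮𝓘(ℝ, E); F, A⟯, MDifferentiableAt 𝓘(ℝ, E) (𝓘(ℝ, E).prod 𝓘(ℝ, E)) (fun y =>
      (⟨y, anchorField ρ W y⟩ : TotalSpace E (TangentSpace 𝓘(ℝ, E) : M → Type _))) y :=
    fun W => (contMDiff_anchorField ρ W y).mdifferentiableAt (by simp)
  have hφs : ContMDiffAt 𝓘(ℝ, E) 𝓘(ℝ, E) 2 φ y := contMDiffAt_extChartAt' (by
    rwa [← extChartAt_source 𝓘(ℝ, E)])
  have e1 := congrArg (fiberCoord F A x₀ y)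
    (DFunLike.congr_fun (flat_algebroidBracket hP X Y S) y)
  rw [inducedConnection_apply, anchorField_algebroidBracket hρ hP, h.fiberCoord_cov S hyW,
    mvfderiv_congr_of_eventuallyEq hS', mvfderiv_const, hS'.self_of_nhds, section_sub_apply,
    map_sub, inducedConnection_apply ρ cov X, inducedConnection_apply ρ cov Y,
    h.fiberCoord_cov_cov hyW Y S hS',
    h.fiberCoord_cov_cov hyW X S hS', ← chartConnForm_dChart hy, ← chartConnForm_dChart hy,
    ← chartConnForm_dChart hy, hX, hY] at e1
  -- The commutator formula for the chart itself, as an `E`-valued function. It cancels the terms in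
  -- which the fields `ρ(X)` and `ρ(Y)` are differentiated.
  have e2 : dChart x₀ y (mlieBracket 𝓘(ℝ, E) (anchorField ρ X) (anchorField ρ Y) y) = _ :=
    mvfderiv_mlieBracket hφs (hd X) (hd Y)
  rw [e2, map_sub] at e1
  simp only [add_apply, ContinuousLinearMap.comp_apply]
  simp only [sub_apply, zero_apply, zero_add] at e1
  rw [← sub_eq_zero] at e1 ⊢
  rw [← neg_eq_zero, ← e1]
  abel

end LocalFrame

/-! ### Existence of local parallel frames. -/

section LocalParallelFrame

open Set Filter Topology VectorField

variable {E : Type*} [NormedAddCommGroup E] [NormedSpace ℝ E]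
  {M : Type*} [TopologicalSpace M] [ChartedSpace E M] [IsManifold 𝓘(ℝ, E) ∞ M]
  {F : Type*} [NormedAddCommGroup F] [NormedSpace ℝ F]
  {A : M → Type*} [TopologicalSpace (TotalSpace F A)]
  [∀ x, AddCommGroup (A x)] [∀ x, Module ℝ (A x)] [∀ x, TopologicalSpace (A x)]
  [FiberBundle F A] [VectorBundle ℝ F A]
  [∀ x, IsTopologicalAddGroup (A x)] [∀ x, ContinuousSMul ℝ (A x)]
  [FiniteDimensional ℝ F] {ι : Type*} [Fintype ι]
  [FiniteDimensional ℝ E] [T2Space M] [ContMDiffVectorBundle ∞ F A 𝓘(ℝ, E)]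
  {ρ : Anchor 𝓘(ℝ, E) F A}
  {br : Cₛ^∞⟮𝓘(ℝ, E); F, A⟯ → Cₛ^∞⟮𝓘(ℝ, E); F, A⟯ → Cₛ^∞⟮𝓘(ℝ, E); F, A⟯}
  {cov : CovariantDerivative 𝓘(ℝ, E) F A}
  [hcov : CovariantDerivative.ContMDiffCovariantDerivative cov ∞]
  {x₀ : M} {b : Module.Basis ι ℝ F} {σ : ι → Cₛ^∞⟮𝓘(ℝ, E); F, A⟯}
  {W : TopologicalSpace.Opens M}

omit hcov in
/-- A solution of the equation of parallel frames is a parallel frame. -/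
theorem IsLocalCoords.isParallelFrame (h : IsLocalCoords x₀ b σ W)
    {U : TopologicalSpace.Opens M} (hUW : U ≤ W) {s : Set E} (hs : IsOpen s)
    (hUs : ∀ y ∈ U, extChartAt 𝓘(ℝ, E) x₀ y ∈ s) {Ψ : E → F →L[ℝ] F}
    (hΨ : ContDiffOn ℝ ∞ Ψ s) (hunit : ∀ z ∈ s, IsUnit (Ψ z))
    (hd : ∀ z ∈ s, ∀ k v, fderiv ℝ Ψ z k v = Ψ z (chartConnForm cov x₀ b σ z k v)) :
    IsParallelFrame cov U
      (fun y => ((trivializationAt F A x₀).symmL ℝ y).comp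
        (Ring.inverse (Ψ (extChartAt 𝓘(ℝ, E) x₀ y))))
      (fun y => (Ψ (extChartAt 𝓘(ℝ, E) x₀ y)).comp (fiberCoord F A x₀ y)) := by
  set φ := extChartAt 𝓘(ℝ, E) x₀ with hφ
  set e := trivializationAt F A x₀ with he
  have hUe : ∀ y ∈ U, y ∈ e.baseSet := fun y hy => h.mem_baseSet y (hUW hy)
  have hUφ : ∀ y ∈ U, y ∈ φ.source := fun y hy => h.mem_source y (hUW hy)
  have hφU : ContMDiffOn 𝓘(ℝ, E) 𝓘(ℝ, E) ∞ φ U :=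
    (contMDiffOn_extChartAt (I := 𝓘(ℝ, E)) (n := ∞) (x := x₀)).mono fun y hy => by
      rw [← extChartAt_source 𝓘(ℝ, E)]
      exact hUφ y hy
  have hΨU : ContMDiffOn 𝓘(ℝ, E) 𝓘(ℝ, F →L[ℝ] F) ∞ (fun y => Ψ (φ y)) U :=
    (contMDiffOn_iff_contDiffOn.2 hΨ).comp hφU hUs
  have hinv : ContDiffOn ℝ ∞ (fun z => Ring.inverse (Ψ z)) s := by
    intro z hz
    obtain ⟨u, hu⟩ := hunit z hz
    have h1 : ContDiffAt ℝ ∞ Ring.inverse (Ψ z) := hu ▸ contDiffAt_ringInverse ℝ u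
    exact h1.comp_contDiffWithinAt z (hΨ z hz)
  have hinvU : ContMDiffOn 𝓘(ℝ, E) 𝓘(ℝ, F →L[ℝ] F) ∞ (fun y => Ring.inverse (Ψ (φ y))) U :=
    (contMDiffOn_iff_contDiffOn.2 hinv).comp hφU hUs
  have hr : ∀ y ∈ U, ∀ v, Ψ (φ y) (Ring.inverse (Ψ (φ y)) v) = v := fun y hy v =>
    DFunLike.congr_fun (Ring.mul_inverse_cancel _ (hunit _ (hUs y hy))) v
  have hl : ∀ y ∈ U, ∀ v, Ring.inverse (Ψ (φ y)) (Ψ (φ y) v) = v := fun y hy v =>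
    DFunLike.congr_fun (Ring.inverse_mul_cancel _ (hunit _ (hUs y hy))) v
  constructor
  · intro y hy v
    simp only [ContinuousLinearMap.comp_apply]
    rw [fiberCoord_symmL (hUe y hy), hr y hy]
  · intro y hy v
    simp only [ContinuousLinearMap.comp_apply]
    rw [hl y hy, symmL_fiberCoord (hUe y hy)]
  · have h1 : ContMDiffOn (𝓘(ℝ, E).prod 𝓘(ℝ, F)) (𝓘(ℝ, E).prod 𝓘(ℝ, F)) ∞
        (fun p : M × F => ((p.1, Ring.inverse (Ψ (φ p.1)) p.2) : M × F)) {p | p.1 ∈ U} :=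
      contMDiffOn_fst.prodMk ((hinvU.comp contMDiffOn_fst fun _ hp => hp).clm_apply
        contMDiffOn_snd)
    have h2 := (e.contMDiffOn_symm (IB := 𝓘(ℝ, E)) (n := ∞)).comp h1 fun p hp =>
      e.mem_target.2 (hUe p.1 hp)
    refine h2.congr fun p hp => ?_
    simp only [ContinuousLinearMap.comp_apply, Function.comp]
    rw [e.symmL_apply (hUe p.1 hp)]
    exact e.mk_symm (hUe p.1 hp) _
  · have h0 : ContMDiffOn (𝓘(ℝ, E).prod 𝓘(ℝ, F)) 𝓘(ℝ, E) ∞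
        (fun p : TotalSpace F A => p.1) {p | p.1 ∈ U} := (contMDiff_proj A).contMDiffOn
    have h1 : ContMDiffOn (𝓘(ℝ, E).prod 𝓘(ℝ, F)) 𝓘(ℝ, F) ∞
        (fun p : TotalSpace F A => (e p).2) {p | p.1 ∈ U} :=
      contMDiffOn_snd.comp (t := univ) ((e.contMDiffOn (IB := 𝓘(ℝ, E)) (n := ∞)).mono
        fun p hp => e.mem_source.2 (hUe p.1 hp)) fun _ _ => mem_univ _
    have h2 := h0.prodMk ((hΨU.comp h0 fun _ hp => hp).clm_apply h1)
    refine h2.congr fun p hp => ?_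
    simp only [ContinuousLinearMap.comp_apply, Function.comp]
    rw [fiberCoord_apply (hUe p.1 hp)]
  · intro Y y hy w
    have hz := hUs y hy
    have hdΨ : DifferentiableAt ℝ Ψ (φ y) :=
      (hΨ.contDiffAt (hs.mem_nhds hz)).differentiableAt (by simp)
    have hdΨ' : MDifferentiableAt 𝓘(ℝ, E) 𝓘(ℝ, F →L[ℝ] F) (Ψ ∘ φ) y :=
      (hΨU.contMDiffAt (U.isOpen.mem_nhds hy)).mdifferentiableAt (by simp)
    -- With `c` the coordinates of `Y` and `θ` the connection form, `dΨ = Ψ θ` gives `d(Ψ c) = Ψ (dc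
    -- + θ c)`, and `dc + θ c` are the coordinates of `∇Y`.
    have h1 := mvfderiv_bilinear (ContinuousLinearMap.id ℝ (F →L[ℝ] F)) hdΨ'
      (mdifferentiableAt_fiberCoord (x₀ := x₀) Y (hUe y hy)) w
    rw [mvfderiv_comp_chart (hUφ y hy) hdΨ] at h1
    simp only [ContinuousLinearMap.comp_apply]
    refine Eq.trans ?_ h1.symm
    simp only [ContinuousLinearMap.id_apply, Function.comp]
    rw [hd _ hz, chartConnForm_dChart (hUφ y hy), h.fiberCoord_cov Y (hUW hy), map_add, add_comm]

/-- A transitive post-Lie algebroid has parallel frames near every point. -/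
theorem exists_isParallelFrame (hρ : ρ.IsTransitive)
    (hP : IsPostLieAlgebroid ρ br (inducedConnection ρ cov)) (x₀ : M) :
    ∃ (U : TopologicalSpace.Opens M) (hom : ∀ x : M, F →L[ℝ] A x) (inv : ∀ x : M, A x →L[ℝ] F),
      x₀ ∈ U ∧ IsParallelFrame cov U hom inv := by
  obtain ⟨σ, W, hx₀, h⟩ := exists_isLocalCoords (E := E) (A := A) (Module.finBasis ℝ F) x₀
  set φ := extChartAt 𝓘(ℝ, E) x₀ with hφ
  have hxs : x₀ ∈ φ.source := mem_extChartAt_source x₀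
  let θ := chartConnForm cov x₀ (Module.finBasis ℝ F) σ
  -- The unknown is an endomorphism `Ψ` with `dΨ = Ψ θ`, a linear system whose coefficient is right
  -- multiplication by `θ`. Right multiplication reverses products, which matches the order of
  -- factors in `IsLocalCoords.flat`.
  let R := (ContinuousLinearMap.compL ℝ F F F).flip
  let s := φ.target ∩ φ.symm ⁻¹' W
  have hs : IsOpen s := isOpen_chart_target_inter x₀ W
  have hzs : φ x₀ ∈ s :=
    ⟨φ.map_source hxs, by rw [mem_preimage, φ.left_inv hxs]; exact hx₀⟩
  have hθ : ContDiffOn ℝ ∞ θ s := contDiffOn_chartConnForm h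
  let T := ContinuousLinearMap.compL ℝ E (F →L[ℝ] F) ((F →L[ℝ] F) →L[ℝ] (F →L[ℝ] F)) R
  have hL : ContDiffOn ℝ ∞ (fun z => T (θ z)) s := T.contDiff.comp_contDiffOn hθ
  have hfd : ∀ z ∈ s, ∀ k l Φ, fderiv ℝ (fun z => T (θ z)) z k l Φ =
      Φ.comp (fderiv ℝ θ z k l) := by
    intro z hz k l Φ
    have hd : DifferentiableAt ℝ θ z :=
      (hθ.contDiffAt (hs.mem_nhds hz)).differentiableAt (by simp)
    have := (T.hasFDerivAt.comp z hd.hasFDerivAt).fderiv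
    change fderiv ℝ (T ∘ θ) z k l Φ = _
    rw [this]
    rfl
  have hflat : ∀ z ∈ s, IsFlatSystemAt (fun z => T (θ z)) z := by
    intro z hz k l
    ext Φ v
    have := congrArg Φ (DFunLike.congr_fun (h.flat hρ hP hz k l) v)
    simp only [add_apply, ContinuousLinearMap.comp_apply, map_add, hfd z hz] at this ⊢
    exact this
  obtain ⟨r, hr, hrs, Ψ, hΨ₀, hΨ, hdΨ⟩ :=
    exists_flat_solution (hs.mem_nhds hzs) hL hflat (1 : F →L[ℝ] F)
  -- `Ψ` starts at the identity, and units form an open set, so `Ψ` stays invertible after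
  -- shrinking.
  let s' := Metric.ball (φ x₀) r ∩ Ψ ⁻¹' {Φ | IsUnit Φ}
  have hs' : IsOpen s' := hΨ.continuousOn.isOpen_inter_preimage Metric.isOpen_ball Units.isOpen
  let U : TopologicalSpace.Opens M :=
    ⟨φ.source ∩ φ ⁻¹' s', (continuousOn_extChartAt x₀).isOpen_inter_preimage
      (isOpen_extChartAt_source x₀) hs'⟩
  have hUW : U ≤ W := fun y hy => by
    have := (hrs hy.2.1).2
    rwa [mem_preimage, φ.left_inv hy.1] at this
  refine ⟨U, _, _, ⟨hxs, Metric.mem_ball_self hr, ?_⟩, h.isParallelFrame hUW hs'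
    (fun y hy => hy.2) (hΨ.mono inter_subset_left) (fun z hz => hz.2) fun z hz k v => ?_⟩
  · change IsUnit (Ψ (φ x₀))
    rw [hΨ₀]
    exact isUnit_one
  · rw [(hdΨ z hz.1).fderiv]
    rfl

end LocalParallelFrame

/-! ### Locally constant cocycles and covering spaces. -/

section LocallyConstantCocycle

open Set Filter Topology

/-- A locally constant cocycle over a simply connected space has a global section through every
point. -/
theorem exists_section_of_locally_constant_cocycle {B ι F : Type*} [TopologicalSpace B]
    [SimplyConnectedSpace B] [LocallyPathConnectedSpace B] {U : ι → Set B} (hU : ∀ i, IsOpen (U i))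
    {idx : B → ι} (hidx : ∀ x, x ∈ U (idx x)) {g : ι → ι → B → F → F}
    (hself : ∀ i, ∀ x ∈ U i, ∀ v, g i i x v = v)
    (hcomp : ∀ i j k, ∀ x ∈ U i ∩ U j ∩ U k, ∀ v, g j k x (g i j x v) = g i k x v)
    (hconst : ∀ i j, ∀ x ∈ U i ∩ U j, ∀ v, ∀ᶠ y in 𝓝 x, g i j y v = g i j x v) (x₀ : B) (v₀ : F) :
    ∃ s : B → F, s x₀ = v₀ ∧ ∀ x i, x ∈ U i →
      ∀ᶠ y in 𝓝 x, g (idx y) i y (s y) = g (idx x) i x (s x) := by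
  -- With discrete fiber a locally constant cocycle glues to a fiber bundle that is a covering, and
  -- continuity of a section means that its local coordinates are locally constant.
  let _ : TopologicalSpace F := ⊥
  have : DiscreteTopology F := ⟨rfl⟩
  let Z : FiberBundleCore ι B F :=
    { baseSet := U
      isOpen_baseSet := hU
      indexAt := idx
      mem_baseSet_at := hidx
      coordChange := g
      coordChange_self := hself
      continuousOn_coordChange := by
        rintro i j ⟨x, v⟩ ⟨hx, -⟩
        have h1 : ∀ᶠ p : B × F in 𝓝 (x, v), g i j p.1 p.2 = g i j x v := by
          rw [nhds_prod_eq, nhds_discrete F, prod_pure, eventually_map]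
          exact hconst i j x hx v
        exact (continuousAt_const.congr (EventuallyEq.symm h1)).continuousWithinAt
      coordChange_comp := hcomp }
  have hcov : IsCoveringMap (π F Z.Fiber) := FiberBundle.isCoveringMap
  -- A lift of the identity through the covering is a section; simple connectedness makes the lift
  -- exist.
  obtain ⟨s, ⟨hs₀, hs⟩, -⟩ := hcov.existsUnique_continuousMap_lifts (ContinuousMap.id B) x₀
    (⟨x₀, v₀⟩ : TotalSpace F Z.Fiber) rfl
  have hs1 : ∀ x, (s x).1 = x := congrFun hs
  let s' : B → F := fun x => (s x).2
  refine ⟨s', ?_, fun x i hx => ?_⟩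
  · have := congrArg (fun p : TotalSpace F Z.Fiber => (p.2 : F)) hs₀
    exact this
  · have h1 : ContinuousAt (fun y => (Z.localTriv i (s y)).2) x := by
      refine continuous_snd.continuousAt.comp (ContinuousAt.comp
        ((Z.localTriv i).continuousAt ?_) s.continuous.continuousAt)
      rw [Z.mem_localTriv_source, ← Z.baseSet_at, hs1]
      exact hx
    have h2 : ∀ y, (Z.localTriv i (s y)).2 = g (idx y) i y (s' y) := by
      intro y
      rw [Z.localTriv_apply]
      change g (idx (s y).1) i (s y).1 (s' y) = _
      rw [hs1]
    simp only [h2] at h1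
    have := h1.eventually (show ∀ᶠ v in 𝓝 (g (idx x) i x (s' x)), v = g (idx x) i x (s' x) by
      rw [nhds_discrete]
      exact eventually_pure.2 rfl)
    exact this

end LocallyConstantCocycle

/-! ### Global parallel frames on simply connected manifolds. -/

section Global

open Set Filter Topology

variable {E : Type*} [NormedAddCommGroup E] [NormedSpace ℝ E]
  {M : Type*} [TopologicalSpace M] [ChartedSpace E M] [IsManifold 𝓘(ℝ, E) ∞ M]
  {F : Type*} [NormedAddCommGroup F] [NormedSpace ℝ F]
  {A : M → Type*} [TopologicalSpace (TotalSpace F A)]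
  [∀ x, AddCommGroup (A x)] [∀ x, Module ℝ (A x)] [∀ x, TopologicalSpace (A x)]
  [FiberBundle F A] [VectorBundle ℝ F A]
  [∀ x, IsTopologicalAddGroup (A x)] [∀ x, ContinuousSMul ℝ (A x)]
  [FiniteDimensional ℝ E] [T2Space M] [FiniteDimensional ℝ F]
  {cov : CovariantDerivative 𝓘(ℝ, E) F A}

/-- On a simply connected manifold, local parallel frames give a global one. -/
theorem exists_isParallelFrame_top [SimplyConnectedSpace M]
    (H : ∀ x : M, ∃ (U : TopologicalSpace.Opens M) (hom : ∀ x : M, F →L[ℝ] A x)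
      (inv : ∀ x : M, A x →L[ℝ] F), x ∈ U ∧ IsParallelFrame cov U hom inv) :
    ∃ (hom : ∀ x : M, F →L[ℝ] A x) (inv : ∀ x : M, A x →L[ℝ] F),
      IsParallelFrame cov ⊤ hom inv := by
  have : LocallyPathConnectedSpace M := ChartedSpace.locallyPathConnectedSpace E M
  choose U hom inv hU hfr using H
  let IsPar : (∀ x : M, A x) → Prop := fun S => ∀ x i, x ∈ U i →
    ∀ᶠ y in 𝓝 x, inv i y (S y) = inv i x (S x)
  have hadd : ∀ S T, IsPar S → IsPar T → IsPar (S + T) := by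
    intro S T hS hT x i hi
    filter_upwards [hS x i hi, hT x i hi] with y h1 h2
    simp only [Pi.add_apply, map_add, h1, h2]
  have hsmul : ∀ (r : ℝ) S, IsPar S → IsPar (r • S) := by
    intro r S hS x i hi
    filter_upwards [hS x i hi] with y h1
    simp only [Pi.smul_apply, map_smul, h1]
  have hinj : ∀ i, ∀ x ∈ U i, ∀ a, inv i x a = 0 → a = 0 := by
    intro i x hx a ha
    rw [← (hfr i).hom_inv x hx a, ha, map_zero]
  -- Near any point the coordinates of a parallel section are constant, so both its zero set and the
  -- complement are open; `M` is connected.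
  have hzero : ∀ S, IsPar S → ∀ x, S x = 0 → ∀ y, S y = 0 := by
    intro S hS x hx
    have hcl : IsClopen {y | S y = 0} := by
      constructor
      · rw [← isOpen_compl_iff, isOpen_iff_mem_nhds]
        intro y hy
        filter_upwards [hS y y (hU y)] with z hz hz0
        rw [hz0, map_zero] at hz
        exact hy (hinj y y (hU y) _ hz.symm)
      · rw [isOpen_iff_mem_nhds]
        intro y hy
        filter_upwards [hS y y (hU y), (U y).isOpen.mem_nhds (hU y)] with z hz hzU
        rw [show S y = 0 from hy, map_zero] at hz
        exact hinj y z hzU _ hz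
    intro y
    have := hcl.eq_univ ⟨x, hx⟩
    exact (this ▸ mem_univ y : y ∈ {y | S y = 0})
  have hex : ∀ x (a : A x), ∃ S, IsPar S ∧ S x = a := by
    intro x a
    -- The local frames are indexed by the points of `M`, so the index function is `id` and the
    -- cocycle consists of the transition functions between frames.
    obtain ⟨s, hs₀, hs⟩ := exists_section_of_locally_constant_cocycle
      (U := fun i => (U i : Set M)) (fun i => (U i).isOpen) (idx := id) hU
      (g := fun i j x v => inv j x (hom i x v)) (fun i x hx v => (hfr i).inv_hom x hx v)
      (fun i j k x hx v => by rw [(hfr j).hom_inv x hx.1.2])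
      (fun i j x hx v => (hfr i).eventually_inv_hom_eq (hfr j) v hx.1 hx.2) x (inv x x a)
    refine ⟨fun y => hom y y (s y), fun y i hy => hs y i hy, ?_⟩
    simp only [hs₀, (hfr x).hom_inv x (hU x)]
  obtain ⟨x₀⟩ : Nonempty M := inferInstance
  -- `S v` is the global parallel section extending `hom x₀ x₀ v`; uniqueness of such extensions
  -- makes `S` linear in `v`.
  choose S hS hS₀ using fun v : F => hex x₀ (hom x₀ x₀ v)
  have huniq : ∀ S T, IsPar S → IsPar T → ∀ x, S x = T x → S = T := by
    intro S T hS hT x hx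
    have h1 := hzero (S + (-1 : ℝ) • T) (hadd _ _ hS (hsmul _ _ hT)) x (by
      simp [hx])
    ext y
    have := h1 y
    simp only [Pi.add_apply, neg_smul, one_smul] at this
    exact add_neg_eq_zero.1 this
  have hSadd : ∀ v w, S (v + w) = S v + S w := fun v w =>
    huniq _ _ (hS _) (hadd _ _ (hS _) (hS _)) x₀ (by simp only [hS₀, Pi.add_apply, map_add])
  have hSsmul : ∀ (r : ℝ) v, S (r • v) = r • S v := fun r v =>
    huniq _ _ (hS _) (hsmul _ _ (hS _)) x₀ (by simp only [hS₀, Pi.smul_apply, map_smul])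
  let Hom : ∀ x : M, F →L[ℝ] A x := fun x => LinearMap.toContinuousLinearMap
    { toFun := fun v => S v x
      map_add' := fun v w => congrFun (hSadd v w) x
      map_smul' := fun r v => congrFun (hSsmul r v) x }
  have hHom : ∀ x v, Hom x v = S v x := fun x v => rfl
  have hbij : ∀ x, Function.Bijective (Hom x) := by
    intro x
    constructor
    · rw [injective_iff_map_eq_zero]
      intro v hv
      have h1 := hzero (S v) (hS v) x hv x₀
      rw [hS₀] at h1
      rw [← (hfr x₀).inv_hom x₀ (hU x₀) v, h1, map_zero]
    · intro a
      obtain ⟨T, hT, rfl⟩ := hex x a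
      refine ⟨inv x₀ x₀ (T x₀), ?_⟩
      rw [hHom, huniq (S (inv x₀ x₀ (T x₀))) T (hS _) hT x₀ (by
        rw [hS₀, (hfr x₀).hom_inv x₀ (hU x₀)])]
  have hTbij : ∀ x, Function.Bijective ((inv x x).comp (Hom x) : F →L[ℝ] F) := by
    intro x
    have h1 : Function.Bijective (inv x x) :=
      ⟨(injective_iff_map_eq_zero (inv x x)).2 (hinj x x (hU x)),
        fun v => ⟨hom x x v, (hfr x).inv_hom x (hU x) v⟩⟩
    exact h1.comp (hbij x)
  let T : ∀ x : M, F ≃L[ℝ] F := fun x => (LinearEquiv.ofBijective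
    ((inv x x).comp (Hom x) : F →L[ℝ] F).toLinearMap (hTbij x)).toContinuousLinearEquiv
  have hT : ∀ x v, T x v = inv x x (S v x) := fun x v => rfl
  refine ⟨Hom, fun x => ((T x).symm : F →L[ℝ] F).comp (inv x x),
    IsParallelFrame.of_locally (V' := F) fun x _ => ?_⟩
  let b := Module.finBasis ℝ F
  -- Each `S v` has locally constant coordinates; a finite basis gives one neighbourhood for all
  -- `v`. There the global frame is the local one composed with the constant isomorphism `T x`.
  have hev : ∀ᶠ y in 𝓝 x, ∀ v, inv x y (Hom y v) = T x v := by
    filter_upwards [eventually_all.2 fun i => hS (b i) x x (hU x)] with y hy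
    have h1 : ((inv x y).comp (Hom y)).toLinearMap = (T x).toLinearEquiv.toLinearMap :=
      b.ext fun i => hy i
    exact fun v => LinearMap.congr_fun h1 v
  obtain ⟨O, hO, hOo, hxO⟩ := eventually_nhds_iff.1 hev
  let U' : TopologicalSpace.Opens M := U x ⊓ ⟨O, hOo⟩
  have hhom : ∀ y ∈ U', ∀ v, Hom y v = hom x y (T x v) := by
    intro y hy v
    rw [← hO y hy.2 v, (hfr x).hom_inv y hy.1]
  refine ⟨U', hom x, inv x, T x, ⟨hU x, hxO⟩, (hfr x).mono inf_le_left, hhom, fun y hy a => ?_⟩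
  obtain ⟨v, rfl⟩ := (hbij y).2 a
  rw [ContinuousLinearMap.comp_apply, hO y hy.2 v, (T x).symm_apply_apply]
  exact (T y).symm_apply_apply v

end Global

/-! ### From post-Lie algebroids to action algebroids, locally and globally. -/

section Local

open Set Filter Topology

variable {E : Type*} [NormedAddCommGroup E] [NormedSpace ℝ E] [FiniteDimensional ℝ E]
  {M : Type*} [TopologicalSpace M] [T2Space M] [ChartedSpace E M] [IsManifold 𝓘(ℝ, E) ∞ M]
  {F : Type*} [NormedAddCommGroup F] [NormedSpace ℝ F] [FiniteDimensional ℝ F]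
  {A : M → Type*} [TopologicalSpace (TotalSpace F A)]
  [∀ x, AddCommGroup (A x)] [∀ x, Module ℝ (A x)] [∀ x, TopologicalSpace (A x)]
  [∀ x, IsTopologicalAddGroup (A x)] [∀ x, ContinuousSMul ℝ (A x)]
  [FiberBundle F A] [VectorBundle ℝ F A] [ContMDiffVectorBundle ∞ F A 𝓘(ℝ, E)]
  {ρ : Anchor 𝓘(ℝ, E) F A}
  {br : Cₛ^∞⟮𝓘(ℝ, E); F, A⟯ → Cₛ^∞⟮𝓘(ℝ, E); F, A⟯ → Cₛ^∞⟮𝓘(ℝ, E); F, A⟯}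
  {cov : CovariantDerivative 𝓘(ℝ, E) F A}
  [hcov : CovariantDerivative.ContMDiffCovariantDerivative cov ∞]

/-- A transitive post-Lie algebroid is locally a transitive action algebroid. -/
theorem IsPostLieAlgebroid.isLocallyTransitiveActionAlgebroid (hρ : ρ.IsTransitive)
    (hP : IsPostLieAlgebroid ρ br (inducedConnection ρ cov)) :
    IsLocallyTransitiveActionAlgebroid ρ
      (algebroidBracket br (inducedConnection ρ cov)) cov := by
  intro x
  have : LocallyConnectedSpace M := ChartedSpace.locallyConnectedSpace E M
  obtain ⟨U, hom, inv, hx, h⟩ := exists_isParallelFrame hρ hP x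
  -- The structure constants are only locally constant, so the frame is restricted to a connected
  -- component of its domain, which is open in a manifold.
  let U' : TopologicalSpace.Opens M :=
    ⟨connectedComponentIn (U : Set M) x, U.isOpen.connectedComponentIn⟩
  have hU' : U' ≤ U := connectedComponentIn_subset (U : Set M) x
  have hx' : x ∈ U' := mem_connectedComponentIn hx
  -- The Lie algebra has to live in `Type`, whereas `F` may lie in any universe; the coordinate
  -- space replaces it.
  let T : (Fin (Module.finrank ℝ F) → ℝ) ≃L[ℝ] F :=
    (Module.finBasis ℝ F).equivFun.symm.toContinuousLinearEquiv
  exact ⟨U', hx', ((h.mono hU').comp_equiv T).isTransitiveActionAlgebroidOver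
    isPreconnected_connectedComponentIn ⟨x, hx'⟩ hρ hP⟩

/-- A transitive post-Lie algebroid over a simply connected manifold is a transitive action
algebroid. -/
theorem IsPostLieAlgebroid.isTransitiveActionAlgebroidOver_top [SimplyConnectedSpace M]
    (hρ : ρ.IsTransitive) (hP : IsPostLieAlgebroid ρ br (inducedConnection ρ cov)) :
    IsTransitiveActionAlgebroidOver ⊤ ρ
      (algebroidBracket br (inducedConnection ρ cov)) cov := by
  obtain ⟨hom, inv, h⟩ := exists_isParallelFrame_top (exists_isParallelFrame hρ hP)
  let T : (Fin (Module.finrank ℝ F) → ℝ) ≃L[ℝ] F :=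
    (Module.finBasis ℝ F).equivFun.symm.toContinuousLinearEquiv
  exact (h.comp_equiv T).isTransitiveActionAlgebroidOver isPreconnected_univ univ_nonempty hρ hP

end Local

end Algebroid

end

theorem mainTheorem1
    {E : Type*} [NormedAddCommGroup E] [NormedSpace ℝ E] [FiniteDimensional ℝ E]
    {M : Type*} [TopologicalSpace M] [T2Space M] [SecondCountableTopology M]
    [ChartedSpace E M] [IsManifold 𝓘(ℝ, E) ∞ M]
    {F : Type*} [NormedAddCommGroup F] [NormedSpace ℝ F] [FiniteDimensional ℝ F]
    {A : M → Type*} [TopologicalSpace (TotalSpace F A)]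
    [∀ x, AddCommGroup (A x)] [∀ x, Module ℝ (A x)] [∀ x, TopologicalSpace (A x)]
    [∀ x, IsTopologicalAddGroup (A x)] [∀ x, ContinuousSMul ℝ (A x)]
    [FiberBundle F A] [VectorBundle ℝ F A] [ContMDiffVectorBundle ∞ F A 𝓘(ℝ, E)]
    (ρ : Anchor 𝓘(ℝ, E) F A) (hρ : ρ.IsTransitive)
    (cov : CovariantDerivative 𝓘(ℝ, E) F A)
    [CovariantDerivative.ContMDiffCovariantDerivative cov ∞]
    (br : Cₛ^∞⟮𝓘(ℝ, E); F, A⟯ → Cₛ^∞⟮𝓘(ℝ, E); F, A⟯ → Cₛ^∞⟮𝓘(ℝ, E); F, A⟯) :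
    (IsPostLieAlgebroid ρ br (inducedConnection ρ cov) ↔
      IsLocallyTransitiveActionAlgebroid ρ
        (algebroidBracket br (inducedConnection ρ cov)) cov) ∧
    (SimplyConnectedSpace M →
      (IsPostLieAlgebroid ρ br (inducedConnection ρ cov) ↔
        IsTransitiveActionAlgebroidOver ⊤ ρ
          (algebroidBracket br (inducedConnection ρ cov)) cov)) := by
  have hconv : IsLocallyTransitiveActionAlgebroid ρ
      (algebroidBracket br (inducedConnection ρ cov)) cov →
        IsPostLieAlgebroid ρ br (inducedConnection ρ cov) :=
    fun h => h.isPostLieAlgebroid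
  exact ⟨⟨fun h => h.isLocallyTransitiveActionAlgebroid hρ, hconv⟩, fun _ =>
    ⟨fun h => h.isTransitiveActionAlgebroidOver_top hρ,
      -- A global isomorphism serves as the local one at every point.
      fun h => hconv fun _ => ⟨⊤, trivial, h⟩⟩⟩
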